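/- Let $n\ge 1$, let $V=\{x\in\mathbb R^{n+1}:\sum_k x_k=0\}$, with simple roots $\alpha_i=e_i-e_{i+1}$ ($1\le i\le n$), almost positive roots $\Phi_{\ge -1}=\{e_i-e_j: i<j\}\cup\{-\alpha_1,\dots,-\alpha_n\}$, and simple reflections $s_i=(i\ i{+}1)\in S_{n+1}$. *The $c$-cluster fan.* A Coxeter element is a product of $s_1,\dots,s_n$, each used once, in some order; $s$ is initial in it if some such product starts with $s$. Let $\sigma_{s}$ fix $-\alpha_t$ for $t\neq s$ and act as the reflection $s$ on the other almost positive roots. Reading's $c$-compatibility relations $\|_c$ on $\Phi_{\ge-1}$ are the family, indexed by the Coxeter elements $c$, such that (i) $-\alpha_s\,\|_c\,\beta$ if and only if $\beta$ lies in the span of the $\alpha_t$ with $t\ne s$, and (ii) for $s$ initial in $c$, $\alpha\,\|_c\,\beta$ if and only if $\sigma_s\alpha\,\|_{scs}\,\sigma_s\beta$. The $c$-cluster fan is the set of cones $\mathbb R_{\ge0}C$, where $C\subseteq\Phi_{\ge-1}$ is a set of pairwise $c$-compatible roots. A sequence of signs $c\in\{+,-\}^{n-1}$ represents the Coxeter element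 in which $s_{i+1}$ comes after $s_i$ if $c_i=+$ and before $s_i$ if $c_i=-$. *Path triangulations.* Let $T_c$ be a triangulation of a convex $(n+3)$-gon whose dual tree is a path, and let $\delta_1,\dots,\delta_n$ be its diagonals in the order of the path. It encodes $c\in\{+,-\}^{n-1}$ if, at the triangle between $\delta_i$ and $\delta_{i+1}$, the dual path turns right when $c_i=+$ and left when $c_i=-$. *The associahedron.* For a diagonal $pq$ of the polygon let $v_{pq}=-\alpha_i$ if $pq=\delta_i$, and $v_{pq}=\sum_{i:\,pq\text{ crosses }\delta_i}\alpha_i$ if $pq\notin T_c$. Call $\omega=(\omega_{pq})$, $\omega_{pq}>0$, admissible if, for any two triangulations $T_1,T_2$ related by a flip that exchanges $d_1$ and $d_2$, each linear dependence $\sum_{d\in T_1\cup T_2}\mu_d v_d=0$ with $\mu_{d_1},\mu_{d_2}>0$ satisfies $\sum_d\mu_d\omega_d>0$. Let $\mathrm{Ass}^{\mathrm{II}}(T_c)=\{x\in V^*: x(v_{pq})\le\omega_{pq}\text{ for all diagonals }pq\}$ for an admissible $\omega$. **Proposition.** The family $(\|_c)_c$ exists and is unique. Every $c\in\{+,-\}^{n-1}$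 represents a Coxeter element and is encoded by some path triangulation. For each path triangulation $T_c$ encoding $c$, admissible weights $\omega$ exist, and for every admissible $\omega$ the set $\mathrm{Ass}^{\mathrm{II}}(T_c)$ is a polytope whose (exterior) normal fan in $V$ coincides with the $c$-cluster fan of type $A_n$. In particular, for every Coxeter element $c$ of $S_{n+1}$ the $c$-cluster fan is the normal fan of a polytope. -/

import Mathlib

open scoped NNReal

namespace CClusterFan

/-! ## The root system of type `A_n` and Coxeter elements -/

/-- The space `V = {x ∈ ℝ^{n+1} : ∑ x_k = 0}`. -/
def rootSpace (n : ℕ) : Submodule ℝ (Fin (n + 1) → ℝ) where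
  carrier := {x | ∑ k, x k = 0}
  add_mem' := by
    intro a b ha hb
    simp only [Set.mem_ofPred_eq] at ha hb ⊢
    simp [Finset.sum_add_distrib, ha, hb]
  zero_mem' := by simp
  smul_mem' := by
    intro c x hx
    simp only [Set.mem_ofPred_eq] at hx ⊢
    simp [← Finset.mul_sum, hx]

/-- The vector `e_i - e_j`. -/
def rootVec {n : ℕ} (i j : Fin (n + 1)) : rootSpace n :=
  ⟨Pi.single i 1 - Pi.single j 1, by
    change ∑ k, (Pi.single i 1 - Pi.single j 1 : Fin (n + 1) → ℝ) k = 0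
    simp [Finset.sum_sub_distrib]⟩

/-- The simple roots `α_i = e_i - e_{i+1}`. -/
def simpleRoot {n : ℕ} (i : Fin n) : rootSpace n := rootVec i.castSucc i.succ

/-- The almost positive roots: the positive roots `e_i - e_j`, `i < j`, together with the
negatives of the simple roots. -/
def almostPositiveRoots (n : ℕ) : Set (rootSpace n) :=
  {v | ∃ i j : Fin (n + 1), i < j ∧ v = rootVec i j} ∪ {v | ∃ i : Fin n, v = -simpleRoot i}

/-- The almost positive roots of the parabolic root subsystem spanned by the simple roots
other than `α_s`. -/
def parabolicAlmostPositiveRoots {n : ℕ} (s : Fin n) : Set (rootSpace n) :=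
  almostPositiveRoots n ∩ Submodule.span ℝ {v | ∃ t : Fin n, t ≠ s ∧ v = simpleRoot t}

/-- The Weyl group `S_{n+1}` acts on `V` by permuting coordinates: `w e_k = e_{w k}`. -/
def permAct {n : ℕ} (w : Equiv.Perm (Fin (n + 1))) (v : rootSpace n) : rootSpace n :=
  ⟨fun k => v.1 (w⁻¹ k), by
    change ∑ k, v.1 (w⁻¹ k) = 0
    rw [Equiv.sum_comp w⁻¹ v.1]
    exact v.2⟩

/-- The simple reflection `s_i`, the transposition of `i` and `i+1`. -/
def simpleReflection {n : ℕ} (i : Fin n) : Equiv.Perm (Fin (n + 1)) :=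
  Equiv.swap i.castSucc i.succ

/-- A word in which each simple generator occurs exactly once. -/
def IsCoxeterWord {n : ℕ} (l : List (Fin n)) : Prop := l.Nodup ∧ ∀ i, i ∈ l

/-- The element of `S_{n+1}` given by a word in the simple generators. -/
def wordProd {n : ℕ} (l : List (Fin n)) : Equiv.Perm (Fin (n + 1)) :=
  (l.map simpleReflection).prod

/-- Coxeter elements: products of all the simple generators, in some order. -/
def IsCoxeterElement {n : ℕ} (w : Equiv.Perm (Fin (n + 1))) : Prop :=
  ∃ l : List (Fin n), IsCoxeterWord l ∧ wordProd l = w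

/-- The generator `s` is initial in the Coxeter element `w`. -/
def IsInitial {n : ℕ} (s : Fin n) (w : Equiv.Perm (Fin (n + 1))) : Prop :=
  ∃ l : List (Fin n), IsCoxeterWord (s :: l) ∧ wordProd (s :: l) = w

/-- `w` is the Coxeter element represented by the sequence of signs `c`: a product of all the
simple generators in an order in which `s_{i+1}` comes after `s_i` if the `i`-th sign is `+`, and
before `s_i` if the `i`-th sign is `-`. -/
def IsCoxeterElementOfSigns {n : ℕ} (c : Fin (n - 1) → ℤˣ) (w : Equiv.Perm (Fin (n + 1))) :
    Prop :=
  ∃ l : List (Fin n), IsCoxeterWord l ∧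
    (∀ i : Fin (n - 1),
      (c i = 1 → l.idxOf (⟨i, by omega⟩ : Fin n) < l.idxOf (⟨i + 1, by omega⟩ : Fin n)) ∧
      (c i = -1 → l.idxOf (⟨i + 1, by omega⟩ : Fin n) < l.idxOf (⟨i, by omega⟩ : Fin n))) ∧
    wordProd l = w

/-! ## `c`-compatibility and the `c`-cluster fan -/

open Classical in
/-- The involution `σ_s` of the almost positive roots: it fixes `-α_t` for `t ≠ s` and is the
reflection `s` on all other almost positive roots. -/
noncomputable def sigma {n : ℕ} (s : Fin n) (v : rootSpace n) : rootSpace n :=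
  if ∃ t : Fin n, t ≠ s ∧ v = -simpleRoot t then v else permAct (simpleReflection s) v

/-- The two conditions by which Reading defines the family of `c`-compatibility relations, where
`c` runs over the Coxeter elements:
(i) `-α_s ∥_c β` if and only if `β` lies in the parabolic subsystem that omits `s`;
(ii) if `s` is initial in `c`, then `α ∥_c β` if and only if `σ_s α ∥_{scs} σ_s β`. -/
structure IsCompatibilityFamily {n : ℕ}
    (R : Equiv.Perm (Fin (n + 1)) → rootSpace n → rootSpace n → Prop) : Prop where
  neg_simple_iff : ∀ w, IsCoxeterElement w → ∀ (s : Fin n), ∀ β ∈ almostPositiveRoots n,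
    (R w (-simpleRoot s) β ↔ β ∈ parabolicAlmostPositiveRoots s)
  sigma_iff : ∀ w (s : Fin n), IsInitial s w →
    ∀ α ∈ almostPositiveRoots n, ∀ β ∈ almostPositiveRoots n,
      (R w α β ↔
        R (simpleReflection s * w * simpleReflection s) (sigma s α) (sigma s β))

/-- The `c`-compatibility relations, generated by Reading's conditions (i) and (ii). -/
inductive CCompatible {n : ℕ} :
    Equiv.Perm (Fin (n + 1)) → rootSpace n → rootSpace n → Prop
  | base (w : Equiv.Perm (Fin (n + 1))) (s : Fin n) (β : rootSpace n)
      (hw : IsCoxeterElement w) (hβ : β ∈ parabolicAlmostPositiveRoots s) :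
      CCompatible w (-simpleRoot s) β
  | of_sigma (w : Equiv.Perm (Fin (n + 1))) (s : Fin n) (α β : rootSpace n)
      (hs : IsInitial s w) (hα : α ∈ almostPositiveRoots n) (hβ : β ∈ almostPositiveRoots n)
      (h : CCompatible (simpleReflection s * w * simpleReflection s) (sigma s α) (sigma s β)) :
      CCompatible w α β
  | to_sigma (w : Equiv.Perm (Fin (n + 1))) (s : Fin n) (α β : rootSpace n)
      (hs : IsInitial s w) (hα : α ∈ almostPositiveRoots n) (hβ : β ∈ almostPositiveRoots n)
      (h : CCompatible w α β) :
      CCompatible (simpleReflection s * w * simpleReflection s) (sigma s α) (sigma s β)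

/-- The cone `ℝ_{≥0} C`. -/
def cone {n : ℕ} (C : Set (rootSpace n)) : Set (rootSpace n) :=
  (Submodule.span ℝ≥0 C : Set (rootSpace n))

/-- The `c`-cluster fan: the cones spanned by the simplices of the `c`-cluster complex, that is,
by the sets of pairwise `c`-compatible almost positive roots. -/
def cClusterFan {n : ℕ} (w : Equiv.Perm (Fin (n + 1))) : Set (Set (rootSpace n)) :=
  {K | ∃ C : Set (rootSpace n), C ⊆ almostPositiveRoots n ∧ C.Pairwise (CCompatible w) ∧
    K = cone C}

/-! ## Polytopes and normal fans -/

/-- A polytope: the convex hull of a nonempty finite set. -/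
def IsPolytope {E : Type*} [AddCommGroup E] [Module ℝ E] (P : Set E) : Prop :=
  ∃ S : Set E, S.Finite ∧ S.Nonempty ∧ P = convexHull ℝ S

/-- The face of `P` on which the linear functional `v` is maximal. -/
def face {n : ℕ} (P : Set (Module.Dual ℝ (rootSpace n))) (v : rootSpace n) :
    Set (Module.Dual ℝ (rootSpace n)) :=
  {x | x ∈ P ∧ ∀ y ∈ P, y v ≤ x v}

/-- The (exterior) normal cone of a subset `F` of `P`. -/
def normalCone {n : ℕ} (P F : Set (Module.Dual ℝ (rootSpace n))) : Set (rootSpace n) :=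
  {v | ∀ x ∈ F, ∀ y ∈ P, y v ≤ x v}

/-- The normal fan of `P`: the normal cones of the nonempty faces of `P`. The polytope lives in
the dual space `V*` and its normal fan in `V`. -/
def normalFan {n : ℕ} (P : Set (Module.Dual ℝ (rootSpace n))) : Set (Set (rootSpace n)) :=
  {K | ∃ v : rootSpace n, (face P v).Nonempty ∧ K = normalCone P (face P v)}

/-! ## Triangulations of the convex `(n+3)`-gon -/

/-- Diagonals `pq`, `p < q`, of the convex `(n+3)`-gon whose vertices are labelled `0, …, n+2` in
counterclockwise order. -/
abbrev Diagonal (n : ℕ) : Type :=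
  {d : Fin (n + 3) × Fin (n + 3) //
    d.1.val + 1 < d.2.val ∧ ¬(d.1.val = 0 ∧ d.2.val = n + 2)}

/-- Two diagonals cross if they meet in their relative interiors. -/
def Crosses {n : ℕ} (d d' : Diagonal n) : Prop :=
  (d.1.1 < d'.1.1 ∧ d'.1.1 < d.1.2 ∧ d.1.2 < d'.1.2) ∨
  (d'.1.1 < d.1.1 ∧ d.1.1 < d'.1.2 ∧ d'.1.2 < d.1.2)

/-- Triangulations, given by their diagonals: maximal sets of pairwise noncrossing diagonals. -/
def IsTriangulation {n : ℕ} (T : Set (Diagonal n)) : Prop :=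
  (∀ d ∈ T, ∀ d' ∈ T, ¬Crosses d d') ∧ ∀ d, d ∉ T → ∃ d' ∈ T, Crosses d d'

/-- The two endpoints of a diagonal. -/
def endpoints {n : ℕ} (d : Diagonal n) : Finset (Fin (n + 3)) := {d.1.1, d.1.2}

/-- For `x < y`: the segment `xy` is an edge of the polygon or a diagonal in `T`. -/
def Joined {n : ℕ} (T : Set (Diagonal n)) (x y : Fin (n + 3)) : Prop :=
  x.val + 1 = y.val ∨ (x.val = 0 ∧ y.val = n + 2) ∨ ∃ d ∈ T, d.1 = (x, y)

/-- The triangles of `T`, given by their vertices. -/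
def IsTriangle {n : ℕ} (T : Set (Diagonal n)) (t : Finset (Fin (n + 3))) : Prop :=
  t.card = 3 ∧ ∀ x ∈ t, ∀ y ∈ t, x < y → Joined T x y

/-- The dual tree of `T`: its nodes are the triangles, and two triangles are adjacent if they share
a diagonal of `T`. -/
def dualTree {n : ℕ} (T : Set (Diagonal n)) :
    SimpleGraph {t : Finset (Fin (n + 3)) // IsTriangle T t} where
  Adj t t' := t ≠ t' ∧ ∃ d ∈ T, endpoints d ⊆ t.1 ∧ endpoints d ⊆ t'.1
  symm := ⟨fun _ _ ⟨h, d, hd, h1, h2⟩ => ⟨h.symm, d, hd, h2, h1⟩⟩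
  loopless := ⟨fun _ h => h.1 rfl⟩

/-- `x, y, z` appear in this counterclockwise order on the boundary of the polygon. -/
def Counterclockwise {m : ℕ} (x y z : Fin m) : Prop :=
  (x < y ∧ y < z) ∨ (y < z ∧ z < x) ∨ (z < x ∧ x < y)

/-- A path that enters a triangle through its edge `d` and leaves it through its edge `d'` turns
left: it turns around the common vertex `x` of `d = xy` and `d' = xz`, which is on its left. -/
def TurnsLeft {n : ℕ} (d d' : Diagonal n) : Prop :=
  ∃ x y z, endpoints d = {x, y} ∧ endpoints d' = {x, z} ∧ Counterclockwise x y z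

/-- The path turns right: the common vertex `x` of `d` and `d'` is on its right. -/
def TurnsRight {n : ℕ} (d d' : Diagonal n) : Prop :=
  ∃ x y z, endpoints d = {x, y} ∧ endpoints d' = {x, z} ∧ Counterclockwise x z y

/-- `T` is a path triangulation encoded by the signs `c`, and `δ_1, …, δ_n` are its diagonals in
the order in which they appear in the dual path: there is an isomorphism from the path with `n+1`
nodes to the dual tree, `δ_i` separates the consecutive triangles number `i` and `i+1`, and at the
triangle between `δ_i` and `δ_{i+1}` the path turns right if `c_i = +` and left if `c_i = -`. -/
def IsPathTriangulation {n : ℕ} (c : Fin (n - 1) → ℤˣ) (T : Set (Diagonal n))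
    (δ : Fin n → Diagonal n) : Prop :=
  IsTriangulation T ∧
  (∃ φ : SimpleGraph.pathGraph (n + 1) ≃g dualTree T,
    ∀ i : Fin n, δ i ∈ T ∧ endpoints (δ i) ⊆ (φ i.castSucc).1 ∧
      endpoints (δ i) ⊆ (φ i.succ).1) ∧
  ∀ i : Fin (n - 1),
    (c i = 1 → TurnsRight (δ ⟨i, by omega⟩) (δ ⟨i + 1, by omega⟩)) ∧
    (c i = -1 → TurnsLeft (δ ⟨i, by omega⟩) (δ ⟨i + 1, by omega⟩))

/-! ## The Santos associahedron -/

open Classical in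
/-- The vector `v_{pq}` of a diagonal with respect to the seed triangulation `{δ_1, …, δ_n}`:
`-α_i` if `pq = δ_i`, and the sum of the `α_i` with `pq` crossing `δ_i` if `pq` is not in the
seed triangulation. -/
noncomputable def diagVec {n : ℕ} (δ : Fin n → Diagonal n) (d : Diagonal n) : rootSpace n :=
  if d ∈ Set.range δ then ∑ i with d = δ i, -simpleRoot i
  else ∑ i with Crosses d (δ i), simpleRoot i

/-- The weights (right-hand sides) allowed in the construction: positive, and such that for each
flip between triangulations `T₁` and `T₂`, exchanging `d₁` and `d₂`, every linear dependence `μ`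
among the vectors of `T₁ ∪ T₂` that is positive on `d₁` and `d₂` satisfies `∑ μ_d ω_d > 0`. -/
def IsAdmissibleWeight {n : ℕ} (δ : Fin n → Diagonal n) (ω : Diagonal n → ℝ) : Prop :=
  (∀ d, 0 < ω d) ∧
  ∀ (T₁ T₂ : Set (Diagonal n)) (d₁ d₂ : Diagonal n),
    IsTriangulation T₁ → IsTriangulation T₂ → T₁ \ T₂ = {d₁} → T₂ \ T₁ = {d₂} →
    ∀ μ : Diagonal n → ℝ, (∀ d, d ∉ T₁ ∪ T₂ → μ d = 0) → ∑ d, μ d • diagVec δ d = 0 →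
      0 < μ d₁ → 0 < μ d₂ → 0 < ∑ d, μ d * ω d

/-- The associahedron `Ass^II` with seed triangulation `{δ_1, …, δ_n}` and weights `ω`, with the
inequalities `⟨v_{pq}, x⟩ ≤ ω_{pq}`. -/
def assII {n : ℕ} (δ : Fin n → Diagonal n) (ω : Diagonal n → ℝ) :
    Set (Module.Dual ℝ (rootSpace n)) :=
  {x | ∀ d, x (diagVec δ d) ≤ ω d}

end CClusterFan

namespace CClusterFan

/-! ## Polytopes with a prescribed simplicial normal fan -/

section Abstract

variable {n : ℕ} {D : Type*} [Fintype D]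

/-! Duality. The maximum of `u` over the polyhedron `{x | ∀ d, x (v d) ≤ ω d}` is the least cost `∑
l d * ω d` of an expression `u = ∑ l d • v d` with `l ≥ 0`. Suppose that a crossing pair can always
be traded for something cheaper with the same sum (`IsGoodWeight`), and that a noncrossing
combination is determined by its value (`IsFanData`). Then the cheapest expression is the unique
noncrossing one. Hence the normal cones are exactly the cones over noncrossing sets
(`normalFan_eq`), and finitely many tight points span the polyhedron (`isPolytope_of_isGoodWeight`).

Both compatibility of roots and noncrossing of diagonals are then identified with one relation,
`RootCross ε`, on almost positive roots, where `ε` assigns signs to indices. The root `e_a - e_b` is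
seen as an interval from `a` to `b`. Two intervals cross if they are consecutive, if they overlap
and the two inner endpoints have equal signs, or if they are nested and the two inner endpoints have
different signs. The root `-α_k` crosses the positive roots whose expansion contains `α_k`.
Noncrossing combinations are unique by `IsNoncrossingPlan.unique`.

Compatibility. The sign of `m` records whether the Coxeter element moves `m` up. Conjugation by an
initial `s_k` exchanges the signs at `k` and `k + 1`, and `σ_k` turns crossing for the old signs
into crossing for the new ones (`rootCross_flip`), which is Reading's condition (ii). Conversely,
(i) and (ii) leave no freedom: rotating once through a word of `w` applies `w⁻¹` to both ends of an
interval, and a suitable power carries the left end to the last index. On the way the order of the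
ends is reversed, and at that moment the root becomes a negative simple root, where (i) decides
(`IsCompatibilityFamily.iff_compatible`).

Diagonals. Along the dual path each sign says which end of the current diagonal advances, so
counting signs locates every `δ_k` up to rotation (`IsPathTriangulation.exists_endpoints`). The
diagonal that crosses exactly the `δ_k` with `a ≤ k < b` has the vector `e_a - e_b`, and
interleaving of endpoints becomes `RootCross` (`pos_cross_iff`).

Weights. The trade that resolves a crossing is a linear dependence attached to a flip, so admissible
and good weights coincide (`IsAdmissibleWeight.isGoodWeight`, `IsGoodWeight.isAdmissibleWeight`).
Explicit good weights come from a product formula (`isGoodWeight_explicitWeight`). -/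

/-- A nonnegative weight whose support contains no two crossing elements. -/
def IsNoncrossing (X : D → D → Prop) (l : D → ℝ) : Prop :=
  0 ≤ l ∧ ∀ d e, 0 < l d → 0 < l e → ¬X d e

/-- The vectors `v d` positively span, and noncrossing combinations of them are unique. -/
structure IsFanData (v : D → rootSpace n) (X : D → D → Prop) : Prop where
  irrefl : ∀ d, ¬X d d
  span : ∀ x, ∃ l : D → ℝ, 0 ≤ l ∧ Fintype.linearCombination ℝ v l = x
  uniq : ∀ l m : D → ℝ, IsNoncrossing X l → IsNoncrossing X m →
    Fintype.linearCombination ℝ v l = Fintype.linearCombination ℝ v m → l = m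

/-- Positive weights for which every crossing pair can be resolved at a strictly lower cost. -/
structure IsGoodWeight (v : D → rootSpace n) (X : D → D → Prop) (ω : D → ℝ) : Prop where
  pos : ∀ d, 0 < ω d
  resolve : ∀ d e, X d e → ∃ r : D → ℝ, 0 ≤ r ∧ Fintype.linearCombination ℝ v r = v d + v e ∧
    Fintype.linearCombination ℝ ω r < ω d + ω e

theorem mul_le_linearCombination {ω l : D → ℝ} (hω : ∀ d, 0 < ω d) (hl : 0 ≤ l) (d : D) :
    l d * ω d ≤ Fintype.linearCombination ℝ ω l := by
  rw [Fintype.linearCombination_apply]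
  exact Finset.single_le_sum (f := fun d => l d • ω d)
    (fun d _ => mul_nonneg (hl d) (hω d).le) (Finset.mem_univ d)

variable {v : D → rootSpace n} {X : D → D → Prop} {ω : D → ℝ}

/-- A crossing weight can be replaced by a cheaper one with the same combination. -/
theorem IsGoodWeight.exists_lt (hX : ∀ d, ¬X d d) (hω : IsGoodWeight v X ω) {l : D → ℝ}
    (hl : 0 ≤ l) (hc : ¬IsNoncrossing X l) :
    ∃ m : D → ℝ, 0 ≤ m ∧
      Fintype.linearCombination ℝ v m = Fintype.linearCombination ℝ v l ∧
      Fintype.linearCombination ℝ ω m < Fintype.linearCombination ℝ ω l := by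
  classical
  unfold IsNoncrossing at hc
  push Not at hc
  obtain ⟨d, e, hd, he, hde⟩ := hc hl
  have hne : d ≠ e := by rintro rfl; exact hX d hde
  obtain ⟨r, hr0, hr1, hr2⟩ := hω.resolve d e hde
  -- The largest multiple of `v d + v e` that can be removed from `l` without losing nonnegativity.
  set t := min (l d) (l e) with ht
  have ht0 : 0 < t := lt_min hd he
  -- Stated for an arbitrary family `u`, since it serves both the vectors `v` and the costs `ω`.
  have key : ∀ {F : Type} [AddCommGroup F] [Module ℝ F] (u : D → F),
      Fintype.linearCombination ℝ u (l - t • (Pi.single d 1 + Pi.single e 1) + t • r) =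
        Fintype.linearCombination ℝ u l - t • (u d + u e) +
          t • Fintype.linearCombination ℝ u r := by
    intro F _ _ u
    simp only [map_add, map_sub, map_smul, Fintype.linearCombination_apply_single, one_smul]
  refine ⟨l - t • (Pi.single d 1 + Pi.single e 1) + t • r, ?_, ?_, ?_⟩
  · intro g
    have h1 : 0 ≤ t * r g := mul_nonneg ht0.le (hr0 g)
    have h2 : t ≤ l d := min_le_left _ _
    have h3 : t ≤ l e := min_le_right _ _
    have h4 : 0 ≤ l g := hl g
    simp only [Pi.zero_apply, Pi.add_apply, Pi.sub_apply, Pi.smul_apply, smul_eq_mul]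
    by_cases hgd : g = d
    · subst hgd
      simp only [Pi.single_eq_same, Pi.single_eq_of_ne hne]
      linarith
    · by_cases hge : g = e
      · subst hge
        simp only [Pi.single_eq_same, Pi.single_eq_of_ne hgd]
        linarith
      · simp only [Pi.single_eq_of_ne hgd, Pi.single_eq_of_ne hge]
        linarith
  · rw [key, hr1]; abel
  · rw [key]
    simp only [smul_eq_mul]
    nlinarith

/-- Every vector is a noncrossing combination, and that combination is the cheapest one. -/
theorem IsGoodWeight.exists_noncrossing (h : IsFanData v X) (hω : IsGoodWeight v X ω)
    (x : rootSpace n) :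
    ∃ l : D → ℝ, IsNoncrossing X l ∧ Fintype.linearCombination ℝ v l = x ∧
      ∀ m : D → ℝ, 0 ≤ m → Fintype.linearCombination ℝ v m = x →
        Fintype.linearCombination ℝ ω l ≤ Fintype.linearCombination ℝ ω m := by
  obtain ⟨l₀, hl₀, hl₀x⟩ := h.span x
  set c := Fintype.linearCombination ℝ ω l₀ with hc
  let K : Set (D → ℝ) := {l | 0 ≤ l ∧ Fintype.linearCombination ℝ v l = x ∧
    Fintype.linearCombination ℝ ω l ≤ c}
  have hcv : Continuous (Fintype.linearCombination ℝ v) :=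
    LinearMap.continuous_of_finiteDimensional _
  have hcω : Continuous (Fintype.linearCombination ℝ ω) :=
    LinearMap.continuous_of_finiteDimensional _
  have hKc : IsClosed K :=
    (isClosed_le continuous_const continuous_id).inter
      ((isClosed_eq hcv continuous_const).inter (isClosed_le hcω continuous_const))
  -- Positive costs bound every coordinate on a sublevel set of the cost. This gives compactness,
  -- hence a minimizer.
  have hKs : K ⊆ Set.Icc 0 (fun d => c / ω d) := by
    rintro l ⟨hl, -, hlc⟩
    refine ⟨hl, fun d => ?_⟩
    rw [le_div_iff₀ (hω.pos d)]
    exact (mul_le_linearCombination hω.pos hl d).trans hlc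
  have hK : IsCompact K := isCompact_Icc.of_isClosed_subset hKc hKs
  obtain ⟨l, hlK, hmin⟩ := hK.exists_isMinOn ⟨l₀, hl₀, hl₀x, le_rfl⟩ hcω.continuousOn
  have hbest : ∀ m : D → ℝ, 0 ≤ m → Fintype.linearCombination ℝ v m = x →
      Fintype.linearCombination ℝ ω l ≤ Fintype.linearCombination ℝ ω m := by
    intro m hm hmx
    by_cases hmc : Fintype.linearCombination ℝ ω m ≤ c
    · exact hmin (show m ∈ K from ⟨hm, hmx, hmc⟩)
    · exact hlK.2.2.trans (not_le.1 hmc).le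
  refine ⟨l, ?_, hlK.2.1, hbest⟩
  by_contra hcr
  obtain ⟨m, hm, hmv, hmω⟩ := hω.exists_lt h.irrefl hlK.1 hcr
  exact absurd (hbest m hm (hmv.trans hlK.2.1)) (not_le.2 hmω)

theorem IsGoodWeight.cost_le (h : IsFanData v X) (hω : IsGoodWeight v X ω) {l m : D → ℝ}
    (hl : IsNoncrossing X l) (hm : 0 ≤ m)
    (hlm : Fintype.linearCombination ℝ v l = Fintype.linearCombination ℝ v m) :
    Fintype.linearCombination ℝ ω l ≤ Fintype.linearCombination ℝ ω m := by
  obtain ⟨l', hl', hl'x, hbest⟩ := hω.exists_noncrossing h (Fintype.linearCombination ℝ v l)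
  rw [← h.uniq l' l hl' hl hl'x]
  exact hbest m hm hlm.symm

/-- A crossing `m` can be improved once, and the noncrossing `l` costs at most as much as the
improvement. -/
theorem IsGoodWeight.cost_lt (h : IsFanData v X) (hω : IsGoodWeight v X ω) {l m : D → ℝ}
    (hl : IsNoncrossing X l) (hm : 0 ≤ m)
    (hlm : Fintype.linearCombination ℝ v l = Fintype.linearCombination ℝ v m)
    (hc : ¬IsNoncrossing X m) :
    Fintype.linearCombination ℝ ω l < Fintype.linearCombination ℝ ω m := by
  obtain ⟨m', hm', hmv, hmω⟩ := hω.exists_lt h.irrefl hm hc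
  exact (hω.cost_le h hl hm' (hlm.trans hmv.symm)).trans_lt hmω

/-- Strong duality: some functional below the weights is tight on a given noncrossing support. -/
theorem IsGoodWeight.exists_tight (h : IsFanData v X) (hω : IsGoodWeight v X ω) {l : D → ℝ}
    (hl : IsNoncrossing X l) :
    ∃ y : Module.Dual ℝ (rootSpace n), (∀ d, y (v d) ≤ ω d) ∧ ∀ d, 0 < l d → y (v d) = ω d := by
  classical
  choose L hL hLx hLmin using hω.exists_noncrossing h
  -- The least cost is a sublinear function. The tight functional is a Hahn-Banach extension,
  -- dominated by `N`, of `t • x ↦ t * N x` on the line through `x`.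
  set N : rootSpace n → ℝ := fun x => Fintype.linearCombination ℝ ω (L x) with hN
  have Nhom : ∀ c : ℝ, 0 < c → ∀ x, N (c • x) = c * N x := by
    intro c hc x
    apply le_antisymm
    · have := hLmin (c • x) (c • L x) (smul_nonneg hc.le (hL x).1) (by rw [map_smul, hLx])
      rwa [map_smul, smul_eq_mul] at this
    · have := hLmin x (c⁻¹ • L (c • x)) (smul_nonneg (inv_pos.2 hc).le (hL _).1)
        (by rw [map_smul, hLx, smul_smul, inv_mul_cancel₀ hc.ne', one_smul])
      rw [map_smul, smul_eq_mul] at this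
      calc c * N x ≤ c * (c⁻¹ * N (c • x)) := mul_le_mul_of_nonneg_left this hc.le
        _ = N (c • x) := by rw [← mul_assoc, mul_inv_cancel₀ hc.ne', one_mul]
  have Nadd : ∀ x y, N (x + y) ≤ N x + N y := by
    intro x y
    have := hLmin (x + y) (L x + L y) (add_nonneg (hL x).1 (hL y).1) (by rw [map_add, hLx, hLx])
    rwa [map_add] at this
  have N0 : N 0 = 0 := by
    have := Nhom 2 two_pos 0
    rw [smul_zero] at this
    linarith
  set x := Fintype.linearCombination ℝ v l with hx
  obtain ⟨y, hyx, hyN⟩ : ∃ y : rootSpace n →ₗ[ℝ] ℝ, y x = N x ∧ ∀ z, y z ≤ N z := by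
    by_cases hx0 : x = 0
    · obtain ⟨y, -, hy⟩ := exists_extension_of_le_sublinear
        (⟨⊥, 0⟩ : rootSpace n →ₗ.[ℝ] ℝ) N Nhom Nadd (by
          rintro ⟨z, hz⟩
          have hz' : z = 0 := by simpa using hz
          subst hz'
          change (0 : ℝ) ≤ N 0
          rw [N0])
      exact ⟨y, by rw [hx0, map_zero, N0], hy⟩
    · obtain ⟨y, hy1, hy2⟩ := exists_extension_of_le_sublinear
        (LinearPMap.mkSpanSingleton (K := ℝ) (L := ℝ) (σ := RingHom.id ℝ) x (N x) hx0) N Nhom Nadd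
        (by
          rintro ⟨z, hz⟩
          obtain ⟨t, rfl⟩ := Submodule.mem_span_singleton.1 hz
          rw [LinearPMap.mkSpanSingleton'_apply]
          simp only [RingHom.id_apply, smul_eq_mul]
          -- For `t < 0`, subadditivity gives `0 = N 0 ≤ N (t • x) + (-t) * N x`.
          rcases lt_trichotomy t 0 with ht | rfl | ht
          · have h1 := Nadd (t • x) ((-t) • x)
            rw [← add_smul, add_neg_cancel, zero_smul, N0, Nhom (-t) (by linarith)] at h1
            linarith
          · simp [N0]
          · rw [Nhom t ht])
      refine ⟨y, ?_, hy2⟩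
      rw [hy1 ⟨x, Submodule.mem_span_singleton_self x⟩]
      exact LinearPMap.mkSpanSingleton_apply _ _ _ _
  have hy : ∀ d, y (v d) ≤ ω d := by
    intro d
    refine (hyN (v d)).trans ?_
    have := hLmin (v d) (Pi.single d 1) (by
      intro g; by_cases hg : g = d
      · subst hg; simp
      · simp [Pi.single_eq_of_ne hg]) (by simp)
    simpa using this
  refine ⟨y, hy, fun d hd => ?_⟩
  have hLl : L x = l := h.uniq _ _ (hL x) hl (hLx x)
  -- Complementary slackness: the slacks weighted by `l` are nonnegative and sum to `N x - y x = 0`.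
  have hsum : ∑ d, l d * (ω d - y (v d)) = 0 := by
    have h1 : y x = ∑ d, l d * y (v d) := by
      rw [hx, Fintype.linearCombination_apply, map_sum]; simp
    have h2 : N x = ∑ d, l d * ω d := by
      simp only [hN, hLl, Fintype.linearCombination_apply, smul_eq_mul]
    simp only [mul_sub, Finset.sum_sub_distrib]
    linarith
  have := (Finset.sum_eq_zero_iff_of_nonneg fun d _ =>
    mul_nonneg (hl.1 d) (sub_nonneg.2 (hy d))).1 hsum d (Finset.mem_univ d)
  rcases mul_eq_zero.1 this with h0 | h0
  · exact absurd h0 hd.ne'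
  · linarith

/-- Lowering one weight slightly keeps the weights good. -/
theorem IsGoodWeight.exists_perturb [DecidableEq D] (hω : IsGoodWeight v X ω) (g : D) :
    ∃ η : ℝ, 0 < η ∧ IsGoodWeight v X (ω - η • Pi.single g 1) := by
  have hres : ∀ p : D × D, ∃ r : D → ℝ, X p.1 p.2 → 0 ≤ r ∧
      Fintype.linearCombination ℝ v r = v p.1 + v p.2 ∧
      Fintype.linearCombination ℝ ω r < ω p.1 + ω p.2 := by
    intro p
    by_cases hp : X p.1 p.2
    · obtain ⟨r, hr⟩ := hω.resolve _ _ hp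
      exact ⟨r, fun _ => hr⟩
    · exact ⟨0, fun hp' => absurd hp' hp⟩
  choose r hr using hres
  -- With the resolutions `r` fixed, goodness is a finite list of strict inequalities that are
  -- continuous in `η` and hold at `η = 0`.
  have hev : ∀ᶠ η in nhds (0 : ℝ), (∀ d, 0 < (ω - η • (Pi.single g 1 : D → ℝ)) d) ∧
      ∀ p : D × D, X p.1 p.2 → Fintype.linearCombination ℝ (ω - η • (Pi.single g 1 : D → ℝ)) (r p) <
        (ω - η • (Pi.single g 1 : D → ℝ)) p.1 + (ω - η • (Pi.single g 1 : D → ℝ)) p.2 := by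
    refine Filter.Eventually.and (Filter.eventually_all.2 fun d => ?_)
      (Filter.eventually_all.2 fun p => ?_)
    · have hc : Continuous fun η : ℝ => (ω - η • (Pi.single g 1 : D → ℝ)) d := by
        simp only [Pi.sub_apply, Pi.smul_apply, smul_eq_mul]; fun_prop
      exact (hc.tendsto 0).eventually (lt_mem_nhds (by simpa using hω.pos d))
    · by_cases hp : X p.1 p.2
      · have hc : Continuous fun η : ℝ =>
            Fintype.linearCombination ℝ (ω - η • (Pi.single g 1 : D → ℝ)) (r p) := by
          simp only [Fintype.linearCombination_apply, Pi.sub_apply, Pi.smul_apply, smul_eq_mul]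
          fun_prop
        have hc' : Continuous fun η : ℝ => (ω - η • (Pi.single g 1 : D → ℝ)) p.1 +
            (ω - η • (Pi.single g 1 : D → ℝ)) p.2 := by
          simp only [Pi.sub_apply, Pi.smul_apply, smul_eq_mul]; fun_prop
        have := (hc.tendsto 0).eventually_lt (hc'.tendsto 0)
          (by simpa using (hr p hp).2.2)
        exact this.mono fun _ hη _ => hη
      · exact Filter.Eventually.of_forall fun _ hp' => absurd hp' hp
  obtain ⟨ε, hε, hball⟩ := Metric.eventually_nhds_iff.1 hev
  have := hball (y := ε / 2) (by
    rw [Real.dist_eq, sub_zero, abs_of_pos (by linarith)]; linarith)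
  exact ⟨ε / 2, by linarith, this.1,
    fun d e hde => ⟨r (d, e), (hr (d, e) hde).1, (hr (d, e) hde).2.1, this.2 (d, e) hde⟩⟩

/-- A functional that is tight for the weights lowered at `g` is still tight on the support of `l`,
which avoids `g`, and lies strictly below the original weight at `g`. -/
theorem IsGoodWeight.exists_tight_lt (h : IsFanData v X) (hω : IsGoodWeight v X ω) {l : D → ℝ}
    (hl : IsNoncrossing X l) (g : D) (hg : l g = 0) :
    ∃ y : Module.Dual ℝ (rootSpace n), (∀ d, y (v d) ≤ ω d) ∧ (∀ d, 0 < l d → y (v d) = ω d) ∧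
      y (v g) < ω g := by
  classical
  obtain ⟨η, hη, hω'⟩ := hω.exists_perturb g
  obtain ⟨y, hy1, hy2⟩ := hω'.exists_tight h hl
  have hle : ∀ d, (ω - η • (Pi.single g 1 : D → ℝ)) d ≤ ω d := by
    intro d
    by_cases hd : d = g
    · subst hd; simp [hη.le]
    · simp [Pi.single_eq_of_ne hd]
  refine ⟨y, fun d => (hy1 d).trans (hle d), fun d hd => ?_, ?_⟩
  · have hdg : d ≠ g := by rintro rfl; exact hd.ne' hg
    simpa [Pi.single_eq_of_ne hdg] using hy2 d hd
  · refine (hy1 g).trans_lt ?_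
    simp [hη]

/-! ### Cones, faces and normal cones -/

theorem mem_cone_image_iff (v : D → rootSpace n) (C : Set D) (x : rootSpace n) :
    x ∈ cone (v '' C) ↔ ∃ l : D → ℝ, 0 ≤ l ∧ (∀ d, d ∉ C → l d = 0) ∧
      Fintype.linearCombination ℝ v l = x := by
  classical
  unfold cone
  constructor
  · intro hx
    refine Submodule.span_induction (p := fun x _ => ∃ l : D → ℝ, 0 ≤ l ∧
      (∀ d, d ∉ C → l d = 0) ∧ Fintype.linearCombination ℝ v l = x) ?_ ?_ ?_ ?_ hx
    · rintro _ ⟨d, hd, rfl⟩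
      refine ⟨Pi.single d 1, Pi.single_nonneg.2 zero_le_one, fun e he => ?_, by simp⟩
      exact Pi.single_eq_of_ne (by rintro rfl; exact he hd) _
    · exact ⟨0, le_rfl, fun _ _ => rfl, map_zero _⟩
    · rintro _ _ _ _ ⟨l, hl, hlC, rfl⟩ ⟨m, hm, hmC, rfl⟩
      exact ⟨l + m, add_nonneg hl hm, fun d hd => by simp [hlC d hd, hmC d hd], map_add _ _ _⟩
    · rintro a _ _ ⟨l, hl, hlC, rfl⟩
      exact ⟨(a : ℝ) • l, smul_nonneg a.2 hl, fun d hd => by simp [hlC d hd], map_smul _ _ _⟩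
  · rintro ⟨l, hl, hlC, rfl⟩
    rw [Fintype.linearCombination_apply]
    refine Submodule.sum_mem _ fun d _ => ?_
    by_cases hd : d ∈ C
    · exact Submodule.smul_mem _ (⟨l d, hl d⟩ : ℝ≥0) (Submodule.subset_span ⟨d, hd, rfl⟩)
    · rw [hlC d hd, zero_smul]; exact Submodule.zero_mem _

theorem apply_linearCombination (y : Module.Dual ℝ (rootSpace n)) (v : D → rootSpace n)
    (l : D → ℝ) : y (Fintype.linearCombination ℝ v l) = ∑ d, l d * y (v d) := by
  rw [Fintype.linearCombination_apply, map_sum]; simp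

theorem apply_le_cost {y : Module.Dual ℝ (rootSpace n)} (hy : ∀ d, y (v d) ≤ ω d)
    {l : D → ℝ} (hl : 0 ≤ l) :
    y (Fintype.linearCombination ℝ v l) ≤ Fintype.linearCombination ℝ ω l := by
  rw [apply_linearCombination, Fintype.linearCombination_apply]
  exact Finset.sum_le_sum fun d _ => mul_le_mul_of_nonneg_left (hy d) (hl d)

theorem apply_eq_cost_iff {y : Module.Dual ℝ (rootSpace n)} (hy : ∀ d, y (v d) ≤ ω d)
    {l : D → ℝ} (hl : 0 ≤ l) :
    y (Fintype.linearCombination ℝ v l) = Fintype.linearCombination ℝ ω l ↔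
      ∀ d, 0 < l d → y (v d) = ω d := by
  rw [apply_linearCombination, Fintype.linearCombination_apply]
  simp only [smul_eq_mul]
  rw [Finset.sum_eq_sum_iff_of_le fun d _ => mul_le_mul_of_nonneg_left (hy d) (hl d)]
  constructor
  · intro h d hd
    exact mul_left_cancel₀ hd.ne' (h d (Finset.mem_univ d))
  · intro h d _
    rcases (hl d).eq_or_lt with h0 | h0
    · simp only [Pi.zero_apply] at h0
      rw [← h0]; simp
    · rw [h d h0]

/-- The faces of the polyhedron `{x | ∀ d, x (v d) ≤ ω d}` in terms of noncrossing weights. -/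
theorem mem_face_iff (h : IsFanData v X) (hω : IsGoodWeight v X ω) {l : D → ℝ}
    (hl : IsNoncrossing X l) (y : Module.Dual ℝ (rootSpace n)) :
    y ∈ face {x : Module.Dual ℝ (rootSpace n) | ∀ d, x (v d) ≤ ω d}
        (Fintype.linearCombination ℝ v l) ↔
      (∀ d, y (v d) ≤ ω d) ∧ ∀ d, 0 < l d → y (v d) = ω d := by
  constructor
  · rintro ⟨hy, hmax⟩
    refine ⟨hy, (apply_eq_cost_iff hy hl.1).1 (le_antisymm (apply_le_cost hy hl.1) ?_)⟩
    -- The comparison point `z` shows that the maximum over the polyhedron equals the cost of `l`.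
    obtain ⟨z, hz1, hz2⟩ := hω.exists_tight h hl
    rw [← (apply_eq_cost_iff hz1 hl.1).2 hz2]
    exact hmax z hz1
  · rintro ⟨hy, ht⟩
    refine ⟨hy, fun z hz => ?_⟩
    rw [(apply_eq_cost_iff hy hl.1).2 ht]
    exact apply_le_cost hz hl.1

/-- Let `m` be the noncrossing weight of a vector in the normal cone. If `m d > 0` but `l d = 0`,
then some point of the face is slack at `d` and so cannot maximize that vector. Hence the support of
`m` lies in that of `l`. -/
theorem normalCone_face_eq (h : IsFanData v X) (hω : IsGoodWeight v X ω) {l : D → ℝ}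
    (hl : IsNoncrossing X l) :
    normalCone {x : Module.Dual ℝ (rootSpace n) | ∀ d, x (v d) ≤ ω d}
        (face {x : Module.Dual ℝ (rootSpace n) | ∀ d, x (v d) ≤ ω d}
          (Fintype.linearCombination ℝ v l)) = cone (v '' {d | 0 < l d}) := by
  ext u
  rw [mem_cone_image_iff]
  constructor
  · intro hu
    obtain ⟨m, hm, rfl, -⟩ := hω.exists_noncrossing h u
    refine ⟨m, hm.1, fun d hd => ?_, rfl⟩
    have hld : l d = 0 := le_antisymm (not_lt.1 hd) (hl.1 d)
    obtain ⟨y, hy1, hy2, hy3⟩ := hω.exists_tight_lt h hl d hld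
    have hyF := (mem_face_iff h hω hl y).2 ⟨hy1, hy2⟩
    have : y ∈ face {x : Module.Dual ℝ (rootSpace n) | ∀ d, x (v d) ≤ ω d}
        (Fintype.linearCombination ℝ v m) := ⟨hy1, hu y hyF⟩
    by_contra hmd
    exact hy3.ne (((mem_face_iff h hω hm y).1 this).2 d
      (lt_of_le_of_ne (hm.1 d) (Ne.symm hmd)))
  · rintro ⟨m, hm, hml, rfl⟩ y hy z hz
    rw [mem_face_iff h hω hl] at hy
    rw [(apply_eq_cost_iff hy.1 hm).2 fun d hd => hy.2 d (by
      by_contra hld; exact hd.ne' (hml d hld))]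
    exact apply_le_cost hz hm

theorem normalFan_eq (h : IsFanData v X) (hω : IsGoodWeight v X ω) :
    normalFan {x : Module.Dual ℝ (rootSpace n) | ∀ d, x (v d) ≤ ω d} =
      {K | ∃ C : Set D, (∀ d ∈ C, ∀ e ∈ C, ¬X d e) ∧ K = cone (v '' C)} := by
  classical
  ext K
  constructor
  · rintro ⟨x, -, rfl⟩
    obtain ⟨l, hl, rfl, -⟩ := hω.exists_noncrossing h x
    exact ⟨{d | 0 < l d}, fun d hd e he => hl.2 d e hd he, normalCone_face_eq h hω hl⟩
  · rintro ⟨C, hC, rfl⟩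
    set l : D → ℝ := C.indicator 1 with hldef
    have hlC : {d | 0 < l d} = C := by
      ext d
      by_cases hd : d ∈ C <;> simp [hldef, hd]
    have hl : IsNoncrossing X l := by
      refine ⟨Set.indicator_nonneg fun _ _ => zero_le_one, fun d e hd he => hC d ?_ e ?_⟩
      · rw [← hlC]; exact hd
      · rw [← hlC]; exact he
    refine ⟨Fintype.linearCombination ℝ v l, ?_, ?_⟩
    · obtain ⟨y, hy⟩ := hω.exists_tight h hl
      exact ⟨y, (mem_face_iff h hω hl y).2 hy⟩
    · rw [normalCone_face_eq h hω hl, hlC]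

/-- One tight point for each noncrossing set is enough. A point outside their hull would be
separated from it by some vector `u`, but the maximum of `u` is attained at the tight point for the
support of the noncrossing weight of `u`. -/
theorem isPolytope_of_isGoodWeight (h : IsFanData v X) (hω : IsGoodWeight v X ω) :
    IsPolytope {x : Module.Dual ℝ (rootSpace n) | ∀ d, x (v d) ≤ ω d} := by
  classical
  have hex : ∀ C : Set D, ∃ y : Module.Dual ℝ (rootSpace n), (∀ d, y (v d) ≤ ω d) ∧
      ((∀ d ∈ C, ∀ e ∈ C, ¬X d e) → ∀ d ∈ C, y (v d) = ω d) := by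
    intro C
    by_cases hC : ∀ d ∈ C, ∀ e ∈ C, ¬X d e
    · have hlC : ∀ d, 0 < (C.indicator 1 : D → ℝ) d ↔ d ∈ C := by
        intro d
        by_cases hd : d ∈ C <;> simp [hd]
      obtain ⟨y, hy1, hy2⟩ := hω.exists_tight h (l := C.indicator 1)
        ⟨Set.indicator_nonneg fun _ _ => zero_le_one,
          fun d e hd he => hC d ((hlC d).1 hd) e ((hlC e).1 he)⟩
      exact ⟨y, hy1, fun _ d hd => hy2 d ((hlC d).2 hd)⟩
    -- For a set with a crossing any feasible point will do. The origin is feasible because the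
    -- weights are positive.
    · exact ⟨0, fun d => by simpa using (hω.pos d).le, fun hC' => absurd hC' hC⟩
  choose Y hY1 hY2 using hex
  refine ⟨Set.range Y, Set.finite_range Y, Set.range_nonempty Y, ?_⟩
  apply Set.Subset.antisymm
  · intro x hx
    by_contra hxc
    -- The separation takes place in coordinates with respect to `b`. A functional `g` on coordinate
    -- space is evaluation at the vector `u` defined below.
    let b := Module.finBasis ℝ (rootSpace n)
    let Φ : Module.Dual ℝ (rootSpace n) ≃ₗ[ℝ] (Fin _ → ℝ) := b.constr ℝ |>.symm
    have himg : Φ x ∉ convexHull ℝ (Φ '' Set.range Y) := by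
      have := Φ.toLinearMap.image_convexHull (Set.range Y)
      intro hmem
      change Φ x ∈ convexHull ℝ (Φ.toLinearMap '' Set.range Y) at hmem
      rw [← this] at hmem
      obtain ⟨z, hz, hzx⟩ := hmem
      exact hxc (Φ.injective hzx ▸ hz)
    have hfin : (Φ '' Set.range Y).Finite := (Set.finite_range Y).image _
    obtain ⟨g, t, hg1, hg2⟩ := geometric_hahn_banach_closed_point (convex_convexHull ℝ _)
      (hfin.isCompact_convexHull ℝ).isClosed himg
    set u : rootSpace n := ∑ i, g (Pi.single i 1) • b i with hu
    have hgu : ∀ y : Module.Dual ℝ (rootSpace n), g (Φ y) = y u := by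
      intro y
      have h1 : Φ y = ∑ i, y (b i) • (Pi.single i (1 : ℝ) : Fin _ → ℝ) := by
        ext j
        simp [Φ, Pi.single_apply]
      rw [h1, hu, map_sum, map_sum]
      simp [mul_comm]
    obtain ⟨l, hl, hlu, -⟩ := hω.exists_noncrossing h u
    have h1 : Y {d | 0 < l d} u < t := by
      rw [← hgu]
      exact hg1 _ (subset_convexHull ℝ _ ⟨_, ⟨_, rfl⟩, rfl⟩)
    rw [hgu] at hg2
    rw [← hlu] at h1 hg2
    rw [(apply_eq_cost_iff (hY1 _) hl.1).2 fun d hd =>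
      hY2 {d | 0 < l d} (fun d hd e he => hl.2 d e hd he) d hd] at h1
    exact absurd (apply_le_cost hx hl.1) (not_le.2 (h1.trans hg2))
  · refine convexHull_min ?_ ?_
    · rintro _ ⟨C, rfl⟩
      exact hY1 C
    · intro x hx y hy a b ha hb hab d
      simp only [LinearMap.add_apply, LinearMap.smul_apply, smul_eq_mul]
      calc a * x (v d) + b * y (v d) ≤ a * ω d + b * ω d :=
            add_le_add (mul_le_mul_of_nonneg_left (hx d) ha) (mul_le_mul_of_nonneg_left (hy d) hb)
        _ = ω d := by rw [← add_mul, hab, one_mul]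

end Abstract

/-! ## Almost positive roots and their crossings -/

/-- Labels of the almost positive roots: `inl k` stands for `-α_k` and `inr (a, b)`, `a < b`, for
`e_a - e_b`. -/
abbrev APRoot (n : ℕ) : Type := Fin n ⊕ {p : Fin (n + 1) × Fin (n + 1) // p.1 < p.2}

/-- The almost positive root with a given label. -/
def APRoot.vec {n : ℕ} : APRoot n → rootSpace n
  | .inl k => -simpleRoot k
  | .inr p => rootVec p.1.1 p.1.2

/-- The positive roots `e_a - e_b` and `e_a' - e_b'` cross, with respect to signs `ε`. -/
def IntervalCross (ε : ℕ → Bool) (a b a' b' : ℕ) : Prop :=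
  b = a' ∨ b' = a ∨ (a < a' ∧ a' < b ∧ b < b' ∧ ε a' = ε b) ∨
    (a' < a ∧ a < b' ∧ b' < b ∧ ε a = ε b') ∨
    (a < a' ∧ a' < b' ∧ b' < b ∧ ε a' ≠ ε b') ∨ (a' < a ∧ a < b ∧ b < b' ∧ ε a ≠ ε b)

/-- Two almost positive roots cross, with respect to signs `ε`. -/
def RootCross {n : ℕ} (ε : ℕ → Bool) : APRoot n → APRoot n → Prop
  | .inl _, .inl _ => False
  | .inl k, .inr p => p.1.1.val ≤ k.val ∧ k.val < p.1.2.val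
  | .inr p, .inl k => p.1.1.val ≤ k.val ∧ k.val < p.1.2.val
  | .inr p, .inr q => IntervalCross ε p.1.1 p.1.2 q.1.1 q.1.2

theorem IntervalCross.symm {ε : ℕ → Bool} {a b a' b' : ℕ} (h : IntervalCross ε a b a' b') :
    IntervalCross ε a' b' a b := by
  unfold IntervalCross at *; tauto

theorem RootCross.symm {n : ℕ} {ε : ℕ → Bool} {r s : APRoot n} (h : RootCross ε r s) :
    RootCross ε s r := by
  rcases r with k | p <;> rcases s with l | q
  · exact h
  · exact h
  · exact h
  · exact IntervalCross.symm h

theorem RootCross.irrefl {n : ℕ} {ε : ℕ → Bool} (r : APRoot n) : ¬RootCross ε r r := by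
  rcases r with k | ⟨⟨a, b⟩, hab⟩
  · exact id
  · have : a.val < b.val := hab
    simp only [RootCross, IntervalCross]
    omega

theorem rootVec_apply {n : ℕ} (i j k : Fin (n + 1)) :
    (rootVec i j).1 k = (if k = i then (1 : ℝ) else 0) - (if k = j then 1 else 0) := by
  simp [rootVec, Pi.single_apply]

theorem rootVec_self {n : ℕ} (i : Fin (n + 1)) : rootVec i i = (0 : rootSpace n) := by
  ext k; simp [rootVec]

theorem rootVec_add {n : ℕ} (i j k : Fin (n + 1)) :
    rootVec i j + rootVec j k = (rootVec i k : rootSpace n) := by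
  ext m; simp [rootVec]

theorem neg_rootVec {n : ℕ} (i j : Fin (n + 1)) :
    -rootVec i j = (rootVec j i : rootSpace n) := by
  ext m; simp [rootVec]

theorem rootVec_add_comm {n : ℕ} (a b c d : Fin (n + 1)) :
    rootVec a b + rootVec c d = (rootVec a d + rootVec c b : rootSpace n) := by
  ext m; simp [rootVec]; ring

/-- The coefficient of `α_k` in the expansion in simple roots. -/
def height {n : ℕ} (k : ℕ) : rootSpace n →ₗ[ℝ] ℝ where
  toFun x := ∑ i with i.val ≤ k, x.1 i
  map_add' x y := by simp [Finset.sum_add_distrib]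
  map_smul' c x := by simp [Finset.mul_sum]

theorem height_rootVec {n : ℕ} (k : ℕ) (i j : Fin (n + 1)) :
    height k (rootVec i j) =
      (if i.val ≤ k then (1 : ℝ) else 0) - (if j.val ≤ k then 1 else 0) := by
  simp only [height, LinearMap.coe_mk, AddHom.coe_mk, rootVec_apply]
  rw [Finset.sum_sub_distrib]
  simp

theorem height_vec_inl {n : ℕ} (k j : Fin n) :
    height k (APRoot.vec (.inl j)) = if j = k then (-1 : ℝ) else 0 := by
  simp only [APRoot.vec, simpleRoot, neg_rootVec, height_rootVec, Fin.val_castSucc, Fin.val_succ,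
    Fin.ext_iff]
  split_ifs <;> first | omega | norm_num

theorem height_vec_inr {n : ℕ} (k : ℕ) (p : {p : Fin (n + 1) × Fin (n + 1) // p.1 < p.2}) :
    height k (APRoot.vec (.inr p)) =
      if p.1.1.val ≤ k ∧ k < p.1.2.val then (1 : ℝ) else 0 := by
  have : p.1.1.val < p.1.2.val := p.2
  simp only [APRoot.vec, height_rootVec]
  split_ifs <;> first | omega | norm_num

theorem rootVec_eq_iff {n : ℕ} {i j k l : Fin (n + 1)} (hij : i ≠ j) :
    (rootVec i j : rootSpace n) = rootVec k l ↔ i = k ∧ j = l := by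
  constructor
  · intro h
    have h1 := congrArg (fun v : rootSpace n => v.1 i) h
    have h2 := congrArg (fun v : rootSpace n => v.1 j) h
    simp only [rootVec_apply] at h1 h2
    simp only [if_neg hij, if_neg hij.symm, if_true] at h1 h2
    constructor
    · by_contra hik
      rw [if_neg hik] at h1
      split_ifs at h1 <;> norm_num at h1
    · by_contra hjl
      rw [if_neg hjl] at h2
      split_ifs at h2 <;> norm_num at h2
  · rintro ⟨rfl, rfl⟩; rfl

theorem neg_simpleRoot {n : ℕ} (k : Fin n) :
    -simpleRoot k = (rootVec k.succ k.castSucc : rootSpace n) := neg_rootVec _ _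

theorem APRoot.vec_injective {n : ℕ} : Function.Injective (APRoot.vec (n := n)) := by
  rintro (k | ⟨⟨a, b⟩, hab⟩) (l | ⟨⟨a', b'⟩, hab'⟩) h
  · simp only [APRoot.vec, neg_simpleRoot] at h
    rw [rootVec_eq_iff (Fin.castSucc_lt_succ).ne'] at h
    rw [Fin.succ_inj.1 h.1]
  · simp only [APRoot.vec, neg_simpleRoot] at h
    rw [rootVec_eq_iff (Fin.castSucc_lt_succ).ne'] at h
    obtain ⟨rfl, rfl⟩ := h
    exact absurd hab' (Fin.castSucc_lt_succ).le.not_gt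
  · simp only [APRoot.vec, neg_simpleRoot] at h
    rw [rootVec_eq_iff (ne_of_lt hab)] at h
    obtain ⟨rfl, rfl⟩ := h
    exact absurd hab (Fin.castSucc_lt_succ).le.not_gt
  · simp only [APRoot.vec] at h
    rw [rootVec_eq_iff (ne_of_lt hab)] at h
    obtain ⟨rfl, rfl⟩ := h
    rfl

theorem almostPositiveRoots_eq_range (n : ℕ) :
    almostPositiveRoots n = Set.range (APRoot.vec (n := n)) := by
  ext v
  constructor
  · rintro (⟨i, j, hij, rfl⟩ | ⟨i, rfl⟩)
    · exact ⟨.inr ⟨(i, j), hij⟩, rfl⟩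
    · exact ⟨.inl i, rfl⟩
  · rintro ⟨k | p, rfl⟩
    · exact Or.inr ⟨k, rfl⟩
    · exact Or.inl ⟨p.1.1, p.1.2, p.2, rfl⟩

/-! ### Uniqueness of noncrossing combinations -/

theorem sum_Iio_add_add_sum_Ioi {N : ℕ} (b : Fin N) (f : Fin N → ℝ) :
    ∑ j ∈ Finset.Iio b, f j + f b + ∑ j ∈ Finset.Ioi b, f j = ∑ j, f j := by
  rw [← Finset.sum_filter_add_sum_filter_not Finset.univ (fun j => j ≤ b) f]
  congr 1
  · have : Finset.univ.filter (fun j => j ≤ b) = insert b (Finset.Iio b) := by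
      ext j; simp [le_iff_eq_or_lt]
    rw [this, Finset.sum_insert (by simp), add_comm]
  · congr 1; ext j; simp

theorem exists_pos_of_sum_ne_zero {ι : Type*} {s : Finset ι} {f : ι → ℝ} (hf : ∀ i, 0 ≤ f i)
    (h : ∑ i ∈ s, f i ≠ 0) : ∃ i ∈ s, 0 < f i := by
  obtain ⟨i, hi, hne⟩ := Finset.exists_ne_zero_of_sum_ne_zero h
  exact ⟨i, hi, lt_of_le_of_ne (hf i) (Ne.symm hne)⟩

/-- A noncrossing transport plan. -/
structure IsNoncrossingPlan {N : ℕ} (ε : ℕ → Bool) (F : Fin N → Fin N → ℝ) : Prop where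
  nonneg : ∀ a b, 0 ≤ F a b
  eq_zero : ∀ a b, ¬a < b → F a b = 0
  noncrossing : ∀ a b a' b', 0 < F a b → 0 < F a' b' → ¬IntervalCross ε a b a' b'

/-- Mass into `a` followed by mass out of `a` would be a pair of consecutive intervals. So every
point is only a source or only a sink. -/
theorem IsNoncrossingPlan.out_or_in {N : ℕ} {ε : ℕ → Bool} {F : Fin N → Fin N → ℝ}
    (hF : IsNoncrossingPlan ε F) (a : Fin N) : ∑ b, F a b = 0 ∨ ∑ b, F b a = 0 := by
  by_contra! h
  obtain ⟨b, -, hb⟩ := exists_pos_of_sum_ne_zero (hF.nonneg a) h.1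
  obtain ⟨c, -, hc⟩ := exists_pos_of_sum_ne_zero (fun c => hF.nonneg c a) h.2
  exact hF.noncrossing _ _ _ _ hc hb (Or.inl rfl)

/-- An interval from `a` to beyond `b` and one from before `a` to `b` overlap with inner endpoints
`a` and `b`. -/
theorem IsNoncrossingPlan.right_or_left {N : ℕ} {ε : ℕ → Bool} {F : Fin N → Fin N → ℝ}
    (hF : IsNoncrossingPlan ε F) {a b : Fin N} (hab : a < b) (h : ε a = ε b) :
    ∑ j ∈ Finset.Ioi b, F a j = 0 ∨ ∑ i ∈ Finset.Iio a, F i b = 0 := by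
  by_contra! hne
  obtain ⟨j, hj, hj'⟩ := exists_pos_of_sum_ne_zero (hF.nonneg a) hne.1
  obtain ⟨i, hi, hi'⟩ := exists_pos_of_sum_ne_zero (fun c => hF.nonneg c b) hne.2
  have hia : i < a := Finset.mem_Iio.1 hi
  have hbj : b < j := Finset.mem_Ioi.1 hj
  exact hF.noncrossing _ _ _ _ hi' hj'
    (Or.inr (Or.inr (Or.inl ⟨hia, hab, hbj, h⟩)))

theorem IsNoncrossingPlan.self_or_outer {N : ℕ} {ε : ℕ → Bool} {F : Fin N → Fin N → ℝ}
    (hF : IsNoncrossingPlan ε F) {a b : Fin N} (hab : a < b) (h : ε a ≠ ε b) :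
    F a b = 0 ∨ ∑ i ∈ Finset.Iio a, ∑ j ∈ Finset.Ioi b, F i j = 0 := by
  by_contra! hne
  obtain ⟨i, hi, hi'⟩ := exists_pos_of_sum_ne_zero
    (fun i => Finset.sum_nonneg fun j _ => hF.nonneg i j) hne.2
  obtain ⟨j, hj, hj'⟩ := exists_pos_of_sum_ne_zero (hF.nonneg i) hi'.ne'
  have hia : i < a := Finset.mem_Iio.1 hi
  have hbj : b < j := Finset.mem_Ioi.1 hj
  exact hF.noncrossing _ _ _ _ hj' (lt_of_le_of_ne (hF.nonneg a b) (Ne.symm hne.1))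
    (Or.inr (Or.inr (Or.inr (Or.inr (Or.inl
      ⟨hia, hab, hbj, h⟩)))))

/-- Induction on `b - a`: entries strictly inside `[a, b]` being known, three sums are known, namely
`F a b` plus the mass from `a` beyond `b`, `F a b` plus the mass into `b` from before `a`, and the
latter mass plus the mass passing over `[a, b]`. For equal signs one of the first two masses
vanishes. For different signs `F a b` or the mass passing over vanishes. Either way nonnegativity
determines `F a b`. -/
theorem IsNoncrossingPlan.unique {N : ℕ} {ε : ℕ → Bool} {F G : Fin N → Fin N → ℝ}
    (hF : IsNoncrossingPlan ε F) (hG : IsNoncrossingPlan ε G)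
    (h : ∀ a, ∑ b, F a b - ∑ b, F b a = ∑ b, G a b - ∑ b, G b a) : F = G := by
  -- Since inflow or outflow vanishes at each point, the net flow determines both.
  have hout : ∀ a, ∑ b, F a b = ∑ b, G a b ∧ ∑ b, F b a = ∑ b, G b a := by
    intro a
    have h1 : 0 ≤ ∑ b, F a b := Finset.sum_nonneg fun b _ => hF.nonneg a b
    have h2 : 0 ≤ ∑ b, F b a := Finset.sum_nonneg fun b _ => hF.nonneg b a
    have h3 : 0 ≤ ∑ b, G a b := Finset.sum_nonneg fun b _ => hG.nonneg a b
    have h4 : 0 ≤ ∑ b, G b a := Finset.sum_nonneg fun b _ => hG.nonneg b a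
    have h5 := h a
    rcases hF.out_or_in a with h6 | h6 <;> rcases hG.out_or_in a with h7 | h7 <;>
      constructor <;> linarith
  have main : ∀ d : ℕ, ∀ a b : Fin N, b.val - a.val = d → F a b = G a b := by
    intro d
    induction d using Nat.strong_induction_on with
    | _ d ih =>
    intro a b hd
    by_cases hab : a < b
    swap
    · rw [hF.eq_zero a b hab, hG.eq_zero a b hab]
    have hab' : a.val < b.val := hab
    have inner : ∀ i j : Fin N, a ≤ i → j ≤ b → (a < i ∨ j < b) → F i j = G i j := by
      intro i j hi hj hij
      by_cases hlt : i < j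
      · have h1 : a.val ≤ i.val := hi
        have h2 : j.val ≤ b.val := hj
        have h3 : i.val < j.val := hlt
        refine ih (j.val - i.val) ?_ i j rfl
        rcases hij with h4 | h4
        · have : a.val < i.val := h4
          omega
        · have : j.val < b.val := h4
          omega
      · rw [hF.eq_zero i j hlt, hG.eq_zero i j hlt]
    have row : ∀ i, ∑ j ∈ Finset.Iio b, F i j + F i b + ∑ j ∈ Finset.Ioi b, F i j =
        ∑ j ∈ Finset.Iio b, G i j + G i b + ∑ j ∈ Finset.Ioi b, G i j := by
      intro i
      rw [sum_Iio_add_add_sum_Ioi b (F i), sum_Iio_add_add_sum_Ioi b (G i)]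
      exact (hout i).1
    have col : ∀ j, ∑ i ∈ Finset.Iio a, F i j + F a j + ∑ i ∈ Finset.Ioi a, F i j =
        ∑ i ∈ Finset.Iio a, G i j + G a j + ∑ i ∈ Finset.Ioi a, G i j := by
      intro j
      rw [sum_Iio_add_add_sum_Ioi a (fun i => F i j), sum_Iio_add_add_sum_Ioi a (fun i => G i j)]
      exact (hout j).2
    have e1 : ∑ j ∈ Finset.Iio b, F a j = ∑ j ∈ Finset.Iio b, G a j :=
      Finset.sum_congr rfl fun j hj =>
        inner a j le_rfl (Finset.mem_Iio.1 hj).le (Or.inr (Finset.mem_Iio.1 hj))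
    have e2 : ∀ j ≤ b, ∑ i ∈ Finset.Ioi a, F i j = ∑ i ∈ Finset.Ioi a, G i j := fun j hj =>
      Finset.sum_congr rfl fun i hi =>
        inner i j (Finset.mem_Ioi.1 hi).le hj (Or.inl (Finset.mem_Ioi.1 hi))
    have e3 : ∑ j ∈ Finset.Iio b, ∑ i ∈ Finset.Iio a, F i j =
        ∑ j ∈ Finset.Iio b, ∑ i ∈ Finset.Iio a, G i j := by
      refine Finset.sum_congr rfl fun j hj => ?_
      have hj := Finset.mem_Iio.1 hj
      have h1 := col j
      rw [e2 j hj.le, inner a j le_rfl hj.le (Or.inr hj)] at h1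
      linarith
    have e4 : ∑ i ∈ Finset.Iio a, F i b + ∑ i ∈ Finset.Iio a, ∑ j ∈ Finset.Ioi b, F i j =
        ∑ i ∈ Finset.Iio a, G i b + ∑ i ∈ Finset.Iio a, ∑ j ∈ Finset.Ioi b, G i j := by
      have h1 := Finset.sum_congr (rfl : Finset.Iio a = Finset.Iio a) fun i _ => row i
      simp only [Finset.sum_add_distrib] at h1
      rw [Finset.sum_comm, e3, Finset.sum_comm] at h1
      linarith
    have r1 := row a
    have r2 := col b
    rw [e1] at r1
    rw [e2 b le_rfl] at r2
    have p1 : 0 ≤ F a b := hF.nonneg a b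
    have p2 : 0 ≤ G a b := hG.nonneg a b
    have p3 : 0 ≤ ∑ j ∈ Finset.Ioi b, F a j := Finset.sum_nonneg fun j _ => hF.nonneg a j
    have p4 : 0 ≤ ∑ j ∈ Finset.Ioi b, G a j := Finset.sum_nonneg fun j _ => hG.nonneg a j
    have p5 : 0 ≤ ∑ i ∈ Finset.Iio a, F i b := Finset.sum_nonneg fun i _ => hF.nonneg i b
    have p6 : 0 ≤ ∑ i ∈ Finset.Iio a, G i b := Finset.sum_nonneg fun i _ => hG.nonneg i b
    have p7 : 0 ≤ ∑ i ∈ Finset.Iio a, ∑ j ∈ Finset.Ioi b, F i j :=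
      Finset.sum_nonneg fun i _ => Finset.sum_nonneg fun j _ => hF.nonneg i j
    have p8 : 0 ≤ ∑ i ∈ Finset.Iio a, ∑ j ∈ Finset.Ioi b, G i j :=
      Finset.sum_nonneg fun i _ => Finset.sum_nonneg fun j _ => hG.nonneg i j
    by_cases hε : ε a = ε b
    · rcases hF.right_or_left hab hε with h6 | h6 <;>
        rcases hG.right_or_left hab hε with h7 | h7 <;> linarith
    · rcases hF.self_or_outer hab hε with h6 | h6 <;>
        rcases hG.self_or_outer hab hε with h7 | h7 <;> linarith
  ext a b
  exact main _ a b rfl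

/-- The transport plan given by the positive roots of a weight. -/
def planOf {n : ℕ} (l : APRoot n → ℝ) (a b : Fin (n + 1)) : ℝ :=
  if h : a < b then l (.inr ⟨(a, b), h⟩) else 0

theorem isNoncrossingPlan_planOf {n : ℕ} {ε : ℕ → Bool} {l : APRoot n → ℝ}
    (hl : IsNoncrossing (RootCross ε) l) : IsNoncrossingPlan ε (planOf l) where
  nonneg a b := by unfold planOf; split_ifs; exacts [hl.1 _, le_rfl]
  eq_zero a b h := dif_neg h
  noncrossing a b a' b' h h' := by
    unfold planOf at h h'
    split_ifs at h h' with h1 h2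
    · exact hl.2 _ _ h h'
    · exact absurd h' (lt_irrefl _)
    · exact absurd h (lt_irrefl _)
    · exact absurd h (lt_irrefl _)

theorem linearCombination_vec {n : ℕ} (l : APRoot n → ℝ) :
    Fintype.linearCombination ℝ APRoot.vec l =
      ∑ k, l (.inl k) • -simpleRoot k + ∑ a, ∑ b, planOf l a b • rootVec a b := by
  rw [Fintype.linearCombination_apply, Fintype.sum_sum_type]
  congr 1
  rw [← Fintype.sum_prod_type' (f := fun a b => planOf l a b • (rootVec a b : rootSpace n))]
  refine Fintype.sum_of_injective Subtype.val Subtype.val_injective _ _ ?_ ?_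
  · rintro ⟨a, b⟩ hp
    have : ¬a < b := fun h => hp ⟨⟨(a, b), h⟩, rfl⟩
    simp [planOf, this]
  · rintro ⟨⟨a, b⟩, h⟩
    have h' : a < b := h
    simp [planOf, h', APRoot.vec]

theorem sum_planOf_apply {n : ℕ} (F : Fin (n + 1) → Fin (n + 1) → ℝ) (i : Fin (n + 1)) :
    (∑ a, ∑ b, F a b • (rootVec a b : rootSpace n)).1 i = ∑ b, F i b - ∑ b, F b i := by
  have : (∑ a, ∑ b, F a b • (rootVec a b : rootSpace n)).1 i =
      ∑ a, ∑ b, F a b * ((if i = a then (1 : ℝ) else 0) - (if i = b then 1 else 0)) := by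
    simp [rootVec_apply, Finset.sum_apply]
  rw [this]
  simp only [mul_sub, Finset.sum_sub_distrib]
  congr 1
  · rw [Finset.sum_comm]; simp
  · simp

/-- No positive root containing `α_k` can occur together with `-α_k`. So the coefficient of `α_k` in
the sum is either minus that of the root `-α_k` or a sum of nonnegative terms, and its negative part
is `l (.inl k)`. -/
theorem height_linearCombination {n : ℕ} {ε : ℕ → Bool} {l : APRoot n → ℝ}
    (hl : IsNoncrossing (RootCross ε) l) (k : Fin n) :
    l (.inl k) = max 0 (-height k (Fintype.linearCombination ℝ APRoot.vec l)) := by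
  have key : height k (Fintype.linearCombination ℝ APRoot.vec l) =
      -l (.inl k) + ∑ p : {p : Fin (n + 1) × Fin (n + 1) // p.1 < p.2}, l (.inr p) *
        (if p.1.1.val ≤ k.val ∧ k.val < p.1.2.val then (1 : ℝ) else 0) := by
    rw [Fintype.linearCombination_apply, map_sum, Fintype.sum_sum_type]
    simp only [map_smul, smul_eq_mul, height_vec_inl, height_vec_inr]
    simp
  have hk := hl.1 (.inl k)
  rw [key]
  rcases hk.eq_or_lt with h0 | h0
  · simp only [Pi.zero_apply] at h0
    rw [← h0, max_eq_left]
    have : 0 ≤ ∑ p : {p : Fin (n + 1) × Fin (n + 1) // p.1 < p.2}, l (.inr p) *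
        (if p.1.1.val ≤ k.val ∧ k.val < p.1.2.val then (1 : ℝ) else 0) :=
      Finset.sum_nonneg fun p _ => mul_nonneg (hl.1 _) (by split_ifs <;> norm_num)
    linarith
  · rw [Finset.sum_eq_zero, max_eq_right] <;> simp only [Pi.zero_apply] at h0
    · ring
    · linarith
    · intro p _
      split_ifs with hp
      · rcases (hl.1 (.inr p)).eq_or_lt with h1 | h1
        · simp only [Pi.zero_apply] at h1; rw [← h1]; ring
        · exact absurd hp (hl.2 _ _ h0 h1)
      · ring

/-- Expand `x = ∑ x_i (e_i - e_0)`. Each `e_i - e_0` is a sum of negative simple roots, and `e_0 -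
e_i` is a positive root or zero. -/
theorem nonneg_span_vec {n : ℕ} (x : rootSpace n) :
    ∃ l : APRoot n → ℝ, 0 ≤ l ∧ Fintype.linearCombination ℝ APRoot.vec l = x := by
  classical
  set S : Set (rootSpace n) :=
    {x | ∃ l : APRoot n → ℝ, 0 ≤ l ∧ Fintype.linearCombination ℝ APRoot.vec l = x}
  have hadd : ∀ x ∈ S, ∀ y ∈ S, x + y ∈ S := by
    rintro _ ⟨l, hl, rfl⟩ _ ⟨m, hm, rfl⟩
    exact ⟨l + m, add_nonneg hl hm, map_add _ _ _⟩
  have hsmul : ∀ c : ℝ, 0 ≤ c → ∀ x ∈ S, c • x ∈ S := by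
    rintro c hc _ ⟨l, hl, rfl⟩
    exact ⟨c • l, smul_nonneg hc hl, map_smul _ _ _⟩
  have hzero : (0 : rootSpace n) ∈ S := ⟨0, le_rfl, map_zero _⟩
  have hvec : ∀ r : APRoot n, r.vec ∈ S := fun r =>
    ⟨Pi.single r 1, Pi.single_nonneg.2 zero_le_one, by simp⟩
  have hneg : ∀ i : Fin (n + 1), rootVec i 0 ∈ S := by
    intro i
    induction i using Fin.induction with
    | zero => rw [rootVec_self]; exact hzero
    | succ k ih =>
      rw [← rootVec_add k.succ k.castSucc 0]
      refine hadd _ ?_ _ ih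
      have := hvec (.inl k)
      rwa [APRoot.vec, neg_simpleRoot] at this
  have hpos : ∀ i : Fin (n + 1), rootVec 0 i ∈ S := by
    intro i
    by_cases hi : 0 < i
    · exact hvec (.inr ⟨(0, i), hi⟩)
    · have : i = 0 := by simpa using hi
      rw [this, rootVec_self]; exact hzero
  have hx : x = ∑ i, x.1 i • rootVec i 0 := by
    ext k
    have : (∑ i, x.1 i • (rootVec i 0 : rootSpace n)).1 k =
        ∑ i, x.1 i * ((if k = i then (1 : ℝ) else 0) - (if k = 0 then 1 else 0)) := by
      simp [rootVec_apply, Finset.sum_apply]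
    rw [this]
    have hsum : ∑ i, x.1 i = 0 := x.2
    simp only [mul_sub, Finset.sum_sub_distrib, ← Finset.sum_mul, hsum]
    simp
  change x ∈ S
  rw [hx]
  refine Finset.sum_induction _ (· ∈ S) (fun a b ha hb => hadd a ha b hb) hzero fun i _ => ?_
  rcases le_total 0 (x.1 i) with h | h
  · exact hsmul _ h _ (hneg i)
  · have : x.1 i • (rootVec i 0 : rootSpace n) = (-x.1 i) • rootVec 0 i := by
      rw [← neg_rootVec 0 i, smul_neg]
      exact (neg_smul _ _).symm
    rw [this]
    exact hsmul _ (by linarith) _ (hpos i)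

theorem isFanData_vec (n : ℕ) (ε : ℕ → Bool) :
    IsFanData (APRoot.vec (n := n)) (RootCross ε) where
  irrefl := RootCross.irrefl
  span := nonneg_span_vec
  uniq l m hl hm h := by
    have hinl : ∀ k, l (.inl k) = m (.inl k) := by
      intro k
      rw [height_linearCombination hl, height_linearCombination hm, h]
    have hplan : planOf l = planOf m := by
      refine (isNoncrossingPlan_planOf hl).unique (isNoncrossingPlan_planOf hm) fun a => ?_
      rw [← sum_planOf_apply, ← sum_planOf_apply]
      rw [linearCombination_vec, linearCombination_vec] at h
      simp only [hinl] at h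
      rw [add_left_cancel h]
    ext r
    rcases r with k | ⟨⟨a, b⟩, hab⟩
    · exact hinl k
    · have := congrFun (congrFun hplan a) b
      have hab' : a < b := hab
      simpa only [planOf, dif_pos hab'] using this

/-! ### Resolving crossings -/

/-- The weight of the root `e_a - e_b`, which is zero if `a = b`. -/
def segment {n : ℕ} (a b : Fin (n + 1)) : APRoot n → ℝ :=
  if h : a < b then Pi.single (.inr ⟨(a, b), h⟩) 1 else 0

theorem segment_nonneg {n : ℕ} (a b : Fin (n + 1)) : 0 ≤ segment a b := by
  unfold segment; split_ifs; exacts [Pi.single_nonneg.2 zero_le_one, le_rfl]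

theorem linearCombination_segment {n : ℕ} {a b : Fin (n + 1)} (h : a ≤ b) :
    Fintype.linearCombination ℝ APRoot.vec (segment a b) = rootVec a b := by
  unfold segment
  split_ifs with hab
  · simp [APRoot.vec]
  · rw [map_zero, le_antisymm h (not_lt.1 hab), rootVec_self]

/-- The noncrossing combinations that resolve a crossing. -/
inductive Resolves {n : ℕ} (ε : ℕ → Bool) : APRoot n → APRoot n → (APRoot n → ℝ) → Prop
  | neg (k : Fin n) (a b : Fin (n + 1)) (hab : a < b) (h1 : a ≤ k.castSucc) (h2 : k.succ ≤ b) :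
    Resolves ε (.inl k) (.inr ⟨(a, b), hab⟩) (segment a k.castSucc + segment k.succ b)
  | concat (a b c : Fin (n + 1)) (hab : a < b) (hbc : b < c) :
    Resolves ε (.inr ⟨(a, b), hab⟩) (.inr ⟨(b, c), hbc⟩) (segment a c)
  | overlap (a a' b b' : Fin (n + 1)) (h1 : a < a') (h2 : a' < b) (h3 : b < b')
    (hε : ε a' = ε b) : Resolves ε (.inr ⟨(a, b), h1.trans h2⟩) (.inr ⟨(a', b'), h2.trans h3⟩)
      (segment a b' + segment a' b)
  | nested (a a' b b' : Fin (n + 1)) (h1 : a < a') (h2 : a' < b') (h3 : b' < b)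
    (hε : ε a' ≠ ε b') : Resolves ε (.inr ⟨(a, b), (h1.trans h2).trans h3⟩)
      (.inr ⟨(a', b'), h2⟩) (segment a b' + segment a' b)

theorem RootCross.exists_resolves {n : ℕ} {ε : ℕ → Bool} {r s : APRoot n}
    (h : RootCross ε r s) : ∃ l, Resolves ε r s l ∨ Resolves ε s r l := by
  have key : ∀ (k : Fin n) (p : {p : Fin (n + 1) × Fin (n + 1) // p.1 < p.2}),
      RootCross ε (.inl k) (.inr p) → ∃ l, Resolves ε (.inl k) (.inr p) l := by
    rintro k ⟨⟨a, b⟩, hab⟩ ⟨h1, h2⟩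
    exact ⟨_, .neg k a b hab (Fin.le_def.2 h1) (Fin.le_def.2 (by simpa using h2))⟩
  rcases r with k | ⟨⟨a, b⟩, hab⟩ <;> rcases s with j | ⟨⟨a', b'⟩, hab'⟩
  · exact h.elim
  · obtain ⟨l, hl⟩ := key _ _ h
    exact ⟨l, Or.inl hl⟩
  · obtain ⟨l, hl⟩ := key _ _ h.symm
    exact ⟨l, Or.inr hl⟩
  · rcases h with h | h | ⟨h1, h2, h3, h4⟩ | ⟨h1, h2, h3, h4⟩ | ⟨h1, h2, h3, h4⟩ |
      ⟨h1, h2, h3, h4⟩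
    · obtain rfl : b = a' := Fin.ext h
      exact ⟨_, Or.inl (.concat a b b' hab hab')⟩
    · obtain rfl : b' = a := Fin.ext h
      exact ⟨_, Or.inr (.concat a' b' b hab' hab)⟩
    · exact ⟨_, Or.inl (.overlap a a' b b' h1 h2 h3 h4)⟩
    · exact ⟨_, Or.inr (.overlap a' a b' b h1 h2 h3 h4)⟩
    · exact ⟨_, Or.inl (.nested a a' b b' h1 h2 h3 h4)⟩
    · exact ⟨_, Or.inr (.nested a' a b' b h1 h2 h3 h4)⟩

theorem Resolves.nonneg {n : ℕ} {ε : ℕ → Bool} {r s : APRoot n} {l : APRoot n → ℝ}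
    (h : Resolves ε r s l) : 0 ≤ l := by
  cases h
  · exact add_nonneg (segment_nonneg _ _) (segment_nonneg _ _)
  · exact segment_nonneg _ _
  · exact add_nonneg (segment_nonneg _ _) (segment_nonneg _ _)
  · exact add_nonneg (segment_nonneg _ _) (segment_nonneg _ _)

theorem Resolves.linearCombination {n : ℕ} {ε : ℕ → Bool} {r s : APRoot n} {l : APRoot n → ℝ}
    (h : Resolves ε r s l) :
    Fintype.linearCombination ℝ APRoot.vec l = r.vec + s.vec := by
  cases h with
  | neg k a b hab h1 h2 =>
    rw [map_add, linearCombination_segment h1, linearCombination_segment h2]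
    simp only [APRoot.vec, neg_simpleRoot]
    exact (rootVec_add_comm _ _ _ _).trans (add_comm _ _)
  | concat a b c hab hbc =>
    rw [linearCombination_segment (hab.trans hbc).le]
    exact (rootVec_add _ _ _).symm
  | overlap a a' b b' h1 h2 h3 hε =>
    rw [map_add, linearCombination_segment ((h1.trans h2).trans h3).le,
      linearCombination_segment h2.le]
    exact rootVec_add_comm _ _ _ _
  | nested a a' b b' h1 h2 h3 hε =>
    rw [map_add, linearCombination_segment (h1.trans h2).le,
      linearCombination_segment (h2.trans h3).le]
    exact rootVec_add_comm _ _ _ _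

/-- An element of the support of a resolution crosses neither the resolved pair nor any other
element of the support. -/
theorem Resolves.not_rootCross {n : ℕ} {ε : ℕ → Bool} {r s : APRoot n} {l : APRoot n → ℝ}
    (h : Resolves ε r s l) {g : APRoot n} (hg : l g ≠ 0) :
    ¬RootCross ε g r ∧ ¬RootCross ε g s ∧ ∀ g', l g' ≠ 0 → ¬RootCross ε g g' := by
  have hseg : ∀ (a b : Fin (n + 1)) (g : APRoot n), segment a b g ≠ 0 →
      ∃ h : a < b, g = .inr ⟨(a, b), h⟩ := by
    intro a b g hg
    unfold segment at hg
    split_ifs at hg with hab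
    · refine ⟨hab, ?_⟩
      by_contra hne
      exact hg (Pi.single_eq_of_ne hne _)
    · exact absurd rfl hg
  have hseg2 : ∀ (a b c d : Fin (n + 1)) (g : APRoot n), (segment a b + segment c d) g ≠ 0 →
      (∃ h : a < b, g = .inr ⟨(a, b), h⟩) ∨ ∃ h : c < d, g = .inr ⟨(c, d), h⟩ := by
    intro a b c d g hg
    by_cases h1 : segment a b g = 0
    · right; apply hseg; simpa [h1] using hg
    · left; exact hseg _ _ _ h1
  cases h with
  | neg k a b hab h1 h2 =>
    rcases hseg2 _ _ _ _ _ hg with ⟨h3, rfl⟩ | ⟨h3, rfl⟩ <;>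
    · refine ⟨?_, ?_, fun g' hg' => ?_⟩
      rotate_left 2
      rcases hseg2 _ _ _ _ _ hg' with ⟨h4, rfl⟩ | ⟨h4, rfl⟩
      all_goals
        simp only [RootCross, IntervalCross, Fin.lt_def, Fin.le_def, Fin.val_castSucc,
          Fin.val_succ] at *
        grind
  | concat a b c hab hbc =>
    obtain ⟨h3, rfl⟩ := hseg _ _ _ hg
    refine ⟨?_, ?_, fun g' hg' => ?_⟩
    rotate_left 2
    obtain ⟨h4, rfl⟩ := hseg _ _ _ hg'
    all_goals
      simp only [RootCross, IntervalCross, Fin.lt_def] at *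
      grind
  | overlap a a' b b' h1 h2 h3 hε =>
    rcases hseg2 _ _ _ _ _ hg with ⟨h3, rfl⟩ | ⟨h3, rfl⟩ <;>
    · refine ⟨?_, ?_, fun g' hg' => ?_⟩
      rotate_left 2
      rcases hseg2 _ _ _ _ _ hg' with ⟨h4, rfl⟩ | ⟨h4, rfl⟩
      all_goals
        simp only [RootCross, IntervalCross, Fin.lt_def] at *
        grind
  | nested a a' b b' h1 h2 h3 hε =>
    rcases hseg2 _ _ _ _ _ hg with ⟨h3, rfl⟩ | ⟨h3, rfl⟩ <;>
    · refine ⟨?_, ?_, fun g' hg' => ?_⟩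
      rotate_left 2
      rcases hseg2 _ _ _ _ _ hg' with ⟨h4, rfl⟩ | ⟨h4, rfl⟩
      all_goals
        simp only [RootCross, IntervalCross, Fin.lt_def] at *
        grind

/-! ### Existence of good weights -/

/-- The number `±a`, with the sign of `ε a`. -/
def signedIndex (ε : ℕ → Bool) (a : ℕ) : ℝ := if ε a then a else -a

/-- The number `∓(n + 1 - b)`, with the sign opposite to that of `ε b`. -/
def signedCoindex (n : ℕ) (ε : ℕ → Bool) (b : ℕ) : ℝ :=
  if ε b then -((n : ℝ) + 1 - b) else (n : ℝ) + 1 - b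

/-- Explicit good weights. -/
def explicitWeight {n : ℕ} (ε : ℕ → Bool) : APRoot n → ℝ
  | .inl _ => 10 * ((n : ℝ) + 1) ^ 2 + 1
  | .inr p => 4 * ((n : ℝ) + 1) ^ 2 + signedIndex ε p.1.1 * signedCoindex n ε p.1.2

theorem abs_signedIndex_mul_le {n : ℕ} (ε : ℕ → Bool) (a b : Fin (n + 1)) :
    |signedIndex ε a * signedCoindex n ε b| ≤ ((n : ℝ) + 1) ^ 2 := by
  have ha : (a.val : ℝ) ≤ n := by exact_mod_cast Nat.lt_succ_iff.1 a.2
  have hb : (b.val : ℝ) ≤ n := by exact_mod_cast Nat.lt_succ_iff.1 b.2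
  have ha0 : (0 : ℝ) ≤ a.val := Nat.cast_nonneg _
  have hb0 : (0 : ℝ) ≤ b.val := Nat.cast_nonneg _
  rw [abs_mul, sq]
  refine mul_le_mul ?_ ?_ (abs_nonneg _) (by linarith)
  · unfold signedIndex; rw [abs_le]; split_ifs <;> constructor <;> linarith
  · unfold signedCoindex; rw [abs_le]; split_ifs <;> constructor <;> linarith

/-- The larger index has the larger absolute value, so its sign alone decides the sign of the
difference. -/
theorem signedIndex_sub {ε : ℕ → Bool} {a a' : ℕ} (h : a < a') :
    if ε a' then 0 < signedIndex ε a' - signedIndex ε a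
    else signedIndex ε a' - signedIndex ε a < 0 := by
  have h' : (a : ℝ) < a' := by exact_mod_cast h
  have ha0 : (0 : ℝ) ≤ a := Nat.cast_nonneg _
  unfold signedIndex; split_ifs <;> linarith

/-- Here the smaller index has the larger absolute value, so `ε b` decides. -/
theorem signedCoindex_sub {n : ℕ} {ε : ℕ → Bool} {b b' : ℕ} (h : b < b') (hb' : b' ≤ n) :
    if ε b then 0 < signedCoindex n ε b' - signedCoindex n ε b
    else signedCoindex n ε b' - signedCoindex n ε b < 0 := by
  have h' : (b : ℝ) < b' := by exact_mod_cast h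
  have hb0 : (b' : ℝ) ≤ n := by exact_mod_cast hb'
  unfold signedCoindex; split_ifs <;> linarith

/-- Put `Q = (n + 1)^2`. Positive roots cost between `3 * Q` and `5 * Q`, so a concatenation trades
at least `6 * Q` for at most `5 * Q`, and a crossing with a negative simple root trades at least `13
* Q + 1` for at most `10 * Q`. In the other two cases the constants cancel and the saving is the
product of the difference of the `signedIndex` of `a'` and `a` and that of the `signedCoindex` of
`b'` and `b`. The sign condition on the inner endpoints makes this product positive. -/
theorem Resolves.explicitWeight_lt {n : ℕ} {ε : ℕ → Bool} {r s : APRoot n} {l : APRoot n → ℝ}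
    (h : Resolves ε r s l) :
    Fintype.linearCombination ℝ (explicitWeight ε) l < explicitWeight ε r + explicitWeight ε s := by
  have hseg : ∀ {a b : Fin (n + 1)}, a < b →
      Fintype.linearCombination ℝ (explicitWeight ε) (segment a b) =
      4 * ((n : ℝ) + 1) ^ 2 + signedIndex ε a * signedCoindex n ε b := by
    intro a b hab
    simp [segment, hab, explicitWeight]
  have hQ : (0 : ℝ) < ((n : ℝ) + 1) ^ 2 := by positivity
  have hsegle : ∀ a b : Fin (n + 1),
      Fintype.linearCombination ℝ (explicitWeight ε) (segment a b) ≤ 5 * ((n : ℝ) + 1) ^ 2 := by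
    intro a b
    by_cases hab : a < b
    · rw [hseg hab]
      have := (abs_le.1 (abs_signedIndex_mul_le ε a b)).2
      linarith
    · simp [segment, hab]; positivity
  cases h with
  | neg k a b hab h1 h2 =>
    rw [map_add]
    have := hsegle a k.castSucc
    have := hsegle k.succ b
    have := (abs_le.1 (abs_signedIndex_mul_le ε a b)).1
    simp only [explicitWeight]
    linarith
  | concat a b c hab hbc =>
    have := hsegle a c
    have := (abs_le.1 (abs_signedIndex_mul_le ε a b)).1
    have := (abs_le.1 (abs_signedIndex_mul_le ε b c)).1
    simp only [explicitWeight]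
    linarith
  | overlap a a' b b' h1 h2 h3 hε =>
    rw [map_add, hseg ((h1.trans h2).trans h3), hseg h2]
    simp only [explicitWeight]
    have e1 := signedIndex_sub (ε := ε) (Fin.lt_def.1 h1)
    have e2 := signedCoindex_sub (n := n) (ε := ε) (Fin.lt_def.1 h3) (Nat.lt_succ_iff.1 b'.2)
    rw [hε] at e1
    split_ifs at e1 e2
    · nlinarith [mul_pos e1 e2]
    · nlinarith [mul_pos_of_neg_of_neg e1 e2]
  | nested a a' b b' h1 h2 h3 hε =>
    rw [map_add, hseg (h1.trans h2), hseg (h2.trans h3)]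
    simp only [explicitWeight]
    have e1 := signedIndex_sub (ε := ε) (Fin.lt_def.1 h1)
    have e2 := signedCoindex_sub (n := n) (ε := ε) (Fin.lt_def.1 h3) (Nat.lt_succ_iff.1 b.2)
    split_ifs at e1 e2 with h5 h6
    · exact absurd (h5.trans h6.symm) hε
    · nlinarith [mul_neg_of_pos_of_neg e1 e2]
    · nlinarith [mul_neg_of_neg_of_pos e1 e2]
    · simp_all

theorem isGoodWeight_explicitWeight (n : ℕ) (ε : ℕ → Bool) :
    IsGoodWeight (APRoot.vec (n := n)) (RootCross ε) (explicitWeight ε) where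
  pos r := by
    have hQ : (0 : ℝ) < ((n : ℝ) + 1) ^ 2 := by positivity
    rcases r with k | p
    · simp only [explicitWeight]; positivity
    · have := (abs_le.1 (abs_signedIndex_mul_le ε p.1.1 p.1.2)).1
      simp only [explicitWeight]; linarith
  resolve r s h := by
    obtain ⟨l, hl | hl⟩ := h.exists_resolves
    · exact ⟨l, hl.nonneg, hl.linearCombination, hl.explicitWeight_lt⟩
    · refine ⟨l, hl.nonneg, ?_, ?_⟩
      · exact hl.linearCombination.trans (add_comm _ _)
      · exact hl.explicitWeight_lt.trans_eq (add_comm _ _)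

/-! ## Coxeter elements and `c`-compatibility -/

/-- Signs are consulted only at inner endpoints, which lie strictly between `0` and `n`. So the
signs at the two ends are a free convention. -/
theorem RootCross.congr {n : ℕ} {ε ε' : ℕ → Bool} (h : ∀ m, 0 < m → m < n → ε m = ε' m)
    (r s : APRoot n) : RootCross ε r s ↔ RootCross ε' r s := by
  rcases r with k | ⟨⟨a, b⟩, hab⟩ <;> rcases s with j | ⟨⟨a', b'⟩, hab'⟩
  · exact Iff.rfl
  · exact Iff.rfl
  · exact Iff.rfl
  · have h1 : a.val < b.val := hab
    have h2 : a'.val < b'.val := hab'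
    have ha := h a
    have hb := h b
    have ha' := h a'
    have hb' := h b'
    have := b.2
    have := b'.2
    simp only [RootCross, IntervalCross]
    grind (splits := 30)

/-- For each point, whether the permutation moves it up. -/
def permSign {n : ℕ} (w : Equiv.Perm (Fin (n + 1))) (m : ℕ) : Bool :=
  if h : m < n + 1 then decide (m < (w ⟨m, h⟩).val) else false

theorem permSign_val {n : ℕ} (w : Equiv.Perm (Fin (n + 1))) (x : Fin (n + 1)) :
    permSign w x.val = decide (x < w x) := by
  unfold permSign
  rw [dif_pos x.2]
  rfl

theorem simpleReflection_val {n : ℕ} (k : Fin n) (x : Fin (n + 1)) :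
    (simpleReflection k x).val =
      if x.val = k.val then k.val + 1 else if x.val = k.val + 1 then k.val else x.val := by
  unfold simpleReflection
  rw [Equiv.swap_apply_def]
  simp only [Fin.ext_iff, Fin.val_castSucc, Fin.val_succ]
  split_ifs <;> simp

theorem simpleReflection_inv {n : ℕ} (k : Fin n) :
    (simpleReflection k)⁻¹ = simpleReflection k := Equiv.swap_inv _ _

theorem simpleReflection_mul_self {n : ℕ} (k : Fin n) :
    simpleReflection k * simpleReflection k = 1 := Equiv.swap_mul_self _ _

theorem wordProd_cons {n : ℕ} (k : Fin n) (l : List (Fin n)) :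
    wordProd (k :: l) = simpleReflection k * wordProd l := by simp [wordProd]

theorem wordProd_append {n : ℕ} (l m : List (Fin n)) :
    wordProd (l ++ m) = wordProd l * wordProd m := by simp [wordProd]

theorem wordProd_reverse {n : ℕ} (l : List (Fin n)) : wordProd l.reverse = (wordProd l)⁻¹ := by
  induction l with
  | nil => simp [wordProd]
  | cons k l ih =>
    rw [List.reverse_cons, wordProd_append, wordProd_cons, ih, wordProd_cons k l, mul_inv_rev,
      simpleReflection_inv]
    simp [wordProd]

/-- Only `s_t` moves a point across the gap between `t` and `t + 1`. -/
theorem wordProd_le_iff {n : ℕ} {t : Fin n} {l : List (Fin n)} (h : t ∉ l) (x : Fin (n + 1)) :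
    (wordProd l x).val ≤ t.val ↔ x.val ≤ t.val := by
  induction l with
  | nil => simp [wordProd]
  | cons k l ih =>
    rw [List.mem_cons, not_or] at h
    have hk : k.val ≠ t.val := fun h' => h.1 (Fin.ext h'.symm)
    rw [wordProd_cons, Equiv.Perm.mul_apply, simpleReflection_val, ← ih h.2]
    split_ifs <;> omega

theorem wordProd_eq_self {n : ℕ} {l : List (Fin n)} {x : Fin (n + 1)}
    (h : ∀ i ∈ l, i.val ≠ x.val ∧ i.val + 1 ≠ x.val) : wordProd l x = x := by
  induction l with
  | nil => simp [wordProd]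
  | cons k l ih =>
    have hk := h k List.mem_cons_self
    rw [wordProd_cons, Equiv.Perm.mul_apply, ih fun i hi => h i (List.mem_cons_of_mem _ hi)]
    apply Fin.ext
    rw [simpleReflection_val, if_neg (Ne.symm hk.1), if_neg (Ne.symm hk.2)]

/-- The right part `m` acts first and fixes `j`, as it contains neither `s_{j-1}` nor `s_j`. Then
`s_j` carries `j` across the gap, and `l` cannot bring it back. -/
theorem lt_wordProd_apply {n : ℕ} {j : Fin n} {l m : List (Fin n)} (hl : j ∉ l) (hm : j ∉ m)
    (h : ∀ i ∈ m, i.val + 1 ≠ j.val) : j.castSucc < wordProd (l ++ j :: m) j.castSucc := by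
  have h1 : wordProd m j.castSucc = j.castSucc := wordProd_eq_self fun i hi =>
    ⟨fun h' => hm (by rwa [show j = i from Fin.ext h'.symm]), h i hi⟩
  rw [wordProd_append, wordProd_cons, Equiv.Perm.mul_apply, Equiv.Perm.mul_apply, h1, Fin.lt_def]
  by_contra h2
  have h3 := (wordProd_le_iff hl _).1 (not_lt.1 h2)
  rw [simpleReflection_val] at h3
  simp at h3

theorem wordProd_apply_lt {n : ℕ} {j : Fin n} {l m : List (Fin n)} (hl : j ∉ l) (hm : j ∉ m)
    (h : ∀ i ∈ m, i.val ≠ j.val + 1) : wordProd (l ++ j :: m) j.succ < j.succ := by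
  have h1 : wordProd m j.succ = j.succ := wordProd_eq_self fun i hi =>
    ⟨h i hi, fun h' => hm (by rwa [show j = i from Fin.ext (Nat.succ_injective h'.symm)])⟩
  rw [wordProd_append, wordProd_cons, Equiv.Perm.mul_apply, Equiv.Perm.mul_apply, h1, Fin.lt_def,
    Fin.val_succ, Nat.lt_succ_iff, wordProd_le_iff hl, simpleReflection_val]
  simp

theorem IsCoxeterWord.rotate {n : ℕ} {k : Fin n} {l : List (Fin n)}
    (h : IsCoxeterWord (k :: l)) : IsCoxeterWord (l ++ [k]) := by
  refine ⟨?_, fun i => ?_⟩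
  · exact (List.nodup_append_comm (l₁ := [k])).1 h.1
  · have := h.2 i
    simp only [List.mem_cons, List.mem_append, List.not_mem_nil, or_false] at this ⊢
    tauto

/-- Conjugation by the first letter moves that letter to the end of the word. -/
theorem conj_wordProd_cons {n : ℕ} (k : Fin n) (l : List (Fin n)) :
    simpleReflection k * wordProd (k :: l) * simpleReflection k = wordProd (l ++ [k]) := by
  rw [wordProd_cons, ← mul_assoc, simpleReflection_mul_self, one_mul, wordProd_append]
  simp [wordProd]

/-- How conjugation by an initial generator changes the signs. -/
structure IsSignFlip (n : ℕ) (k : ℕ) (ε ε' : ℕ → Bool) : Prop where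
  left : 0 < k → ε k = false ∧ ε' k = true
  right : k + 1 < n → ε (k + 1) = true ∧ ε' (k + 1) = false
  other : ∀ m, m ≤ n → m ≠ k → m ≠ k + 1 → ε m = ε' m

/-- Write `w = s * v`, so that the conjugate is `v * s`, where `v` preserves the cut between `k` and
`k + 1`. In `v` the letter `s_{k-1}` moves `k` down and `s_{k+1}` moves `k + 1` up, as far as these
letters exist. This gives the signs at `k` and `k + 1`. For any other `m`, applying `s` to the value
`v m` does not affect its comparison with `m`. -/
theorem IsInitial.isSignFlip {n : ℕ} {k : Fin n} {w : Equiv.Perm (Fin (n + 1))}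
    (h : IsInitial k w) : IsSignFlip n k (permSign w)
      (permSign (simpleReflection k * w * simpleReflection k)) := by
  obtain ⟨l, hl, rfl⟩ := h
  have hkl : k ∉ l := (List.nodup_cons.1 hl.1).1
  have hnd : l.Nodup := (List.nodup_cons.1 hl.1).2
  have hmem : ∀ i, i ≠ k → i ∈ l := fun i hi => by
    rcases List.mem_cons.1 (hl.2 i) with h | h
    · exact absurd h hi
    · exact h
  have hk := k.2
  set s := simpleReflection k with hs
  set v := wordProd l with hv
  have hw : wordProd (k :: l) = s * v := wordProd_cons k l
  have hw' : s * wordProd (k :: l) * s = v * s := by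
    rw [hw, ← mul_assoc, simpleReflection_mul_self, one_mul]
  have hs1 : s k.castSucc = k.succ := Equiv.swap_apply_left _ _
  have hs2 : s k.succ = k.castSucc := Equiv.swap_apply_right _ _
  have hv1 : 0 < k.val → v k.castSucc < k.castSucc := by
    intro h0
    obtain ⟨j, hj⟩ : ∃ j : Fin n, j.val + 1 = k.val := ⟨⟨k.val - 1, by omega⟩, by
      change k.val - 1 + 1 = k.val; omega⟩
    obtain ⟨L, B, rfl⟩ := List.append_of_mem (hmem j (by rintro rfl; omega))
    have hnd' := List.nodup_middle.1 hnd
    rw [List.nodup_cons, List.mem_append, not_or] at hnd'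
    have : k.castSucc = j.succ := Fin.ext hj.symm
    rw [this]
    refine wordProd_apply_lt hnd'.1.1 hnd'.1.2 fun i hi h' => hkl ?_
    rw [show k = i from Fin.ext (by omega)]
    simp [hi]
  have hv2 : k.val + 1 < n → k.succ < v k.succ := by
    intro h0
    obtain ⟨j, hj⟩ : ∃ j : Fin n, j.val = k.val + 1 := ⟨⟨k.val + 1, h0⟩, rfl⟩
    obtain ⟨L, B, rfl⟩ := List.append_of_mem (hmem j (by rintro rfl; omega))
    have hnd' := List.nodup_middle.1 hnd
    rw [List.nodup_cons, List.mem_append, not_or] at hnd'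
    have : k.succ = j.castSucc := Fin.ext hj.symm
    rw [this]
    refine lt_wordProd_apply hnd'.1.1 hnd'.1.2 fun i hi h' => hkl ?_
    rw [show k = i from Fin.ext (by omega)]
    simp [hi]
  have hv3 : (v k.castSucc).val ≤ k.val := (wordProd_le_iff hkl _).2 (by simp)
  have hv4 : k.val < (v k.succ).val := by
    rw [← not_le, wordProd_le_iff hkl]; simp
  refine ⟨fun h0 => ?_, fun h0 => ?_, fun m hm h1 h2 => ?_⟩
  · have := hv1 h0
    change permSign _ k.castSucc.val = _ ∧ permSign _ k.castSucc.val = _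
    rw [permSign_val, permSign_val, hw', hw]
    refine ⟨decide_eq_false ?_, decide_eq_true ?_⟩
    · rw [Equiv.Perm.mul_apply, Fin.lt_def, hs, simpleReflection_val, Fin.val_castSucc]
      rw [Fin.lt_def, Fin.val_castSucc] at this
      split_ifs <;> omega
    · rw [Equiv.Perm.mul_apply, hs1]
      exact hv4
  · have := hv2 h0
    change permSign _ k.succ.val = _ ∧ permSign _ k.succ.val = _
    rw [permSign_val, permSign_val, hw', hw]
    refine ⟨decide_eq_true ?_, decide_eq_false ?_⟩
    · rw [Equiv.Perm.mul_apply, Fin.lt_def, hs, simpleReflection_val, Fin.val_succ]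
      rw [Fin.lt_def, Fin.val_succ] at this
      split_ifs <;> omega
    · rw [Equiv.Perm.mul_apply, hs2, Fin.lt_def, Fin.val_succ]
      omega
  · obtain ⟨x, rfl⟩ : ∃ x : Fin (n + 1), x.val = m := ⟨⟨m, by omega⟩, rfl⟩
    have hsx : s x = x := by
      apply Fin.ext; rw [hs, simpleReflection_val, if_neg h1, if_neg h2]
    rw [permSign_val, permSign_val, hw', hw]
    refine decide_eq_decide.2 ?_
    rw [Equiv.Perm.mul_apply, Equiv.Perm.mul_apply, hsx, Fin.lt_def, Fin.lt_def, hs,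
      simpleReflection_val]
    split_ifs <;> omega

/-! ### The involutions on labels -/

theorem simpleReflection_lt {n : ℕ} {k : Fin n} {a b : Fin (n + 1)} (hab : a < b) :
    simpleReflection k a < simpleReflection k b ↔ ¬(a = k.castSucc ∧ b = k.succ) := by
  simp only [Fin.lt_def, Fin.ext_iff, simpleReflection_val, Fin.val_castSucc, Fin.val_succ] at *
  split_ifs <;> omega

/-- The involution `σ_k` on labels of almost positive roots. -/
def APRoot.reflect {n : ℕ} (k : Fin n) : APRoot n → APRoot n
  | .inl t => if t = k then .inr ⟨(k.castSucc, k.succ), Fin.castSucc_lt_succ⟩ else .inl t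
  | .inr p => if h : simpleReflection k p.1.1 < simpleReflection k p.1.2 then
      .inr ⟨(simpleReflection k p.1.1, simpleReflection k p.1.2), h⟩ else .inl k

theorem permAct_rootVec {n : ℕ} (w : Equiv.Perm (Fin (n + 1))) (i j : Fin (n + 1)) :
    permAct w (rootVec i j) = rootVec (w i) (w j) := by
  ext k
  change (rootVec i j).1 (w⁻¹ k) = (rootVec (w i) (w j)).1 k
  simp only [rootVec_apply, Equiv.Perm.inv_eq_iff_eq]

theorem sigma_vec {n : ℕ} (k : Fin n) (r : APRoot n) : sigma k r.vec = (r.reflect k).vec := by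
  have hswap1 : simpleReflection k k.castSucc = k.succ := Equiv.swap_apply_left _ _
  have hswap2 : simpleReflection k k.succ = k.castSucc := Equiv.swap_apply_right _ _
  have hiff : (∃ t : Fin n, t ≠ k ∧ r.vec = -simpleRoot t) ↔ ∃ t, t ≠ k ∧ r = .inl t := by
    refine exists_congr fun t => and_congr_right fun _ => ?_
    exact APRoot.vec_injective.eq_iff (b := .inl t)
  unfold sigma
  simp only [hiff]
  rcases r with t | ⟨⟨a, b⟩, hab⟩
  · by_cases ht : t = k
    · subst ht
      rw [if_neg (by rintro ⟨t', h1, h2⟩; exact h1 (Sum.inl.inj h2).symm)]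
      simp only [APRoot.vec, APRoot.reflect, if_true, neg_simpleRoot, permAct_rootVec, hswap1,
        hswap2]
    · rw [if_pos ⟨t, ht, rfl⟩]
      simp only [APRoot.reflect, if_neg ht]
  · rw [if_neg (by rintro ⟨t, -, h⟩; cases h)]
    by_cases h : simpleReflection k a < simpleReflection k b
    · simp only [APRoot.vec, APRoot.reflect, dif_pos h, permAct_rootVec]
    · simp only [APRoot.vec, APRoot.reflect, dif_neg h, permAct_rootVec]
      rw [simpleReflection_lt hab, not_not] at h
      obtain ⟨rfl, rfl⟩ := h
      rw [hswap1, hswap2, neg_simpleRoot]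

theorem APRoot.reflect_reflect {n : ℕ} (k : Fin n) (r : APRoot n) :
    (r.reflect k).reflect k = r := by
  have hss : ∀ x, simpleReflection k (simpleReflection k x) = x := fun x =>
    Equiv.swap_apply_self _ _ _
  rcases r with t | ⟨⟨a, b⟩, hab⟩
  · by_cases ht : t = k
    · subst ht
      have h : ¬simpleReflection t t.castSucc < simpleReflection t t.succ := by
        rw [simpleReflection_lt Fin.castSucc_lt_succ]; simp
      simp only [APRoot.reflect, if_true, dif_neg h]
    · simp only [APRoot.reflect, if_neg ht]
  · have hab' : a < b := hab
    by_cases h : simpleReflection k a < simpleReflection k b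
    · simp only [APRoot.reflect, dif_pos h, hss, dif_pos hab']
    · simp only [APRoot.reflect, dif_neg h, if_true]
      rw [simpleReflection_lt hab, not_not] at h
      obtain ⟨rfl, rfl⟩ := h
      rfl

/-- At interior points the signs travel with the points: `ε'` at the image of `x` is `ε x`. So only
comparisons between `k` and `k + 1` change. There overlapping may become nested or the reverse, and
as `ε k ≠ ε (k + 1)` the equal-sign and different-sign conditions exchange accordingly. An overlap
in exactly `[k, k + 1]` is no crossing, and its image is a disjoint pair. -/
theorem intervalCross_flip {n k : ℕ} {ε ε' : ℕ → Bool} (h : IsSignFlip n k ε ε')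
    {a b a' b' : ℕ} (hab : a < b) (hb : b ≤ n) (hab' : a' < b') (hb' : b' ≤ n)
    (h1 : ¬(a = k ∧ b = k + 1)) (h2 : ¬(a' = k ∧ b' = k + 1)) :
    IntervalCross ε a b a' b' ↔ IntervalCross ε'
      (if a = k then k + 1 else if a = k + 1 then k else a)
      (if b = k then k + 1 else if b = k + 1 then k else b)
      (if a' = k then k + 1 else if a' = k + 1 then k else a')
      (if b' = k then k + 1 else if b' = k + 1 then k else b') := by
  have hl := h.left
  have hr := h.right
  have ea := h.other a (by omega)
  have eb := h.other b (by omega)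
  have ea' := h.other a' (by omega)
  have eb' := h.other b' (by omega)
  unfold IntervalCross
  split_ifs <;> grind (splits := 30)

/-- The case in which one root is `-α_k`, which `σ_k` sends to the interval from `k` to `k + 1`. -/
theorem intervalCross_simple_flip {n k : ℕ} {ε ε' : ℕ → Bool} (h : IsSignFlip n k ε ε')
    {a b : ℕ} (hab : a < b) (hb : b ≤ n) (h1 : ¬(a = k ∧ b = k + 1)) :
    (a ≤ k ∧ k < b) ↔ IntervalCross ε' k (k + 1)
      (if a = k then k + 1 else if a = k + 1 then k else a)
      (if b = k then k + 1 else if b = k + 1 then k else b) := by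
  have hl := h.left
  have hr := h.right
  unfold IntervalCross
  split_ifs <;> grind (splits := 30)

theorem intervalCross_simple_flip' {n k : ℕ} {ε ε' : ℕ → Bool} (h : IsSignFlip n k ε ε')
    {a b : ℕ} (hab : a < b) (hb : b ≤ n) (h1 : ¬(a = k ∧ b = k + 1)) :
    IntervalCross ε k (k + 1) a b ↔
      (if a = k then k + 1 else if a = k + 1 then k else a) ≤ k ∧
      k < (if b = k then k + 1 else if b = k + 1 then k else b) := by
  have hl := h.left
  have hr := h.right
  unfold IntervalCross
  split_ifs <;> grind (splits := 30)

theorem rootCross_flip_aux {n : ℕ} {k : Fin n} {ε ε' : ℕ → Bool} (h : IsSignFlip n k ε ε')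
    (t : Fin n) (p : {p : Fin (n + 1) × Fin (n + 1) // p.1 < p.2}) :
    RootCross ε (.inl t) (.inr p) ↔
      RootCross ε' (APRoot.reflect k (.inl t)) (APRoot.reflect k (.inr p)) := by
  obtain ⟨⟨a, b⟩, hab⟩ := p
  have hab' : a.val < b.val := hab
  have hb := Nat.lt_succ_iff.1 b.2
  by_cases hs : simpleReflection k a < simpleReflection k b
  · have hs' := (simpleReflection_lt hab).1 hs
    simp only [Fin.ext_iff, Fin.val_castSucc, Fin.val_succ] at hs'
    by_cases ht : t = k
    · subst ht
      simp only [APRoot.reflect, if_true, dif_pos hs, RootCross, simpleReflection_val,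
        Fin.val_castSucc, Fin.val_succ]
      exact intervalCross_simple_flip h hab' hb hs'
    · have ht' : t.val ≠ k.val := fun h' => ht (Fin.ext h')
      simp only [APRoot.reflect, if_neg ht, dif_pos hs, RootCross, simpleReflection_val]
      split_ifs <;> omega
  · have hs' := hs
    rw [simpleReflection_lt hab, not_not] at hs'
    simp only [Fin.ext_iff, Fin.val_castSucc, Fin.val_succ] at hs'
    by_cases ht : t = k
    · subst ht
      simp only [APRoot.reflect, if_true, dif_neg hs, RootCross, Fin.val_castSucc, Fin.val_succ]
      omega
    · have ht' : t.val ≠ k.val := fun h' => ht (Fin.ext h')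
      simp only [APRoot.reflect, if_neg ht, dif_neg hs, RootCross]
      exact iff_of_false (by omega) id

theorem rootCross_flip {n : ℕ} {k : Fin n} {ε ε' : ℕ → Bool} (h : IsSignFlip n k ε ε')
    (r s : APRoot n) : RootCross ε r s ↔ RootCross ε' (r.reflect k) (s.reflect k) := by
  have comm : ∀ {ε : ℕ → Bool} {r s : APRoot n}, RootCross ε r s ↔ RootCross ε s r :=
    ⟨RootCross.symm, RootCross.symm⟩
  rcases r with t | ⟨⟨a, b⟩, hab⟩ <;> rcases s with t' | ⟨⟨a', b'⟩, hab'⟩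
  · by_cases ht : t = k <;> by_cases ht' : t' = k
    · subst ht ht'
      exact iff_of_false (RootCross.irrefl _) (RootCross.irrefl _)
    · have : t'.val ≠ k.val := fun h' => ht' (Fin.ext h')
      simp only [APRoot.reflect, if_pos ht, if_neg ht', RootCross, Fin.val_castSucc, Fin.val_succ]
      exact iff_of_false id (by omega)
    · have : t.val ≠ k.val := fun h' => ht (Fin.ext h')
      simp only [APRoot.reflect, if_pos ht', if_neg ht, RootCross, Fin.val_castSucc, Fin.val_succ]
      exact iff_of_false id (by omega)
    · simp only [APRoot.reflect, if_neg ht', if_neg ht, RootCross]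
  · exact rootCross_flip_aux h _ _
  · rw [comm, rootCross_flip_aux h, comm]
  · have h1 : a.val < b.val := hab
    have h2 : a'.val < b'.val := hab'
    have hb := Nat.lt_succ_iff.1 b.2
    have hb' := Nat.lt_succ_iff.1 b'.2
    by_cases hs : simpleReflection k a < simpleReflection k b <;>
      by_cases hs' : simpleReflection k a' < simpleReflection k b'
    · have h3 := (simpleReflection_lt hab).1 hs
      have h4 := (simpleReflection_lt hab').1 hs'
      simp only [Fin.ext_iff, Fin.val_castSucc, Fin.val_succ] at h3 h4
      simp only [APRoot.reflect, dif_pos hs, dif_pos hs', RootCross, simpleReflection_val]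
      exact intervalCross_flip h h1 hb h2 hb' h3 h4
    · have h3 := (simpleReflection_lt hab).1 hs
      have h4 := hs'
      rw [simpleReflection_lt hab', not_not] at h4
      simp only [Fin.ext_iff, Fin.val_castSucc, Fin.val_succ] at h3 h4
      rw [comm]
      simp only [APRoot.reflect, dif_pos hs, dif_neg hs', RootCross, simpleReflection_val,
        h4.1, h4.2]
      exact intervalCross_simple_flip' h h1 hb h3
    · have h3 := (simpleReflection_lt hab').1 hs'
      have h4 := hs
      rw [simpleReflection_lt hab, not_not] at h4
      simp only [Fin.ext_iff, Fin.val_castSucc, Fin.val_succ] at h3 h4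
      simp only [APRoot.reflect, dif_pos hs', dif_neg hs, RootCross, simpleReflection_val,
        h4.1, h4.2]
      exact intervalCross_simple_flip' h h2 hb' h3
    · have h3 := hs
      have h4 := hs'
      rw [simpleReflection_lt hab, not_not] at h3
      rw [simpleReflection_lt hab', not_not] at h4
      obtain ⟨rfl, rfl⟩ := h3
      obtain ⟨rfl, rfl⟩ := h4
      exact iff_of_false (RootCross.irrefl _) (RootCross.irrefl _)

/-! ### Existence and uniqueness of the compatibility family -/

/-- Two almost positive roots are distinct and do not cross. -/
def APRoot.Compatible {n : ℕ} (ε : ℕ → Bool) (r s : APRoot n) : Prop :=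
  r ≠ s ∧ ¬RootCross ε r s

theorem compatible_flip {n : ℕ} {k : Fin n} {ε ε' : ℕ → Bool} (h : IsSignFlip n k ε ε')
    (r s : APRoot n) :
    APRoot.Compatible ε r s ↔ APRoot.Compatible ε' (r.reflect k) (s.reflect k) := by
  unfold APRoot.Compatible
  rw [rootCross_flip h, (Function.Involutive.injective (APRoot.reflect_reflect k)).ne_iff]

theorem rootVec_mem_span {n : ℕ} (k : Fin n) (a b : Fin (n + 1)) (hab : a ≤ b)
    (h : ¬(a.val ≤ k.val ∧ k.val < b.val)) :
    rootVec a b ∈ Submodule.span ℝ {v : rootSpace n | ∃ t : Fin n, t ≠ k ∧ v = simpleRoot t} := by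
  induction b using Fin.induction with
  | zero => rw [Fin.le_zero_iff.1 hab, rootVec_self]; exact Submodule.zero_mem _
  | succ i ih =>
    rcases hab.eq_or_lt with rfl | hlt
    · rw [rootVec_self]; exact Submodule.zero_mem _
    · have h1 : a ≤ i.castSucc := Fin.le_castSucc_iff.2 hlt
      have h2 : a.val ≤ i.val := h1
      simp only [Fin.val_succ, Fin.val_castSucc] at h ih
      rw [← rootVec_add a i.castSucc i.succ]
      refine Submodule.add_mem _ (ih h1 (by omega)) (Submodule.subset_span ⟨i, ?_, rfl⟩)
      rintro rfl
      omega

theorem height_eq_zero_of_mem_span {n : ℕ} {k : Fin n} {v : rootSpace n}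
    (h : v ∈ Submodule.span ℝ {v : rootSpace n | ∃ t : Fin n, t ≠ k ∧ v = simpleRoot t}) :
    height k v = 0 := by
  refine Submodule.span_induction (p := fun v _ => height k v = 0) ?_ (map_zero _) ?_ ?_ h
  · rintro _ ⟨t, ht, rfl⟩
    have := height_vec_inl k t
    rw [APRoot.vec, map_neg, if_neg ht, neg_eq_zero] at this
    exact this
  · intro x y _ _ hx hy; rw [map_add, hx, hy, add_zero]
  · intro a x _ hx; rw [map_smul, hx, smul_zero]

/-- Reading's condition (i) for noncrossing: on almost positive roots, lying in the span means that
the coefficient of `α_k` vanishes. Any `ε` is allowed, since crossings with negative simple roots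
ignore the signs. -/
theorem vec_mem_parabolic_iff {n : ℕ} (ε : ℕ → Bool) (k : Fin n) (r : APRoot n) :
    r.vec ∈ parabolicAlmostPositiveRoots k ↔ APRoot.Compatible ε (.inl k) r := by
  have hr : r.vec ∈ almostPositiveRoots n := by
    rw [almostPositiveRoots_eq_range]; exact ⟨r, rfl⟩
  unfold parabolicAlmostPositiveRoots APRoot.Compatible
  rw [Set.mem_inter_iff, and_iff_right hr, SetLike.mem_coe]
  rcases r with t | ⟨⟨a, b⟩, hab⟩
  · simp only [RootCross, not_false_eq_true, and_true, ne_eq, Sum.inl.injEq]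
    constructor
    · rintro h rfl
      have := height_eq_zero_of_mem_span h
      rw [height_vec_inl] at this
      simp at this
    · intro h
      exact Submodule.neg_mem _ (Submodule.subset_span ⟨t, fun h' => h h'.symm, rfl⟩)
  · simp only [ne_eq, reduceCtorEq, not_false_eq_true, true_and, RootCross]
    constructor
    · intro h h'
      have := height_eq_zero_of_mem_span h
      rw [height_vec_inr, if_pos h'] at this
      exact one_ne_zero this
    · exact rootVec_mem_span k a b (le_of_lt hab)

/-- Noncrossing satisfies both of Reading's conditions, so it contains the relation they generate.
This gives the nontrivial direction of (i) for `CCompatible`. -/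
theorem CCompatible.exists_compatible {n : ℕ} {w : Equiv.Perm (Fin (n + 1))}
    {α β : rootSpace n} (h : CCompatible w α β) :
    ∃ r s : APRoot n, r.vec = α ∧ s.vec = β ∧ APRoot.Compatible (permSign w) r s := by
  induction h with
  | base w k β hw hβ =>
    obtain ⟨r, rfl⟩ : β ∈ Set.range APRoot.vec := by
      rw [← almostPositiveRoots_eq_range]; exact hβ.1
    exact ⟨.inl k, r, rfl, rfl, (vec_mem_parabolic_iff _ k r).1 hβ⟩
  | of_sigma w k α β hk hα hβ _ ih =>
    obtain ⟨r, s, hr, hs, hrs⟩ := ih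
    rw [almostPositiveRoots_eq_range] at hα hβ
    obtain ⟨r', rfl⟩ := hα
    obtain ⟨s', rfl⟩ := hβ
    rw [sigma_vec] at hr hs
    obtain rfl := APRoot.vec_injective hr
    obtain rfl := APRoot.vec_injective hs
    exact ⟨r', s', rfl, rfl, (compatible_flip hk.isSignFlip r' s').2 hrs⟩
  | to_sigma w k α β hk hα hβ _ ih =>
    obtain ⟨r, s, rfl, rfl, hrs⟩ := ih
    exact ⟨r.reflect k, s.reflect k, (sigma_vec k r).symm, (sigma_vec k s).symm,
      (compatible_flip hk.isSignFlip r s).1 hrs⟩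

theorem isCompatibilityFamily_cCompatible (n : ℕ) :
    IsCompatibilityFamily (CCompatible (n := n)) where
  neg_simple_iff w hw k β hβ := by
    constructor
    · intro h
      obtain ⟨r, s, hr, rfl, hrs⟩ := h.exists_compatible
      obtain rfl : r = .inl k := APRoot.vec_injective hr
      exact (vec_mem_parabolic_iff _ k s).2 hrs
    · exact CCompatible.base w k β hw
  sigma_iff w k hk α hα β hβ :=
    ⟨CCompatible.to_sigma w k α β hk hα hβ, CCompatible.of_sigma w k α β hk hα hβ⟩

/-! ### Uniqueness of the compatibility family -/

section Uniqueness

variable {n : ℕ} {R : Equiv.Perm (Fin (n + 1)) → rootSpace n → rootSpace n → Prop}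

/-- The relation agrees with noncrossing of labels at the root `r`. -/
def AgreesAt (R : Equiv.Perm (Fin (n + 1)) → rootSpace n → rootSpace n → Prop)
    (w : Equiv.Perm (Fin (n + 1))) (r : APRoot n) : Prop :=
  ∀ s : APRoot n, R w r.vec s.vec ↔ APRoot.Compatible (permSign w) r s

theorem IsCompatibilityFamily.agreesAt_inl (hR : IsCompatibilityFamily R)
    {w : Equiv.Perm (Fin (n + 1))} (hw : IsCoxeterElement w) (k : Fin n) :
    AgreesAt R w (.inl k) := fun s => by
  rw [← vec_mem_parabolic_iff]
  exact hR.neg_simple_iff w hw k s.vec (by rw [almostPositiveRoots_eq_range]; exact ⟨s, rfl⟩)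

theorem IsCompatibilityFamily.agreesAt_of_reflect (hR : IsCompatibilityFamily R)
    {w : Equiv.Perm (Fin (n + 1))} {k : Fin n} (hk : IsInitial k w) {r : APRoot n}
    (h : AgreesAt R (simpleReflection k * w * simpleReflection k) (r.reflect k)) :
    AgreesAt R w r := fun s => by
  have hmem : ∀ r : APRoot n, r.vec ∈ almostPositiveRoots n := fun r => by
    rw [almostPositiveRoots_eq_range]; exact ⟨r, rfl⟩
  rw [hR.sigma_iff w k hk _ (hmem r) _ (hmem s), sigma_vec, sigma_vec, h,
    ← compatible_flip hk.isSignFlip]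

/-- Apply `σ` for the letters of `l` in turn. The letters move to the end of the word, and the root
is transformed by `(wordProd l)⁻¹` as long as it stays positive. Should a letter reverse its ends,
it becomes a negative simple root and condition (i) settles the matter, so only the order-preserving
case needs a hypothesis. -/
theorem IsCompatibilityFamily.agreesAt_of_rotate (hR : IsCompatibilityFamily R)
    (l : List (Fin n)) : ∀ (m : List (Fin n)), IsCoxeterWord (l ++ m) →
    ∀ (a b : Fin (n + 1)) (hab : a < b),
    (∀ h : (wordProd l)⁻¹ a < (wordProd l)⁻¹ b, AgreesAt R (wordProd (m ++ l))
      (.inr ⟨((wordProd l)⁻¹ a, (wordProd l)⁻¹ b), h⟩)) →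
    AgreesAt R (wordProd (l ++ m)) (.inr ⟨(a, b), hab⟩) := by
  induction l with
  | nil =>
    intro m _ a b hab h
    simpa [wordProd] using h (by simpa [wordProd] using hab)
  | cons k l ih =>
    intro m hm a b hab h
    have hk : IsInitial k (wordProd (k :: (l ++ m))) := ⟨l ++ m, hm, rfl⟩
    refine hR.agreesAt_of_reflect hk ?_
    have hrot : IsCoxeterWord (l ++ m ++ [k]) := IsCoxeterWord.rotate hm
    rw [List.append_assoc] at hrot
    rw [conj_wordProd_cons, List.append_assoc]
    by_cases hs : simpleReflection k a < simpleReflection k b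
    · have : APRoot.reflect k (.inr ⟨(a, b), hab⟩) =
          .inr ⟨(simpleReflection k a, simpleReflection k b), hs⟩ := by
        simp only [APRoot.reflect, dif_pos hs]
      rw [this]
      refine ih (m ++ [k]) hrot _ _ hs fun h' => ?_
      have e : ∀ x, (wordProd l)⁻¹ (simpleReflection k x) = (wordProd (k :: l))⁻¹ x := by
        intro x
        rw [wordProd_cons, mul_inv_rev, Equiv.Perm.mul_apply, simpleReflection_inv]
      have h'' := h'
      rw [e, e] at h''
      have := h h''
      simp only [e]
      rw [List.append_assoc]
      exact this
    · have : APRoot.reflect k (.inr ⟨(a, b), hab⟩) = .inl k := by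
        simp only [APRoot.reflect, dif_neg hs]
      rw [this]
      exact hR.agreesAt_inl ⟨_, hrot, rfl⟩ k

/-- Rotating through the whole word returns to `w` and applies `w⁻¹` to the ends. If some power of
`w⁻¹` reverses them, a negative simple root was met on the way. -/
theorem IsCompatibilityFamily.agreesAt_of_pow (hR : IsCompatibilityFamily R)
    {w : Equiv.Perm (Fin (n + 1))} (hw : IsCoxeterElement w) (N : ℕ) :
    ∀ (a b : Fin (n + 1)) (hab : a < b), ¬((w⁻¹ ^ N) a < (w⁻¹ ^ N) b) →
      AgreesAt R w (.inr ⟨(a, b), hab⟩) := by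
  obtain ⟨l, hl, rfl⟩ := hw
  induction N with
  | zero => intro a b hab h; exact absurd hab h
  | succ N ih =>
    intro a b hab h
    have := hR.agreesAt_of_rotate l [] (by simpa using hl) a b hab fun h' =>
      ih _ _ h' (by rwa [pow_succ, Equiv.Perm.mul_apply, Equiv.Perm.mul_apply] at h)
    simpa using this

/-- If `s_{j-1}` is not to the right of `s_j`, then `w` moves `j` up. Otherwise the reversed word,
which represents `w⁻¹`, has this property. -/
theorem IsCoxeterElement.lt_apply_or {w : Equiv.Perm (Fin (n + 1))} (hw : IsCoxeterElement w)
    (j : Fin n) : j.castSucc < w j.castSucc ∨ j.castSucc < w⁻¹ j.castSucc := by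
  obtain ⟨l, hl, rfl⟩ := hw
  obtain ⟨L, B, rfl⟩ := List.append_of_mem (hl.2 j)
  have hnd := List.nodup_middle.1 hl.1
  rw [List.nodup_cons, List.mem_append, not_or, List.nodup_append] at hnd
  by_cases h : ∀ i ∈ B, i.val + 1 ≠ j.val
  · exact Or.inl (lt_wordProd_apply hnd.1.1 hnd.1.2 h)
  · right
    push Not at h
    obtain ⟨i, hi, hij⟩ := h
    rw [← wordProd_reverse]
    have := lt_wordProd_apply (j := j) (l := B.reverse) (m := L.reverse) (by simpa using hnd.1.2)
      (by simpa using hnd.1.1) (by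
        intro i' hi' hij'
        obtain rfl : i = i' := Fin.ext (by omega)
        exact hnd.2.2.2 i (List.mem_reverse.1 hi') i hi rfl)
    simpa using this

/-- The largest point of the orbit is moved up neither by `w⁻¹` nor by `w`, which is itself a power
of `w⁻¹` because the order is finite. Every point but the last is moved up by one of the two. -/
theorem IsCoxeterElement.exists_pow_eq_last {w : Equiv.Perm (Fin (n + 1))}
    (hw : IsCoxeterElement w) (a : Fin (n + 1)) : ∃ N : ℕ, (w⁻¹ ^ N) a = Fin.last n := by
  obtain ⟨_, ⟨N, rfl⟩, hmax⟩ := Set.exists_max_image (Set.range fun N : ℕ => (w⁻¹ ^ N) a) id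
    (Set.toFinite _) ⟨_, 0, rfl⟩
  refine ⟨N, ?_⟩
  by_contra hne
  obtain ⟨j, hj⟩ := Fin.exists_castSucc_eq.2 hne
  rcases hw.lt_apply_or j with h | h
  · obtain ⟨m, hm⟩ : ∃ m : ℕ, w⁻¹ ^ m = w := by
      have hpos := orderOf_pos w⁻¹
      refine ⟨orderOf w⁻¹ - 1, ?_⟩
      have h1 : w⁻¹ ^ (orderOf w⁻¹ - 1) * w⁻¹ = 1 := by
        rw [← pow_succ, Nat.sub_add_cancel hpos, pow_orderOf_eq_one]
      rw [mul_inv_eq_one] at h1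
      exact h1
    have := hmax _ ⟨m + N, rfl⟩
    simp only [id, pow_add, Equiv.Perm.mul_apply, hm] at this
    rw [← hj] at this
    exact absurd h (not_lt.2 this)
  · have := hmax _ ⟨N + 1, rfl⟩
    simp only [id, pow_succ', Equiv.Perm.mul_apply] at this
    rw [← hj] at this
    exact absurd h (not_lt.2 this)

theorem IsCompatibilityFamily.iff_compatible (hR : IsCompatibilityFamily R)
    {w : Equiv.Perm (Fin (n + 1))} (hw : IsCoxeterElement w) (r s : APRoot n) :
    R w r.vec s.vec ↔ APRoot.Compatible (permSign w) r s := by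
  rcases r with k | ⟨⟨a, b⟩, hab⟩
  · exact hR.agreesAt_inl hw k s
  · obtain ⟨N, hN⟩ := hw.exists_pow_eq_last a
    exact hR.agreesAt_of_pow hw N a b hab (by rw [hN]; exact (Fin.le_last _).not_gt) s

end Uniqueness

/-! ### Signs -/

theorem idxOf_lt_of_mem_right {α : Type*} [DecidableEq α] {l m : List α} {i j : α} (hj : j ∉ l)
    (hij : i ≠ j) (hi : i ∉ l) : (l ++ j :: m).idxOf j < (l ++ j :: m).idxOf i := by
  rw [List.idxOf_append_of_notMem hj, List.idxOf_append_of_notMem hi, List.idxOf_cons_self,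
    List.idxOf_cons_ne _ hij.symm]
  omega

/-- With indices from `0`, the sign `c i` compares the generators `i` and `i + 1`, which share the
point `i + 1`. If generator `i` comes first, the point goes up through generator `i + 1`. Otherwise
it goes down through generator `i`. -/
theorem IsCoxeterElementOfSigns.permSign_eq {n : ℕ} {c : Fin (n - 1) → ℤˣ}
    {w : Equiv.Perm (Fin (n + 1))} (h : IsCoxeterElementOfSigns c w) (i : Fin (n - 1)) :
    permSign w (i.val + 1) = decide (c i = 1) := by
  obtain ⟨l, hl, hc, rfl⟩ := h
  have hi := i.2
  set a : Fin n := ⟨i.val, by omega⟩ with ha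
  set b : Fin n := ⟨i.val + 1, by omega⟩ with hb
  have hab : b ≠ a := by rw [ha, hb]; simp
  obtain ⟨h1, h2⟩ := hc i
  rw [← ha, ← hb] at h1 h2
  rcases Int.units_eq_one_or (c i) with hci | hci
  · have hlt := h1 hci
    obtain ⟨L, B, hLB⟩ := List.append_of_mem (hl.2 b)
    rw [hLB] at hlt
    have hnd := hl.1
    rw [hLB, List.nodup_middle, List.nodup_cons, List.mem_append, not_or,
      List.nodup_append] at hnd
    have hd : ∀ j ∈ B, j.val + 1 ≠ b.val := by
      intro j hj hjb
      obtain rfl : j = a := Fin.ext (by simp only [hb] at hjb; simp only [ha]; omega)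
      exact absurd hlt (idxOf_lt_of_mem_right hnd.1.1 hab.symm
        fun haL => hnd.2.2.2 _ haL _ hj rfl).le.not_gt
    have := lt_wordProd_apply hnd.1.1 hnd.1.2 hd
    rw [← hLB] at this
    change permSign _ b.castSucc.val = _
    rw [permSign_val, hci]
    simpa using this
  · have hlt := h2 hci
    obtain ⟨L, B, hLB⟩ := List.append_of_mem (hl.2 a)
    rw [hLB] at hlt
    have hnd := hl.1
    rw [hLB, List.nodup_middle, List.nodup_cons, List.mem_append, not_or,
      List.nodup_append] at hnd
    have hd : ∀ j ∈ B, j.val ≠ a.val + 1 := by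
      intro j hj hjb
      obtain rfl : j = b := Fin.ext (by simp only [ha] at hjb; simp only [hb]; omega)
      exact absurd hlt (idxOf_lt_of_mem_right hnd.1.1 hab
        fun haL => hnd.2.2.2 _ haL _ hj rfl).le.not_gt
    have := wordProd_apply_lt hnd.1.1 hnd.1.2 hd
    rw [← hLB] at this
    change permSign _ a.succ.val = _
    rw [permSign_val, hci]
    simpa using this.le

theorem exists_isCoxeterElementOfSigns {n : ℕ} (c : Fin (n - 1) → ℤˣ) :
    ∃ w, IsCoxeterElementOfSigns c w := by
  have key : ∀ k : ℕ, k ≤ n → ∃ l : List (Fin n), l.Nodup ∧ (∀ i, i ∈ l ↔ i.val < k) ∧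
      ∀ i : Fin (n - 1), i.val + 1 < k →
      (c i = 1 → l.idxOf (⟨i, by omega⟩ : Fin n) < l.idxOf (⟨i + 1, by omega⟩ : Fin n)) ∧
      (c i = -1 → l.idxOf (⟨i + 1, by omega⟩ : Fin n) < l.idxOf (⟨i, by omega⟩ : Fin n)) := by
    intro k
    induction k with
    | zero => intro _; exact ⟨[], by simp, by simp, by simp⟩
    | succ k ih =>
      intro hk
      obtain ⟨l, hnd, hmem, hc⟩ := ih (by omega)
      have hkl : (⟨k, hk⟩ : Fin n) ∉ l := by rw [hmem]; simp
      -- The new generator `k` is put in front of the word if its sign relative to `k - 1` is `-`,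
      -- and at the end otherwise.
      by_cases hsign : ∃ i : Fin (n - 1), i.val + 1 = k ∧ c i = -1
      · obtain ⟨i₀, hi₀, hci₀⟩ := hsign
        refine ⟨⟨k, hk⟩ :: l, List.nodup_cons.2 ⟨hkl, hnd⟩, fun i => ?_, fun i hi => ?_⟩
        · rw [List.mem_cons, hmem, Fin.ext_iff]
          change i.val = k ∨ i.val < k ↔ _
          omega
        · by_cases hik : i.val + 1 = k
          · obtain rfl : i = i₀ := Fin.ext (by omega)
            refine ⟨fun h => by rw [hci₀] at h; exact absurd h (by decide), fun _ => ?_⟩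
            have e : (⟨i.val + 1, by omega⟩ : Fin n) = ⟨k, hk⟩ := Fin.ext hik
            rw [e, List.idxOf_cons_self, List.idxOf_cons_ne]
            · omega
            · rw [Ne, Fin.ext_iff]; change ¬ k = i.val; omega
          · rw [List.idxOf_cons_ne, List.idxOf_cons_ne]
            · have := hc i (by omega)
              exact ⟨fun h => Nat.succ_lt_succ (this.1 h), fun h => Nat.succ_lt_succ (this.2 h)⟩
            · rw [Ne, Fin.ext_iff]; change ¬ k = i.val + 1; omega
            · rw [Ne, Fin.ext_iff]; change ¬ k = i.val; omega
      · refine ⟨l ++ [⟨k, hk⟩], ?_, fun i => ?_, fun i hi => ?_⟩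
        · rw [List.nodup_append]
          refine ⟨hnd, by simp, fun a ha b hb => ?_⟩
          rw [List.mem_singleton] at hb
          rintro rfl
          exact hkl (hb ▸ ha)
        · rw [List.mem_append, hmem, List.mem_singleton, Fin.ext_iff]
          change i.val < k ∨ i.val = k ↔ _
          omega
        · by_cases hik : i.val + 1 = k
          · have hmi : (⟨i.val, by omega⟩ : Fin n) ∈ l := by
              rw [hmem]; change i.val < k; omega
            refine ⟨fun _ => ?_, fun h => absurd ⟨i, hik, h⟩ hsign⟩
            have e : (⟨i.val + 1, by omega⟩ : Fin n) = ⟨k, hk⟩ := Fin.ext hik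
            rw [e, List.idxOf_append_of_mem hmi, List.idxOf_append_of_notMem hkl]
            have := List.idxOf_lt_length_iff.2 hmi
            omega
          · rw [List.idxOf_append_of_mem, List.idxOf_append_of_mem]
            · exact hc i (by omega)
            · rw [hmem]; change i.val + 1 < k; omega
            · rw [hmem]; change i.val < k; omega
  obtain ⟨l, hnd, hmem, hc⟩ := key n le_rfl
  exact ⟨_, l, ⟨hnd, fun i => (hmem i).2 i.2⟩, fun i => hc i (by omega), rfl⟩

theorem IsCoxeterElement.exists_signs {n : ℕ} {w : Equiv.Perm (Fin (n + 1))}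
    (hw : IsCoxeterElement w) : ∃ c : Fin (n - 1) → ℤˣ, IsCoxeterElementOfSigns c w := by
  obtain ⟨l, hl, rfl⟩ := hw
  refine ⟨fun i => if l.idxOf (⟨i, by omega⟩ : Fin n) < l.idxOf (⟨i + 1, by omega⟩ : Fin n)
    then 1 else -1, l, hl, fun i => ⟨fun h => ?_, fun h => ?_⟩, rfl⟩
  · by_contra hlt
    dsimp only at h
    rw [if_neg hlt] at h
    exact absurd h (by decide)
  · rcases lt_trichotomy (l.idxOf (⟨i, by omega⟩ : Fin n)) (l.idxOf (⟨i + 1, by omega⟩ : Fin n))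
      with h' | h' | h'
    · dsimp only at h
      rw [if_pos h'] at h
      exact absurd h (by decide)
    · have := (List.idxOf_inj (hl.2 _)).1 h'
      simp at this
    · exact h'

/-! ## Positions of the diagonals of a path triangulation -/

/-- The number of signs `-` among the indices `1, …, m`. -/
def minusCount (ε : ℕ → Bool) : ℕ → ℕ
  | 0 => 0
  | m + 1 => minusCount ε m + if ε (m + 1) then 0 else 1

/-- The number of signs `+` among the indices `1, …, m`. -/
def plusCount (ε : ℕ → Bool) : ℕ → ℕ
  | 0 => 0
  | m + 1 => plusCount ε m + if ε (m + 1) then 1 else 0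

theorem minusCount_add_plusCount (ε : ℕ → Bool) (m : ℕ) :
    minusCount ε m + plusCount ε m = m := by
  induction m with
  | zero => rfl
  | succ m ih =>
    simp only [minusCount, plusCount]
    split_ifs <;> omega

theorem count_le (ε : ℕ → Bool) {a b : ℕ} (h : a ≤ b) :
    minusCount ε a ≤ minusCount ε b ∧ plusCount ε a ≤ plusCount ε b := by
  induction b, h using Nat.le_induction with
  | base => exact ⟨le_rfl, le_rfl⟩
  | succ b _ ih => exact ⟨ih.1.trans (Nat.le_add_right _ _), ih.2.trans (Nat.le_add_right _ _)⟩

theorem count_lt (ε : ℕ → Bool) {a b : ℕ} (h : a < b) :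
    minusCount ε a + (if ε b then 0 else 1) ≤ minusCount ε b ∧
      plusCount ε a + (if ε b then 1 else 0) ≤ plusCount ε b := by
  obtain ⟨b, rfl⟩ : ∃ b', b = b' + 1 := ⟨b - 1, by omega⟩
  have := count_le ε (Nat.lt_succ_iff.1 h)
  simp only [minusCount, plusCount]
  omega

/-- The smaller endpoint of the diagonal of a root, relative to the first vertex of the path. -/
def loPos {n : ℕ} (ε : ℕ → Bool) : APRoot n → ℕ
  | .inl k => 1 + minusCount ε k
  | .inr p => if ε p.1.1 then
      (if ε p.1.2 then n + 2 - plusCount ε p.1.2 else 1 + minusCount ε p.1.2)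
      else minusCount ε p.1.1

/-- The larger endpoint of the diagonal of a root, relative to the first vertex of the path. -/
def hiPos {n : ℕ} (ε : ℕ → Bool) : APRoot n → ℕ
  | .inl k => n + 2 - plusCount ε k
  | .inr p => if ε p.1.1 then n + 3 - plusCount ε p.1.1
      else (if ε p.1.2 then n + 2 - plusCount ε p.1.2 else 1 + minusCount ε p.1.2)

/-- Signs on `0, …, n` that are negative at both ends. -/
def IsEndNeg (n : ℕ) (ε : ℕ → Bool) : Prop := ε 0 = false ∧ ε n = false

/-- Positions count counterclockwise steps from a vertex of the first triangle that is not on the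
first diagonal. At a sign `-` the low end of the current diagonal advances, at `+` the high end
recedes. The root from `a` to `b` starts at the vertex of triangle `a` that is off diagonal `a` and
ends at the vertex of triangle `b` that is off diagonal `b - 1`. The negative end signs make these
formulas valid also for `a = 0` and `b = n`. -/
theorem loPos_hiPos {n : ℕ} {ε : ℕ → Bool} (hε : IsEndNeg n ε) (r : APRoot n) :
    loPos ε r + 1 < hiPos ε r ∧ hiPos ε r < n + 3 ∧ ¬(loPos ε r = 0 ∧ hiPos ε r = n + 2) := by
  rcases r with k | ⟨⟨a, b⟩, hab⟩
  · have := minusCount_add_plusCount ε k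
    have := k.2
    simp only [loPos, hiPos]
    omega
  · have hab : a.val < b.val := hab
    have h1 := minusCount_add_plusCount ε a
    have h2 := minusCount_add_plusCount ε b
    have h3 := count_lt ε hab
    have h4 := b.2
    have h5 : ε a = true → 1 ≤ plusCount ε a := by
      intro h
      have h0 : 0 < a.val := by
        rw [Nat.pos_iff_ne_zero]; intro h0; rw [h0, hε.1] at h; exact absurd h (by decide)
      have := count_lt ε h0
      rw [if_pos h, if_pos h] at this
      omega
    simp only [loPos, hiPos]
    cases hea : ε a <;> cases heb : ε b <;>
      simp only [hea, heb, if_true, forall_const, Bool.false_eq_true, if_false] at h3 h5 ⊢ <;> omega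

/-- The diagonal runs from triangle `a` to triangle `b`, so it crosses exactly the path diagonals
between them. -/
theorem pos_cross_inl_inr {n : ℕ} {ε : ℕ → Bool} (hε : IsEndNeg n ε) {k a b : ℕ} (hk : k < n)
    (hab : a < b) (hb : b ≤ n) {p q r s : ℕ}
    (hp : p = 1 + minusCount ε k) (hq : q = n + 2 - plusCount ε k)
    (hr : r = if ε a then (if ε b then n + 2 - plusCount ε b else 1 + minusCount ε b)
      else minusCount ε a)
    (hs : s = if ε a then n + 3 - plusCount ε a
      else (if ε b then n + 2 - plusCount ε b else 1 + minusCount ε b)) :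
    ((p < r ∧ r < q ∧ q < s) ∨ (r < p ∧ p < s ∧ s < q)) ↔ a ≤ k ∧ k < b := by
  have h1 := minusCount_add_plusCount ε a
  have h2 := minusCount_add_plusCount ε b
  have h3 := count_lt ε hab
  have h4 := minusCount_add_plusCount ε k
  have h5 : ε a = true → 0 < a := by
    intro h
    rw [Nat.pos_iff_ne_zero]; rintro rfl; rw [hε.1] at h; exact absurd h (by decide)
  have h6 : 0 < a → plusCount ε 0 + (if ε a then 1 else 0) ≤ plusCount ε a :=
    fun h => (count_lt ε h).2
  rcases lt_or_ge k a with hka | hka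
  · have h7 := count_lt ε hka
    cases hea : ε a <;> cases heb : ε b <;>
      simp only [hea, heb, if_true, forall_const, Bool.false_eq_true, if_false] at * <;> omega
  · have h7 := count_le ε hka
    rcases lt_or_ge k b with hkb | hkb
    · have h8 := count_lt ε hkb
      cases hea : ε a <;> cases heb : ε b <;>
        simp only [hea, heb, if_true, forall_const, Bool.false_eq_true, if_false] at * <;> omega
    · have h8 := count_le ε hkb
      cases hea : ε a <;> cases heb : ε b <;>
        simp only [hea, heb, if_true, forall_const, Bool.false_eq_true, if_false] at * <;> omega

-- The sign of an inner endpoint tells on which of the two boundary chains (low or high positions)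
-- it lies. Overlapping diagonals cross when both inner endpoints are on the same chain, nested ones
-- when the inner diagonal passes from one chain to the other. Each order type and sign pattern
-- reduces to the monotonicity of the counts.
set_option maxHeartbeats 1000000 in
theorem pos_cross_inr_inr {n : ℕ} {ε : ℕ → Bool} (hε : IsEndNeg n ε) {a b a' b' : ℕ}
    (hab : a < b) (hb : b ≤ n) (hab' : a' < b') (hb' : b' ≤ n) (haa : a ≤ a') {p q r s : ℕ}
    (hp : p = if ε a then (if ε b then n + 2 - plusCount ε b else 1 + minusCount ε b)
      else minusCount ε a)
    (hq : q = if ε a then n + 3 - plusCount ε a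
      else (if ε b then n + 2 - plusCount ε b else 1 + minusCount ε b))
    (hr : r = if ε a' then (if ε b' then n + 2 - plusCount ε b' else 1 + minusCount ε b')
      else minusCount ε a')
    (hs : s = if ε a' then n + 3 - plusCount ε a'
      else (if ε b' then n + 2 - plusCount ε b' else 1 + minusCount ε b')) :
    ((p < r ∧ r < q ∧ q < s) ∨ (r < p ∧ p < s ∧ s < q)) ↔ IntervalCross ε a b a' b' := by
  have h1 := minusCount_add_plusCount ε a
  have h2 := minusCount_add_plusCount ε b
  have h3 := count_lt ε hab
  have h4 := minusCount_add_plusCount ε a'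
  have h5 := minusCount_add_plusCount ε b'
  have h6 := count_lt ε hab'
  have h8 : ε a = true → 1 ≤ plusCount ε a := by
    intro h
    have h0 : 0 < a := by
      rw [Nat.pos_iff_ne_zero]; intro h0; rw [h0, hε.1] at h; exact absurd h (by decide)
    have := count_lt ε h0
    rw [if_pos h, if_pos h] at this
    omega
  unfold IntervalCross
  rcases haa.eq_or_lt with rfl | haa
  · rcases lt_trichotomy b b' with hbb | rfl | hbb
    · have h7 := count_lt ε hbb
      cases hea : ε a <;> cases heb : ε b <;> cases heb' : ε b' <;>
        simp only [hea, heb, heb', if_true, forall_const, Bool.false_eq_true, if_false] at * <;>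
        omega
    · omega
    · have h7 := count_lt ε hbb
      cases hea : ε a <;> cases heb : ε b <;> cases heb' : ε b' <;>
        simp only [hea, heb, heb', if_true, forall_const, Bool.false_eq_true, if_false] at * <;>
        omega
  · have h9 := count_lt ε haa
    rcases lt_trichotomy b a' with hba | rfl | hba
    · have h7 := count_lt ε hba
      cases hea : ε a <;> cases heb : ε b <;> cases hea' : ε a' <;> cases heb' : ε b' <;>
        simp only [hea, heb, hea', heb', if_true, forall_const, Bool.false_eq_true, if_false,
          reduceCtorEq, not_true_eq_false, not_false_eq_true, ne_eq, and_true, eq_self,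
            and_false, or_false, false_or] at * <;>
        omega
    · cases hea : ε a <;> cases heb : ε b <;> cases heb' : ε b' <;>
        simp only [hea, heb, heb', if_true, forall_const, Bool.false_eq_true, if_false,
          reduceCtorEq, not_true_eq_false, not_false_eq_true, ne_eq, and_true, eq_self,
            and_false, or_false, false_or, true_or, iff_true] at * <;>
        omega
    · have h7 := count_lt ε hba
      rcases lt_trichotomy b b' with hbb | rfl | hbb
      · have h10 := count_lt ε hbb
        cases hea : ε a <;> cases heb : ε b <;> cases hea' : ε a' <;> cases heb' : ε b' <;>
          simp only [hea, heb, hea', heb', if_true, forall_const, Bool.false_eq_true, if_false,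
            reduceCtorEq, not_true_eq_false, not_false_eq_true, ne_eq, and_true, eq_self,
            and_false, or_false, false_or] at * <;>
          omega
      · cases hea : ε a <;> cases heb : ε b <;> cases hea' : ε a' <;>
          simp only [hea, heb, hea', if_true, forall_const, Bool.false_eq_true, if_false,
            reduceCtorEq, not_true_eq_false, not_false_eq_true, ne_eq, and_true, eq_self,
            and_false, or_false, false_or] at * <;>
          omega
      · have h10 := count_lt ε hbb
        cases hea : ε a <;> cases heb : ε b <;> cases hea' : ε a' <;> cases heb' : ε b' <;>
          simp only [hea, heb, hea', heb', if_true, forall_const, Bool.false_eq_true, if_false,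
            reduceCtorEq, not_true_eq_false, not_false_eq_true, ne_eq, and_true, eq_self,
            and_false, or_false, false_or] at * <;>
          omega

/-- The positions of two roots interleave if and only if the roots cross. -/
theorem pos_cross_iff {n : ℕ} {ε : ℕ → Bool} (hε : IsEndNeg n ε) (x y : APRoot n) :
    ((loPos ε x < loPos ε y ∧ loPos ε y < hiPos ε x ∧ hiPos ε x < hiPos ε y) ∨
      (loPos ε y < loPos ε x ∧ loPos ε x < hiPos ε y ∧ hiPos ε y < hiPos ε x)) ↔
      RootCross ε x y := by
  rcases x with k | ⟨⟨a, b⟩, hab⟩ <;> rcases y with j | ⟨⟨a', b'⟩, hab'⟩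
  · simp only [loPos, hiPos, RootCross, iff_false]
    have h1 := minusCount_add_plusCount ε k
    have h2 := minusCount_add_plusCount ε j
    rcases le_total k.val j.val with h | h
    · have := count_le ε h; omega
    · have := count_le ε h; omega
  · exact pos_cross_inl_inr hε k.2 hab' (Nat.lt_succ_iff.1 b'.2) rfl rfl rfl rfl
  · rw [or_comm]
    exact pos_cross_inl_inr hε j.2 hab (Nat.lt_succ_iff.1 b.2) rfl rfl rfl rfl
  · rcases le_total a.val a'.val with h | h
    · exact pos_cross_inr_inr hε hab (Nat.lt_succ_iff.1 b.2) hab' (Nat.lt_succ_iff.1 b'.2) h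
        rfl rfl rfl rfl
    · rw [or_comm]
      exact (pos_cross_inr_inr hε hab' (Nat.lt_succ_iff.1 b'.2) hab (Nat.lt_succ_iff.1 b.2) h
        rfl rfl rfl rfl).trans ⟨IntervalCross.symm, IntervalCross.symm⟩

/-! ### Rotating the polygon -/

/-- The vertex reached from `A` after `p` counterclockwise steps. -/
def vertex {n : ℕ} (A : Fin (n + 3)) (p : ℕ) : Fin (n + 3) :=
  ⟨(A.val + p) % (n + 3), Nat.mod_lt _ (by omega)⟩

theorem vertex_val {n : ℕ} (A : Fin (n + 3)) {p : ℕ} (hp : p < n + 3) :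
    (A.val + p < n + 3 ∧ (vertex A p).val = A.val + p) ∨
      (n + 3 ≤ A.val + p ∧ (vertex A p).val = A.val + p - (n + 3)) := by
  have hA := A.2
  rcases lt_or_ge (A.val + p) (n + 3) with h | h
  · exact Or.inl ⟨h, Nat.mod_eq_of_lt h⟩
  · refine Or.inr ⟨h, ?_⟩
    change (A.val + p) % (n + 3) = _
    rw [Nat.mod_eq_sub_mod h, Nat.mod_eq_of_lt (by omega)]

theorem vertex_inj {n : ℕ} (A : Fin (n + 3)) {p q : ℕ} (hp : p < n + 3) (hq : q < n + 3) :
    vertex A p = vertex A q ↔ p = q := by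
  have h1 := vertex_val A hp
  have h2 := vertex_val A hq
  rw [Fin.ext_iff]
  omega

theorem exists_vertex_eq {n : ℕ} (A x : Fin (n + 3)) : ∃ p < n + 3, vertex A p = x := by
  have hA := A.2
  have hx := x.2
  rcases le_or_gt A.val x.val with h | h
  · refine ⟨x.val - A.val, by omega, Fin.ext ?_⟩
    have := vertex_val A (p := x.val - A.val) (by omega)
    omega
  · refine ⟨x.val + (n + 3) - A.val, by omega, Fin.ext ?_⟩
    have := vertex_val A (p := x.val + (n + 3) - A.val) (by omega)
    omega

theorem counterclockwise_vertex {n : ℕ} (A : Fin (n + 3)) {p q r : ℕ} (hp : p < n + 3)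
    (hq : q < n + 3) (hr : r < n + 3) :
    Counterclockwise (vertex A p) (vertex A q) (vertex A r) ↔
      (p < q ∧ q < r) ∨ (q < r ∧ r < p) ∨ (r < p ∧ p < q) := by
  have h1 := vertex_val A hp
  have h2 := vertex_val A hq
  have h3 := vertex_val A hr
  have hA := A.2
  simp only [Counterclockwise, Fin.lt_def]
  rcases h1 with h1 | h1 <;> rcases h2 with h2 | h2 <;> rcases h3 with h3 | h3 <;>
    rw [h1.2, h2.2, h3.2] <;> omega

theorem pair_cases {α : Type*} [DecidableEq α] {a b c d : α}
    (h : ({a, b} : Finset α) = {c, d}) : (a = c ∧ b = d) ∨ (a = d ∧ b = c) := by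
  have := congrArg (fun s : Finset α => (s : Set α)) h
  simp only [Finset.coe_insert, Finset.coe_singleton] at this
  exact Set.pair_eq_pair_iff.1 this

/-- Crossing is invariant under rotation, so it can be tested on positions counted from any vertex
`A`. -/
theorem crosses_iff_of_endpoints {n : ℕ} (A : Fin (n + 3)) {d d' : Diagonal n} {p q r s : ℕ}
    (hpq : p < q) (hq : q < n + 3) (hrs : r < s) (hs : s < n + 3)
    (hd : endpoints d = {vertex A p, vertex A q}) (hd' : endpoints d' = {vertex A r, vertex A s}) :
    Crosses d d' ↔ (p < r ∧ r < q ∧ q < s) ∨ (r < p ∧ p < s ∧ s < q) := by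
  obtain ⟨⟨x, y⟩, hxy, hxy'⟩ := d
  obtain ⟨⟨z, w⟩, hzw, hzw'⟩ := d'
  have hA := A.2
  have h1 := vertex_val A (hpq.trans hq)
  have h2 := vertex_val A hq
  have h3 := vertex_val A (hrs.trans hs)
  have h4 := vertex_val A hs
  simp only [endpoints] at hd hd'
  simp only [Crosses, Fin.lt_def]
  simp only at hxy hxy' hzw hzw'
  rcases pair_cases hd with ⟨e1, e2⟩ | ⟨e1, e2⟩ <;>
    rcases pair_cases hd' with ⟨e3, e4⟩ | ⟨e3, e4⟩ <;>
    rw [Fin.ext_iff] at e1 e2 e3 e4 <;>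
    rcases h1 with h1 | h1 <;> rcases h2 with h2 | h2 <;> rcases h3 with h3 | h3 <;>
    rcases h4 with h4 | h4 <;> omega

theorem diagonal_ext_of_endpoints {n : ℕ} {d d' : Diagonal n} (h : endpoints d = endpoints d') :
    d = d' := by
  obtain ⟨⟨x, y⟩, hxy, hxy'⟩ := d
  obtain ⟨⟨z, w⟩, hzw, hzw'⟩ := d'
  simp only at hxy hzw
  rcases pair_cases h with ⟨e1, e2⟩ | ⟨e1, e2⟩
  · simp only at e1 e2
    subst e1 e2
    rfl
  · simp only at e1 e2
    subst e1 e2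
    omega

theorem exists_diagonal {n : ℕ} (A : Fin (n + 3)) {p q : ℕ} (hpq : p + 1 < q) (hq : q < n + 3)
    (h : ¬(p = 0 ∧ q = n + 2)) : ∃ d : Diagonal n, endpoints d = {vertex A p, vertex A q} := by
  have h1 := vertex_val A (p := p) (by omega)
  have h2 := vertex_val A hq
  have hA := A.2
  rcases lt_or_ge (vertex A p).val (vertex A q).val with hlt | hge
  · exact ⟨⟨(vertex A p, vertex A q), by simp only; omega⟩, rfl⟩
  · exact ⟨⟨(vertex A q, vertex A p), by simp only; omega⟩, Finset.pair_comm _ _⟩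

/-! ### The bijection between roots and diagonals -/

theorem card_diagonal_le {n : ℕ} (hn : 1 ≤ n) :
    Fintype.card (Diagonal n) ≤ Fintype.card (APRoot n) := by
  -- A long diagonal `(x, y)` gives the interval `(x, y - 2)`, and a short one `(x, x + 2)` with `x
  -- < n` gives `-α_x`. The remaining `(n, n + 2)` takes the free label `(0, n)`, which would belong
  -- to the polygon edge `(0, n + 2)`.
  let g : Diagonal n → APRoot n := fun d =>
    if h : d.1.1.val + 2 = d.1.2.val then
      if h' : d.1.1.val < n then .inl ⟨d.1.1.val, h'⟩
      else .inr ⟨(0, Fin.last n), by simp [Fin.lt_def]; omega⟩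
    else .inr ⟨(⟨d.1.1.val, by have := d.2.1; have := d.1.2.2; omega⟩,
      ⟨d.1.2.val - 2, by have := d.1.2.2; omega⟩), by
        have := d.2.1; simp only [Fin.lt_def]; omega⟩
  refine Fintype.card_le_of_injective g ?_
  rintro ⟨⟨x, y⟩, hxy, hxy'⟩ ⟨⟨z, w⟩, hzw, hzw'⟩ h
  have hx := x.2
  have hy := y.2
  have hz := z.2
  have hw := w.2
  simp only at hxy hzw hxy' hzw'
  have : x.val = z.val ∧ y.val = w.val := by
    simp only [g] at h
    split_ifs at h <;>
      simp only [Sum.inl.injEq, Sum.inr.injEq, Subtype.mk.injEq, Prod.mk.injEq, Fin.ext_iff,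
        Fin.val_zero, Fin.val_last] at h <;> omega
  obtain ⟨rfl, rfl⟩ : x = z ∧ y = w := ⟨Fin.ext this.1, Fin.ext this.2⟩
  rfl

/-- A label can be read off from the labels it crosses. So a map that preserves crossing both ways
is injective. -/
theorem RootCross.separates {n : ℕ} {ε : ℕ → Bool} {r s : APRoot n}
    (h : ∀ t, RootCross ε r t ↔ RootCross ε s t) : r = s := by
  rcases r with k | ⟨⟨a, b⟩, hab⟩ <;> rcases s with j | ⟨⟨a', b'⟩, hab'⟩
  · have := h (.inr ⟨(k.castSucc, k.succ), Fin.castSucc_lt_succ⟩)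
    simp only [RootCross, Fin.val_castSucc, Fin.val_succ] at this
    have : k.val = j.val := by omega
    rw [Fin.ext this]
  · have h1 : a'.val < b'.val := hab'
    have := h (.inl ⟨a'.val, by omega⟩)
    simp only [RootCross, false_iff] at this
    omega
  · have h1 : a.val < b.val := hab
    have := h (.inl ⟨a.val, by omega⟩)
    simp only [RootCross, iff_false] at this
    omega
  · have h1 : a.val < b.val := hab
    have h2 : a'.val < b'.val := hab'
    have k1 := h (.inl ⟨a.val, by omega⟩)
    have k2 := h (.inl ⟨a'.val, by omega⟩)
    have k3 := h (.inl ⟨b.val - 1, by omega⟩)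
    have k4 := h (.inl ⟨b'.val - 1, by omega⟩)
    simp only [RootCross] at k1 k2 k3 k4
    have h5 : a.val = a'.val ∧ b.val = b'.val := by omega
    obtain ⟨rfl, rfl⟩ : a = a' ∧ b = b' := ⟨Fin.ext h5.1, Fin.ext h5.2⟩
    rfl

/-- A bijection between labels of almost positive roots and diagonals that sends `-α_k` to `δ_k`
and identifies the two notions of crossing. -/
structure IsModel {n : ℕ} (ε : ℕ → Bool) (δ : Fin n → Diagonal n) (f : APRoot n ≃ Diagonal n) :
    Prop where
  map_inl : ∀ k, f (.inl k) = δ k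
  crosses_iff : ∀ r s, Crosses (f r) (f s) ↔ RootCross ε r s

/-- Preservation of crossing gives injectivity, and the cardinality bound makes the map bijective.
-/
theorem exists_isModel {n : ℕ} (hn : 1 ≤ n) {ε : ℕ → Bool} (hε : IsEndNeg n ε)
    (A : Fin (n + 3)) : ∃ (δ : Fin n → Diagonal n) (f : APRoot n ≃ Diagonal n),
      IsModel ε δ f ∧ ∀ k, endpoints (δ k) =
        {vertex A (1 + minusCount ε k), vertex A (n + 2 - plusCount ε k)} := by
  have hex : ∀ r : APRoot n, ∃ d : Diagonal n,
      endpoints d = {vertex A (loPos ε r), vertex A (hiPos ε r)} := fun r => by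
    obtain ⟨h1, h2, h3⟩ := loPos_hiPos hε r
    exact exists_diagonal A h1 h2 h3
  choose f hf using hex
  have hcr : ∀ r s, Crosses (f r) (f s) ↔ RootCross ε r s := fun r s => by
    obtain ⟨h1, h2, -⟩ := loPos_hiPos hε r
    obtain ⟨h3, h4, -⟩ := loPos_hiPos hε s
    rw [crosses_iff_of_endpoints A (by omega) h2 (by omega) h4 (hf r) (hf s)]
    exact pos_cross_iff hε r s
  have hinj : Function.Injective f := fun r s hrs =>
    RootCross.separates (ε := ε) fun t => by rw [← hcr, ← hcr, hrs]
  have hbij : Function.Bijective f := by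
    rw [Fintype.bijective_iff_injective_and_card]
    exact ⟨hinj, le_antisymm (Fintype.card_le_of_injective f hinj) (card_diagonal_le hn)⟩
  exact ⟨fun k => f (.inl k), Equiv.ofBijective f hbij, ⟨fun _ => rfl, hcr⟩, fun k => hf (.inl k)⟩

theorem exists_isModel_of_endpoints {n : ℕ} (hn : 1 ≤ n) {ε : ℕ → Bool} (hε : IsEndNeg n ε)
    (A : Fin (n + 3)) {δ : Fin n → Diagonal n} (hδ : ∀ k, endpoints (δ k) =
      {vertex A (1 + minusCount ε k), vertex A (n + 2 - plusCount ε k)}) :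
    ∃ f : APRoot n ≃ Diagonal n, IsModel ε δ f := by
  obtain ⟨δ', f, hf, hδ'⟩ := exists_isModel hn hε A
  have : δ' = δ := funext fun k => diagonal_ext_of_endpoints ((hδ' k).trans (hδ k).symm)
  exact ⟨f, this ▸ hf⟩

/-! ## Admissible weights and the associahedron -/

theorem Crosses.symm {n : ℕ} {d e : Diagonal n} (h : Crosses d e) : Crosses e d := Or.symm h

theorem sum_simpleRoot {n : ℕ} (a b : Fin (n + 1)) (hab : a ≤ b) :
    ∑ i : Fin n with a.val ≤ i.val ∧ i.val < b.val, simpleRoot i = rootVec a b := by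
  induction b using Fin.induction with
  | zero =>
    rw [Fin.le_zero_iff.1 hab, rootVec_self]
    exact Finset.sum_eq_zero fun i hi => by simp at hi
  | succ j ih =>
    rcases hab.eq_or_lt with rfl | hlt
    · rw [rootVec_self]
      refine Finset.sum_eq_zero fun i hi => ?_
      have := (Finset.mem_filter.1 hi).2
      omega
    · have h1 : a ≤ j.castSucc := Fin.le_castSucc_iff.2 hlt
      have h2 : a.val ≤ j.val := h1
      have : Finset.univ.filter (fun i : Fin n => a.val ≤ i.val ∧ i.val < j.succ.val) =
          insert j (Finset.univ.filter fun i : Fin n =>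
            a.val ≤ i.val ∧ i.val < j.castSucc.val) := by
        ext i
        simp only [Finset.mem_filter, Finset.mem_univ, true_and, Finset.mem_insert, Fin.ext_iff,
          Fin.val_succ, Fin.val_castSucc]
        omega
      rw [this, Finset.sum_insert (by simp), ih h1]
      exact (add_comm _ _).trans (rootVec_add _ _ _)

theorem IsModel.diagVec_apply {n : ℕ} {ε : ℕ → Bool} {δ : Fin n → Diagonal n}
    {f : APRoot n ≃ Diagonal n} (hf : IsModel ε δ f) (r : APRoot n) :
    diagVec δ (f r) = r.vec := by
  unfold diagVec
  rcases r with k | ⟨⟨a, b⟩, hab⟩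
  · rw [if_pos ⟨k, (hf.map_inl k).symm⟩, Finset.sum_eq_single k]
    · rfl
    · intro i hi hik
      have h := (Finset.mem_filter.1 hi).2
      rw [← hf.map_inl i, f.apply_eq_iff_eq, Sum.inl.injEq] at h
      exact absurd h.symm hik
    · intro hk
      exact (hk (Finset.mem_filter.2 ⟨Finset.mem_univ k, hf.map_inl k⟩)).elim
  · rw [if_neg]
    · rw [APRoot.vec, ← sum_simpleRoot a b (le_of_lt hab)]
      refine Finset.sum_congr ?_ fun _ _ => rfl
      ext i
      simp only [Finset.mem_filter, Finset.mem_univ, true_and]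
      rw [← hf.map_inl i, hf.crosses_iff]
      rfl
    · rintro ⟨i, hi⟩
      rw [← hf.map_inl i, f.apply_eq_iff_eq] at hi
      cases hi

/-! ### Flips -/

/-- The sides of the quadrilateral with diagonals `d` and `e`. -/
def quadSides {n : ℕ} (d e : Diagonal n) : Set (Diagonal n) :=
  {g | endpoints g ⊆ endpoints d ∪ endpoints e ∧ ¬Crosses g d ∧ ¬Crosses g e}

theorem quadSides_comm {n : ℕ} (d e : Diagonal n) : quadSides d e = quadSides e d := by
  ext g
  unfold quadSides
  simp only [Set.mem_ofPred_eq, Finset.union_comm (endpoints d)]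
  tauto

theorem mem_quadSides_cases {n : ℕ} {d e g : Diagonal n} (hg : g ∈ quadSides d e) :
    (g.1.1 = d.1.1 ∨ g.1.1 = d.1.2 ∨ g.1.1 = e.1.1 ∨ g.1.1 = e.1.2) ∧
      (g.1.2 = d.1.1 ∨ g.1.2 = d.1.2 ∨ g.1.2 = e.1.1 ∨ g.1.2 = e.1.2) := by
  have h1 := hg.1 (show g.1.1 ∈ endpoints g by simp [endpoints])
  have h2 := hg.1 (show g.1.2 ∈ endpoints g by simp [endpoints])
  simp only [endpoints, Finset.mem_union, Finset.mem_insert, Finset.mem_singleton] at h1 h2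
  tauto

/-- As `d` and `e` cross each other but not `h`, all four endpoints lie weakly on one side of `h`.
-/
theorem not_crosses_of_mem_quadSides {n : ℕ} {d e g h : Diagonal n} (hde : Crosses d e)
    (hg : g ∈ quadSides d e) (h1 : ¬Crosses h d) (h2 : ¬Crosses h e) : ¬Crosses h g := by
  have hc := mem_quadSides_cases hg
  obtain ⟨-, h3, h4⟩ := hg
  have h5 := d.2
  have h6 := e.2
  have h7 := g.2
  have h8 := h.2
  simp only [Crosses, Fin.lt_def, Fin.ext_iff] at *
  omega

theorem not_crosses_of_mem_endpoints {n : ℕ} {d g : Diagonal n} {x : Fin (n + 3)}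
    (hd : x ∈ endpoints d) (hg : x ∈ endpoints g) : ¬Crosses g d := by
  simp only [endpoints, Finset.mem_insert, Finset.mem_singleton] at hd hg
  simp only [Crosses, Fin.lt_def]
  rcases hd with rfl | rfl <;> rcases hg with h | h <;> rw [h] <;> omega

/-- A diagonal that crosses `e` and none of the sides cannot leave the quadrilateral, so it joins
the two endpoints of `d`. -/
theorem eq_of_crosses_of_quadSides {n : ℕ} {d e h : Diagonal n} (hde : Crosses d e)
    (hq : ∀ g ∈ quadSides d e, ¬Crosses h g) (hh : Crosses h e) : h = d := by
  -- Expressed by interleaving, because a side may be an edge of the polygon. When the interleaving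
  -- holds, `xy` is a genuine diagonal and thus a member of `quadSides d e`.
  have hside : ∀ x y : Fin (n + 3), (x ∈ endpoints d ∧ y ∈ endpoints e) ∨
      (x ∈ endpoints e ∧ y ∈ endpoints d) → x.val < y.val →
      ¬((h.1.1.val < x.val ∧ x.val < h.1.2.val ∧ h.1.2.val < y.val) ∨
        (x.val < h.1.1.val ∧ h.1.1.val < y.val ∧ y.val < h.1.2.val)) := by
    intro x y hx hxy hc
    have h1 := h.1.2.2
    have h2 := y.2
    let g : Diagonal n := ⟨(x, y), by simp only; omega⟩
    have hgx : x ∈ endpoints g := Finset.mem_insert_self _ _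
    have hgy : y ∈ endpoints g := Finset.mem_insert_of_mem (Finset.mem_singleton_self _)
    refine hq g ⟨?_, ?_, ?_⟩ hc
    · intro z hz
      simp only [g, endpoints, Finset.mem_insert, Finset.mem_singleton] at hz
      rw [Finset.mem_union]
      rcases hz with rfl | rfl <;> tauto
    · rcases hx with ⟨h1, -⟩ | ⟨-, h1⟩
      · exact not_crosses_of_mem_endpoints h1 hgx
      · exact not_crosses_of_mem_endpoints h1 hgy
    · rcases hx with ⟨-, h1⟩ | ⟨h1, -⟩
      · exact not_crosses_of_mem_endpoints h1 hgy
      · exact not_crosses_of_mem_endpoints h1 hgx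
  have hd1 : d.1.1 ∈ endpoints d := Finset.mem_insert_self _ _
  have hd2 : d.1.2 ∈ endpoints d := Finset.mem_insert_of_mem (Finset.mem_singleton_self _)
  have he1 : e.1.1 ∈ endpoints e := Finset.mem_insert_self _ _
  have he2 : e.1.2 ∈ endpoints e := Finset.mem_insert_of_mem (Finset.mem_singleton_self _)
  have : h.1.1.val = d.1.1.val ∧ h.1.2.val = d.1.2.val := by
    simp only [Crosses, Fin.lt_def] at hde hh
    rcases hde with ⟨k1, k2, k3⟩ | ⟨k1, k2, k3⟩
    · have s1 := hside _ _ (Or.inl ⟨hd1, he1⟩) k1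
      have s2 := hside _ _ (Or.inr ⟨he1, hd2⟩) k2
      have s3 := hside _ _ (Or.inl ⟨hd2, he2⟩) k3
      have s4 := hside _ _ (Or.inl ⟨hd1, he2⟩) (by omega)
      clear hside hq
      omega
    · have s1 := hside _ _ (Or.inr ⟨he1, hd1⟩) k1
      have s2 := hside _ _ (Or.inl ⟨hd1, he2⟩) k2
      have s3 := hside _ _ (Or.inr ⟨he2, hd2⟩) k3
      have s4 := hside _ _ (Or.inr ⟨he1, hd2⟩) (by omega)
      clear hside hq
      omega
  exact Subtype.ext (Prod.ext (Fin.ext this.1) (Fin.ext this.2))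

/-- Two crossing diagonals are exchanged by a flip that preserves a given noncrossing set. -/
theorem exists_flip {n : ℕ} {d e : Diagonal n} (hde : Crosses d e) (S : Set (Diagonal n))
    (hS : ∀ g ∈ S, ∀ h ∈ S, ¬Crosses g h) (hd : ∀ g ∈ S, ¬Crosses g d)
    (he : ∀ g ∈ S, ¬Crosses g e) :
    ∃ T₁ T₂ : Set (Diagonal n), IsTriangulation T₁ ∧ IsTriangulation T₂ ∧ T₁ \ T₂ = {d} ∧
      T₂ \ T₁ = {e} ∧ S ⊆ T₁ := by
  have hirr : ∀ g : Diagonal n, ¬Crosses g g := fun g => by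
    simp only [Crosses, Fin.lt_def]; omega
  -- The diagonal `d`, the quadrilateral sides and `S` are pairwise noncrossing. Extend them to a
  -- triangulation `T₁` and replace `d` by `e` there.
  set C : Set (Diagonal n) := insert d (quadSides d e ∪ S) with hC
  have hCnc : ∀ g ∈ C, ∀ h ∈ C, ¬Crosses g h := by
    have hq : ∀ h ∈ C, ∀ g ∈ quadSides d e, ¬Crosses h g := by
      rintro h (rfl | hh | hh) g hg
      · exact fun h' => hg.2.1 h'.symm
      · exact not_crosses_of_mem_quadSides hde hg hh.2.1 hh.2.2
      · exact not_crosses_of_mem_quadSides hde hg (hd h hh) (he h hh)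
    rintro g (rfl | hg | hg) h hh
    · rcases hh with rfl | hh | hh
      · exact hirr _
      · exact fun h' => hh.2.1 h'.symm
      · exact fun h' => hd h hh h'.symm
    · exact fun h' => hq h hh g hg h'.symm
    · rcases hh with rfl | hh | hh
      · exact hd g hg
      · exact hq g (Or.inr (Or.inr hg)) h hh
      · exact hS g hg h hh
  obtain ⟨T₁, hCT, hmax⟩ := (Set.toFinite {T : Set (Diagonal n) |
    ∀ g ∈ T, ∀ h ∈ T, ¬Crosses g h}).exists_le_maximal (show C ∈ _ from hCnc)
  have hnc : ∀ g ∈ T₁, ∀ h ∈ T₁, ¬Crosses g h := hmax.prop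
  have hT₁ : IsTriangulation T₁ := by
    refine ⟨hnc, fun g hg => ?_⟩
    by_contra! hno
    have : insert g T₁ ∈ {T : Set (Diagonal n) | ∀ g ∈ T, ∀ h ∈ T, ¬Crosses g h} := by
      rintro x (rfl | hx) y (rfl | hy)
      · exact hirr _
      · exact hno y hy
      · exact fun h' => hno x hx h'.symm
      · exact hnc x hx y hy
    exact hg (hmax.le_of_ge this (Set.subset_insert _ _) (Set.mem_insert _ _))
  have hdT : d ∈ T₁ := hCT (Set.mem_insert _ _)
  have heT : e ∉ T₁ := fun h => hnc d hdT e h hde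
  have hned : e ≠ d := by rintro rfl; exact heT hdT
  have hquad : ∀ g ∈ quadSides d e, g ∈ T₁ := fun g hg => hCT (Or.inr (Or.inl hg))
  have hde' : ∀ h ∈ T₁, Crosses h e → h = d := fun h hh hc =>
    eq_of_crosses_of_quadSides hde (fun g hg => hnc h hh g (hquad g hg)) hc
  refine ⟨T₁, insert e (T₁ \ {d}), hT₁, ⟨?_, ?_⟩, ?_, ?_,
    fun g hg => hCT (Or.inr (Or.inr hg))⟩
  · rintro x (rfl | hx) y (rfl | hy)
    · exact hirr _
    · exact fun h' => hy.2 (hde' y hy.1 h'.symm)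
    · exact fun h' => hx.2 (hde' x hx.1 h')
    · exact hnc x hx.1 y hy.1
  · intro g hg
    rw [Set.mem_insert_iff, not_or] at hg
    by_cases hgd : g = d
    · exact ⟨e, Set.mem_insert _ _, hgd ▸ hde⟩
    · have hgT : g ∉ T₁ := fun h => hg.2 ⟨h, hgd⟩
      by_contra! hno
      have hno' : ∀ t ∈ T₁, t ≠ d → ¬Crosses g t := fun t ht htd =>
        hno t (Or.inr ⟨ht, htd⟩)
      obtain ⟨t, ht, hgt⟩ := hT₁.2 g hgT
      have htd : t = d := by
        by_contra htd; exact hno' t ht htd hgt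
      subst htd
      refine hg.1 (eq_of_crosses_of_quadSides hde.symm (fun q hq => ?_) hgt)
      rw [quadSides_comm] at hq
      refine hno' q (hquad q hq) ?_
      rintro rfl
      exact hq.2.2 hde
  · ext x
    simp only [Set.mem_sdiff, Set.mem_insert_iff, Set.mem_singleton_iff, not_or, not_and, not_not]
    constructor
    · rintro ⟨h1, -, h3⟩
      exact h3 h1
    · rintro rfl
      exact ⟨hdT, hned.symm, fun _ => rfl⟩
  · ext x
    simp only [Set.mem_sdiff, Set.mem_insert_iff, Set.mem_singleton_iff]
    constructor
    · rintro ⟨h1 | h1, h2⟩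
      · exact h1
      · exact absurd h1.1 h2
    · rintro rfl
      exact ⟨Or.inl rfl, heT⟩

/-! ### Admissible weights and good weights -/

section Model

variable {n : ℕ} {ε : ℕ → Bool} {δ : Fin n → Diagonal n} {f : APRoot n ≃ Diagonal n}
  {ω : Diagonal n → ℝ}

theorem IsModel.sum_smul_diagVec (hf : IsModel ε δ f) (μ : Diagonal n → ℝ) :
    ∑ d, μ d • diagVec δ d = Fintype.linearCombination ℝ APRoot.vec (μ ∘ f) := by
  rw [← Equiv.sum_comp f, Fintype.linearCombination_apply]
  simp only [hf.diagVec_apply, Function.comp]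

theorem sum_mul_eq (f : APRoot n ≃ Diagonal n) (μ ω : Diagonal n → ℝ) :
    ∑ d, μ d * ω d = Fintype.linearCombination ℝ (ω ∘ f) (μ ∘ f) := by
  rw [← Equiv.sum_comp f, Fintype.linearCombination_apply]
  rfl

/-- A resolution `l` of the crossing pair gives the dependence `v r + v s - ∑ l`, whose support fits
into two triangulations exchanging the pair by a flip. Admissibility says that this dependence has
positive cost. -/
theorem IsAdmissibleWeight.isGoodWeight (hf : IsModel ε δ f) (hω : IsAdmissibleWeight δ ω) :
    IsGoodWeight APRoot.vec (RootCross ε) (ω ∘ f) := by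
  classical
  have key : ∀ (r s : APRoot n) (l : APRoot n → ℝ), RootCross ε r s → Resolves ε r s l →
      Fintype.linearCombination ℝ (ω ∘ f) l < (ω ∘ f) r + (ω ∘ f) s := by
    intro r s l hrs hl
    have hcross : Crosses (f r) (f s) := (hf.crosses_iff r s).2 hrs
    have hrs' : r ≠ s := by rintro rfl; exact RootCross.irrefl _ hrs
    have hlr : l r = 0 := by
      by_contra h; exact (hl.not_rootCross h).2.1 hrs
    have hls : l s = 0 := by
      by_contra h; exact (hl.not_rootCross h).1 hrs.symm
    obtain ⟨T₁, T₂, hT₁, hT₂, h12, h21, hST⟩ := exists_flip hcross (f '' {g | l g ≠ 0})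
      (by
        rintro _ ⟨g, hg, rfl⟩ _ ⟨h, hh, rfl⟩
        rw [hf.crosses_iff]
        exact (hl.not_rootCross hg).2.2 h hh)
      (by
        rintro _ ⟨g, hg, rfl⟩
        rw [hf.crosses_iff]
        exact (hl.not_rootCross hg).1)
      (by
        rintro _ ⟨g, hg, rfl⟩
        rw [hf.crosses_iff]
        exact (hl.not_rootCross hg).2.1)
    have hrT : f r ∈ T₁ := (h12.symm ▸ Set.mem_singleton (f r) : f r ∈ T₁ \ T₂).1
    have hsT : f s ∈ T₂ := (h21.symm ▸ Set.mem_singleton (f s) : f s ∈ T₂ \ T₁).1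
    set m : APRoot n → ℝ := Pi.single r 1 + Pi.single s 1 - l with hm
    have hmf : (m ∘ f.symm) ∘ f = m := by
      ext x; simp
    have hlin : ∀ {F : Type} [AddCommGroup F] [Module ℝ F] (u : APRoot n → F),
        Fintype.linearCombination ℝ u m = u r + u s - Fintype.linearCombination ℝ u l := by
      intro F _ _ u
      simp only [hm, map_add, map_sub, Fintype.linearCombination_apply_single, one_smul]
    have := hω.2 T₁ T₂ (f r) (f s) hT₁ hT₂ h12 h21 (m ∘ f.symm) (by
        intro d hd
        rw [Set.mem_union, not_or] at hd
        obtain ⟨x, rfl⟩ := f.surjective d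
        have hxr : x ≠ r := by rintro rfl; exact hd.1 hrT
        have hxs : x ≠ s := by rintro rfl; exact hd.2 hsT
        have hxl : l x = 0 := by
          by_contra h; exact hd.1 (hST ⟨x, h, rfl⟩)
        simp [hm, Pi.single_eq_of_ne hxr, Pi.single_eq_of_ne hxs, hxl])
      (by rw [hf.sum_smul_diagVec, hmf, hlin, hl.linearCombination, sub_self])
      (by simp [hm, Pi.single_eq_of_ne hrs', hlr])
      (by simp [hm, Pi.single_eq_of_ne hrs'.symm, hls])
    rw [sum_mul_eq f, hmf, hlin] at this
    linarith
  refine ⟨fun r => hω.1 _, fun r s hrs => ?_⟩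
  obtain ⟨l, hl | hl⟩ := hrs.exists_resolves
  · exact ⟨l, hl.nonneg, hl.linearCombination, key r s l hrs hl⟩
  · exact ⟨l, hl.nonneg, hl.linearCombination.trans (add_comm _ _),
      (key s r l hrs.symm hl).trans_eq (add_comm _ _)⟩

/-- Split the dependence into positive and negative parts, two weights with the same combination.
The negative part lives in `T₁` and is noncrossing. The positive part contains the crossing pair
`d₁`, `d₂`, so it is strictly more expensive. -/
theorem IsGoodWeight.isAdmissibleWeight (hf : IsModel ε δ f)
    (hω : IsGoodWeight APRoot.vec (RootCross ε) (ω ∘ f)) : IsAdmissibleWeight δ ω := by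
  refine ⟨fun d => ?_, ?_⟩
  · have := hω.pos (f.symm d)
    simpa using this
  intro T₁ T₂ d₁ d₂ hT₁ hT₂ h12 h21 μ hμ0 hμ hμ1 hμ2
  have hd₁ : d₁ ∈ T₁ \ T₂ := h12.symm ▸ Set.mem_singleton d₁
  have hd₂ : d₂ ∈ T₂ \ T₁ := h21.symm ▸ Set.mem_singleton d₂
  -- By maximality of `T₁` some member crosses `d₂`. It cannot lie in `T₂`, so it is `d₁`.
  have hcross : Crosses d₂ d₁ := by
    obtain ⟨d, hd, hc⟩ := hT₁.2 d₂ hd₂.2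
    have hd' : d ∉ T₂ := fun h => hT₂.1 d₂ hd₂.1 d h hc
    have : d ∈ T₁ \ T₂ := ⟨hd, hd'⟩
    rw [h12, Set.mem_singleton_iff] at this
    rwa [← this]
  have hneg : ∀ d, μ d < 0 → d ∈ T₁ := by
    intro d hd
    by_contra hdT
    have h2 : d ∈ T₂ := by
      by_contra h2
      exact hd.ne (hμ0 d (by simp [hdT, h2]))
    have : d ∈ T₂ \ T₁ := ⟨h2, hdT⟩
    rw [h21, Set.mem_singleton_iff] at this
    rw [this] at hd
    exact absurd hμ2 hd.not_gt
  set m := μ ∘ f with hm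
  have hsplit : m = m ⊔ 0 - (-m) ⊔ 0 := by
    ext x
    simp only [Pi.sub_apply, Pi.sup_apply, Pi.zero_apply, Pi.neg_apply]
    rcases le_total 0 (m x) with h | h
    · rw [sup_of_le_left h, sup_of_le_right (by linarith), sub_zero]
    · rw [sup_of_le_right h, sup_of_le_left (by linarith)]; ring
  have hnc : IsNoncrossing (RootCross ε) ((-m) ⊔ 0) := by
    refine ⟨le_sup_right, fun r s hr hs => ?_⟩
    simp only [Pi.sup_apply, Pi.neg_apply, Pi.zero_apply, lt_sup_iff, lt_irrefl, or_false,
      Left.neg_pos_iff] at hr hs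
    rw [← hf.crosses_iff]
    exact hT₁.1 _ (hneg _ hr) _ (hneg _ hs)
  have hc : ¬IsNoncrossing (RootCross ε) (m ⊔ 0) := by
    intro h
    obtain ⟨r, rfl⟩ := f.surjective d₁
    obtain ⟨s, rfl⟩ := f.surjective d₂
    exact h.2 s r (lt_sup_of_lt_left hμ2) (lt_sup_of_lt_left hμ1) ((hf.crosses_iff s r).1 hcross)
  have h0 : Fintype.linearCombination ℝ APRoot.vec ((-m) ⊔ 0) =
      Fintype.linearCombination ℝ APRoot.vec (m ⊔ 0) := by
    rw [hf.sum_smul_diagVec, ← hm, hsplit, map_sub, sub_eq_zero] at hμ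
    exact hμ.symm
  have := hω.cost_lt (isFanData_vec n ε) hnc le_sup_right h0 hc
  rw [sum_mul_eq f, ← hm, hsplit, map_sub]
  linarith

theorem IsModel.exists_isAdmissibleWeight (hf : IsModel ε δ f) :
    ∃ ω, IsAdmissibleWeight δ ω := by
  refine ⟨explicitWeight ε ∘ f.symm, IsGoodWeight.isAdmissibleWeight hf ?_⟩
  have : (explicitWeight ε ∘ f.symm) ∘ f = explicitWeight ε := by
    ext x; simp
  rw [this]
  exact isGoodWeight_explicitWeight n ε

theorem IsModel.assII_eq (hf : IsModel ε δ f) (ω : Diagonal n → ℝ) :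
    assII δ ω = {x | ∀ r : APRoot n, x r.vec ≤ (ω ∘ f) r} := by
  ext x
  simp only [assII, Set.mem_ofPred_eq]
  rw [← f.forall_congr_right]
  simp only [hf.diagVec_apply, Function.comp]

theorem IsModel.isPolytope_assII (hf : IsModel ε δ f) (hω : IsAdmissibleWeight δ ω) :
    IsPolytope (assII δ ω) := by
  rw [hf.assII_eq]
  exact isPolytope_of_isGoodWeight (isFanData_vec n ε) (hω.isGoodWeight hf)

theorem cClusterFan_eq {w : Equiv.Perm (Fin (n + 1))} (hw : IsCoxeterElement w) :
    cClusterFan w = {K | ∃ C : Set (APRoot n), (∀ r ∈ C, ∀ s ∈ C, ¬RootCross (permSign w) r s) ∧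
      K = cone (APRoot.vec '' C)} := by
  have hiff : ∀ r s : APRoot n, CCompatible w r.vec s.vec ↔
      APRoot.Compatible (permSign w) r s :=
    (isCompatibilityFamily_cCompatible n).iff_compatible hw
  ext K
  constructor
  · rintro ⟨C, hC, hpw, rfl⟩
    rw [almostPositiveRoots_eq_range] at hC
    refine ⟨APRoot.vec ⁻¹' C, fun r hr s hs => ?_, by rw [Set.image_preimage_eq_of_subset hC]⟩
    by_cases hrs : r = s
    · subst hrs; exact RootCross.irrefl _
    · exact ((hiff r s).1 (hpw hr hs (APRoot.vec_injective.ne hrs))).2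
  · rintro ⟨C, hC, rfl⟩
    refine ⟨_, ?_, ?_, rfl⟩
    · rw [almostPositiveRoots_eq_range]; exact Set.image_subset_range _ _
    · rintro _ ⟨r, hr, rfl⟩ _ ⟨s, hs, rfl⟩ hne
      exact (hiff r s).2 ⟨fun h => hne (h ▸ rfl), hC r hr s hs⟩

theorem IsModel.normalFan_assII (hf : IsModel ε δ f) (hω : IsAdmissibleWeight δ ω)
    {w : Equiv.Perm (Fin (n + 1))} (hw : IsCoxeterElement w)
    (hε : ∀ m, 0 < m → m < n → ε m = permSign w m) :
    normalFan (assII δ ω) = cClusterFan w := by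
  rw [hf.assII_eq, normalFan_eq (isFanData_vec n ε) (hω.isGoodWeight hf), cClusterFan_eq hw]
  simp only [RootCross.congr hε]

end Model

/-! ## The diagonals of a path triangulation -/

/-- The signs `c` as a function on all indices, extended by `-`. -/
def signOf {n : ℕ} (c : Fin (n - 1) → ℤˣ) (m : ℕ) : Bool :=
  if h : 0 < m ∧ m < n then decide (c ⟨m - 1, by omega⟩ = 1) else false

theorem isEndNeg_signOf {n : ℕ} (c : Fin (n - 1) → ℤˣ) : IsEndNeg n (signOf c) := by
  constructor <;> exact dif_neg (by omega)

theorem signOf_succ {n : ℕ} (c : Fin (n - 1) → ℤˣ) (i : Fin (n - 1)) :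
    signOf c (i.val + 1) = decide (c i = 1) := by
  have := i.2
  exact dif_pos (by omega)

theorem Joined.not_crossing {n : ℕ} {T : Set (Diagonal n)} (hT : IsTriangulation T)
    {x y z w : Fin (n + 3)} (h : Joined T x y) (h' : Joined T z w) :
    ¬(x.val < z.val ∧ z.val < y.val ∧ y.val < w.val) := by
  intro hc
  have hw := w.2
  rcases h with h | h | ⟨d, hd, h⟩
  · omega
  · omega
  rcases h' with h' | h' | ⟨d', hd', h'⟩
  · omega
  · omega
  refine hT.1 d hd d' hd' (Or.inl ?_)
  rw [h, h']
  exact hc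

theorem IsTriangle.joined {n : ℕ} {T : Set (Diagonal n)} {t : Finset (Fin (n + 3))}
    (ht : IsTriangle T t) {x y : Fin (n + 3)} (hx : x ∈ t) (hy : y ∈ t) (hxy : x ≠ y) :
    (x.val < y.val ∧ Joined T x y) ∨ (y.val < x.val ∧ Joined T y x) := by
  rcases lt_or_gt_of_ne hxy with h | h
  · exact Or.inl ⟨h, ht.2 x hx y hy h⟩
  · exact Or.inr ⟨h, ht.2 y hy x hx h⟩

/-- Edges of triangles of a triangulation do not cross. -/
theorem IsTriangle.not_crossing {n : ℕ} {T : Set (Diagonal n)} (hT : IsTriangulation T)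
    {t t' : Finset (Fin (n + 3))} (ht : IsTriangle T t) (ht' : IsTriangle T t')
    (A : Fin (n + 3)) {a b c d : ℕ} (hab : a < b) (hbc : b < c) (hcd : c < d) (hd : d < n + 3)
    (h1 : vertex A a ∈ t) (h2 : vertex A c ∈ t) (h3 : vertex A b ∈ t')
    (h4 : vertex A d ∈ t') : False := by
  have e1 := vertex_val A (p := a) (by omega)
  have e2 := vertex_val A (p := b) (by omega)
  have e3 := vertex_val A (p := c) (by omega)
  have e4 := vertex_val A (p := d) hd
  have hA := A.2
  have k1 := ht.joined h1 h2 (by rw [Ne, vertex_inj A (by omega) (by omega)]; omega)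
  have k2 := ht'.joined h3 h4 (by rw [Ne, vertex_inj A (by omega) (by omega)]; omega)
  rcases k1 with ⟨k1, j1⟩ | ⟨k1, j1⟩ <;> rcases k2 with ⟨k2, j2⟩ | ⟨k2, j2⟩ <;>
  · have n1 := j1.not_crossing hT j2
    have n2 := j2.not_crossing hT j1
    clear j1 j2
    omega

/-- Two distinct triangles with a common edge lie on different sides of it. -/
theorem IsTriangle.opposite {n : ℕ} {T : Set (Diagonal n)} (hT : IsTriangulation T)
    {t t' : Finset (Fin (n + 3))} (ht : IsTriangle T t) (ht' : IsTriangle T t') (hne : t ≠ t')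
    (A : Fin (n + 3)) {p q u w : ℕ} (hpq : p < q) (hq : q < n + 3) (hu : u < n + 3)
    (hw : w < n + 3) (hpt : vertex A p ∈ t) (hqt : vertex A q ∈ t) (hut : vertex A u ∈ t)
    (hpt' : vertex A p ∈ t') (hqt' : vertex A q ∈ t') (hwt' : vertex A w ∈ t')
    (hout : u < p ∨ q < u) (hwp : w ≠ p) (hwq : w ≠ q) : p < w ∧ w < q := by
  by_contra hcon
  have hwout : w < p ∨ q < w := by omega
  have hcross : ∀ {a b c d : ℕ}, a < b → b < c → c < d → d < n + 3 →
      ∀ {s s'}, IsTriangle T s → IsTriangle T s' → vertex A a ∈ s → vertex A c ∈ s →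
      vertex A b ∈ s' → vertex A d ∈ s' → False :=
    fun hab hbc hcd hd _ _ hs hs' => hs.not_crossing hT hs' A hab hbc hcd hd
  -- If the third vertices differed on the same side of the common edge, an edge of one triangle
  -- would cross an edge of the other.
  have huw : u = w := by
    rcases lt_trichotomy u w with h | h | h
    · exfalso
      rcases hout with h1 | h1 <;> rcases hwout with h2 | h2
      · exact hcross h h2 hpq hq ht ht' hut hpt hwt' hqt'
      · exact hcross h1 hpq h2 hw ht ht' hut hqt hpt' hwt'
      · omega
      · exact hcross hpq h1 h hw ht ht' hpt hut hqt' hwt'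
    · exact h
    · exfalso
      rcases hout with h1 | h1 <;> rcases hwout with h2 | h2
      · exact hcross h h1 hpq hq ht' ht hwt' hpt' hut hqt
      · omega
      · exact hcross h2 hpq h1 hu ht' ht hwt' hqt' hpt hut
      · exact hcross hpq h2 h hu ht' ht hpt' hwt' hqt hut
  subst huw
  have hcard : ({vertex A p, vertex A q, vertex A u} : Finset (Fin (n + 3))).card = 3 := by
    rw [Finset.card_eq_three]
    refine ⟨_, _, _, ?_, ?_, ?_, rfl⟩ <;> rw [Ne, vertex_inj A (by omega) (by omega)] <;> omega
  have e1 : ({vertex A p, vertex A q, vertex A u} : Finset (Fin (n + 3))) = t := by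
    refine Finset.eq_of_subset_of_card_le ?_ (by rw [hcard, ht.1])
    simp only [Finset.insert_subset_iff, Finset.singleton_subset_iff]
    exact ⟨hpt, hqt, hut⟩
  have e2 : ({vertex A p, vertex A q, vertex A u} : Finset (Fin (n + 3))) = t' := by
    refine Finset.eq_of_subset_of_card_le ?_ (by rw [hcard, ht'.1])
    simp only [Finset.insert_subset_iff, Finset.singleton_subset_iff]
    exact ⟨hpt', hqt', hwt'⟩
  exact hne (e1.symm.trans e2)

theorem exists_endpoints_eq {n : ℕ} (A : Fin (n + 3)) (d : Diagonal n) :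
    ∃ p q, p + 1 < q ∧ q < n + 3 ∧ endpoints d = {vertex A p, vertex A q} := by
  obtain ⟨p, hp, h1⟩ := exists_vertex_eq A d.1.1
  obtain ⟨q, hq, h2⟩ := exists_vertex_eq A d.1.2
  have e1 := vertex_val A hp
  have e2 := vertex_val A hq
  have hd := d.2
  have hA := A.2
  rw [h1] at e1
  rw [h2] at e2
  rcases lt_or_ge p q with h | h
  · exact ⟨p, q, by omega, hq, by rw [h1, h2]; rfl⟩
  · exact ⟨q, p, by omega, hp, by rw [h1, h2]; exact Finset.pair_comm _ _⟩

theorem endpoints_subset_iff {n : ℕ} {d : Diagonal n} {x y : Fin (n + 3)}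
    {t : Finset (Fin (n + 3))} (h : endpoints d = {x, y}) :
    endpoints d ⊆ t ↔ x ∈ t ∧ y ∈ t := by
  rw [h, Finset.insert_subset_iff, Finset.singleton_subset_iff]

/-- One step along a path triangulation. -/
theorem exists_vertex_of_turn {n : ℕ} {T : Set (Diagonal n)} (hT : IsTriangulation T)
    {t t' : Finset (Fin (n + 3))} (ht : IsTriangle T t) (ht' : IsTriangle T t') (hne : t ≠ t')
    (A : Fin (n + 3)) {d d' : Diagonal n} {p q u : ℕ} (hpq : p < q) (hq : q < n + 3)
    (hd : endpoints d = {vertex A p, vertex A q}) (hdt : endpoints d ⊆ t)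
    (hdt' : endpoints d ⊆ t') (hd't' : endpoints d' ⊆ t') (hu : u < n + 3)
    (hut : vertex A u ∈ t) (hout : u < p ∨ q < u) {x y z : Fin (n + 3)}
    (hxy : endpoints d = {x, y}) (hxz : endpoints d' = {x, z})
    (hzx : z ≠ x) (hzy : z ≠ y) :
    ∃ r, p < r ∧ r < q ∧ z = vertex A r ∧
      ((x = vertex A p ∧ y = vertex A q) ∨ (x = vertex A q ∧ y = vertex A p)) := by
  obtain ⟨r, hr, rfl⟩ := exists_vertex_eq A z
  have hc := pair_cases (hxy.symm.trans hd)
  have hrp : r ≠ p := by rintro rfl; tauto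
  have hrq : r ≠ q := by rintro rfl; tauto
  rw [endpoints_subset_iff hd] at hdt hdt'
  rw [endpoints_subset_iff hxz] at hd't'
  obtain ⟨h1, h2⟩ := ht.opposite hT ht' hne A hpq hq hu hr hdt.1 hdt.2 hut hdt'.1 hdt'.2 hd't'.2
    hout hrp hrq
  exact ⟨r, h1, h2, rfl, hc⟩

/-- The invariant is a vertex of the previous triangle outside the interval `[p, q]`, so the new
vertex lies strictly between `p` and `q`. The orientation of the turn then tells which end of `d` is
kept. -/
theorem turnsRight_step {n : ℕ} {T : Set (Diagonal n)} (hT : IsTriangulation T)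
    {t t' : Finset (Fin (n + 3))} (ht : IsTriangle T t) (ht' : IsTriangle T t') (hne : t ≠ t')
    (A : Fin (n + 3)) {d d' : Diagonal n} {p q p' q' u : ℕ} (hpq : p < q) (hq : q < n + 3)
    (hpq' : p' < q') (hq' : q' < n + 3) (hd : endpoints d = {vertex A p, vertex A q})
    (hd' : endpoints d' = {vertex A p', vertex A q'}) (hdt : endpoints d ⊆ t)
    (hdt' : endpoints d ⊆ t') (hd't' : endpoints d' ⊆ t') (hu : u < n + 3)
    (hut : vertex A u ∈ t) (hout : u < p ∨ q < u) (hturn : TurnsRight d d') :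
    p' = p ∧ q' < q := by
  obtain ⟨x, y, z, hxy, hxz, hccw⟩ := hturn
  obtain ⟨r, h1, h2, rfl, hc⟩ := exists_vertex_of_turn hT ht ht' hne A hpq hq hd hdt hdt' hd't' hu
    hut hout hxy hxz
    (by rintro rfl; simp only [Counterclockwise, Fin.lt_def] at hccw; omega)
    (by rintro rfl; simp only [Counterclockwise, Fin.lt_def] at hccw; omega)
  rcases hc with ⟨rfl, rfl⟩ | ⟨rfl, rfl⟩ <;>
    rw [counterclockwise_vertex A (by omega) (by omega) (by omega)] at hccw
  · have := pair_cases (hd'.symm.trans hxz)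
    rw [vertex_inj A (by omega) (by omega), vertex_inj A (by omega) (by omega),
      vertex_inj A (by omega) (by omega), vertex_inj A (by omega) (by omega)] at this
    omega
  · omega

theorem turnsLeft_step {n : ℕ} {T : Set (Diagonal n)} (hT : IsTriangulation T)
    {t t' : Finset (Fin (n + 3))} (ht : IsTriangle T t) (ht' : IsTriangle T t') (hne : t ≠ t')
    (A : Fin (n + 3)) {d d' : Diagonal n} {p q p' q' u : ℕ} (hpq : p < q) (hq : q < n + 3)
    (hpq' : p' < q') (hq' : q' < n + 3) (hd : endpoints d = {vertex A p, vertex A q})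
    (hd' : endpoints d' = {vertex A p', vertex A q'}) (hdt : endpoints d ⊆ t)
    (hdt' : endpoints d ⊆ t') (hd't' : endpoints d' ⊆ t') (hu : u < n + 3)
    (hut : vertex A u ∈ t) (hout : u < p ∨ q < u) (hturn : TurnsLeft d d') :
    p < p' ∧ q' = q := by
  obtain ⟨x, y, z, hxy, hxz, hccw⟩ := hturn
  obtain ⟨r, h1, h2, rfl, hc⟩ := exists_vertex_of_turn hT ht ht' hne A hpq hq hd hdt hdt' hd't' hu
    hut hout hxy hxz
    (by rintro rfl; simp only [Counterclockwise, Fin.lt_def] at hccw; omega)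
    (by rintro rfl; simp only [Counterclockwise, Fin.lt_def] at hccw; omega)
  rcases hc with ⟨rfl, rfl⟩ | ⟨rfl, rfl⟩ <;>
    rw [counterclockwise_vertex A (by omega) (by omega) (by omega)] at hccw
  · omega
  · have := pair_cases (hd'.symm.trans hxz)
    rw [vertex_inj A (by omega) (by omega), vertex_inj A (by omega) (by omega),
      vertex_inj A (by omega) (by omega), vertex_inj A (by omega) (by omega)] at this
    omega

/-- Signs and bounds at both ends determine the endpoints along a path. -/
theorem eq_counts_of_steps {n : ℕ} {ε : ℕ → Bool} {p q : ℕ → ℕ}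
    (h0 : 1 ≤ p 0 ∧ q 0 ≤ n + 2) (hlast : p (n - 1) + 2 ≤ q (n - 1))
    (hstep : ∀ i, i + 1 < n →
      (ε (i + 1) = true → p (i + 1) = p i ∧ q (i + 1) < q i) ∧
      (ε (i + 1) = false → p i < p (i + 1) ∧ q (i + 1) = q i)) (k : ℕ) (hk : k < n) :
    p k = 1 + minusCount ε k ∧ q k = n + 2 - plusCount ε k := by
  -- Stepping forward bounds `p` from below and `q` from above. Stepping backward from the last
  -- diagonal bounds `q - p` from below by `2` plus the number of steps. At each `k` the bounds
  -- leave no slack.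
  have up : ∀ i, i < n → 1 + minusCount ε i ≤ p i ∧ q i + plusCount ε i ≤ n + 2 := by
    intro i
    induction i with
    | zero => intro _; exact h0
    | succ i ih =>
      intro hi
      have h1 := ih (by omega)
      have h2 := hstep i hi
      simp only [minusCount, plusCount]
      cases he : ε (i + 1) <;>
        simp only [he, if_true, forall_const, Bool.false_eq_true, if_false, reduceCtorEq,
          false_imp_iff, true_and, and_true] at h2 ⊢ <;> omega
  have down : ∀ j, j < n → p (n - 1 - j) + 2 + j ≤ q (n - 1 - j) := by
    intro j
    induction j with
    | zero => intro _; exact hlast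
    | succ j ih =>
      intro hj
      have h1 := ih (by omega)
      have h2 := hstep (n - 1 - (j + 1)) (by omega)
      have h3 : n - 1 - (j + 1) + 1 = n - 1 - j := by omega
      rw [h3] at h2
      cases he : ε (n - 1 - j) <;>
        simp only [he, forall_const, Bool.false_eq_true, reduceCtorEq,
          false_imp_iff, true_and, and_true] at h2 <;> omega
  have h1 := up k hk
  have h2 := down (n - 1 - k) (by omega)
  rw [show n - 1 - (n - 1 - k) = k by omega] at h2
  have h3 := minusCount_add_plusCount ε k
  omega

/-- Positions are counted from the vertex `A` of the first triangle that is off the first diagonal.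
Every turn shrinks the interval of positions on the side given by its sign, and `eq_counts_of_steps`
does the rest. -/
theorem IsPathTriangulation.exists_endpoints {n : ℕ} (hn : 1 ≤ n) {c : Fin (n - 1) → ℤˣ}
    {T : Set (Diagonal n)} {δ : Fin n → Diagonal n} (h : IsPathTriangulation c T δ) :
    ∃ A : Fin (n + 3), ∀ k, endpoints (δ k) =
      {vertex A (1 + minusCount (signOf c) k), vertex A (n + 2 - plusCount (signOf c) k)} := by
  obtain ⟨hT, ⟨φ, hφ⟩, hturn⟩ := h
  have hinj : ∀ i : Fin n, (φ i.castSucc).1 ≠ (φ i.succ).1 := fun i he => by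
    have := φ.injective (Subtype.ext he)
    exact absurd this (Fin.castSucc_lt_succ).ne
  let i0 : Fin n := ⟨0, hn⟩
  obtain ⟨A, hA, hA'⟩ : ∃ A ∈ (φ i0.castSucc).1, A ∉ endpoints (δ i0) := by
    by_contra! hno
    have h1 := Finset.card_le_card (show (φ i0.castSucc).1 ⊆ endpoints (δ i0) from hno)
    have h2 : (endpoints (δ i0)).card ≤ 2 := Finset.card_le_two
    have h3 := (φ i0.castSucc).2.1
    omega
  have hA0 : vertex A 0 = A := Fin.ext (Nat.mod_eq_of_lt A.2)
  refine ⟨A, ?_⟩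
  choose p q hpq hq hδ using fun k => exists_endpoints_eq A (δ k)
  have hstep : ∀ i (hi : i + 1 < n), ∀ u < n + 3,
      vertex A u ∈ (φ (Fin.castSucc ⟨i, by omega⟩)).1 →
      (u < p ⟨i, by omega⟩ ∨ q ⟨i, by omega⟩ < u) →
      (signOf c (i + 1) = true → p ⟨i + 1, hi⟩ = p ⟨i, by omega⟩ ∧
        q ⟨i + 1, hi⟩ < q ⟨i, by omega⟩) ∧
      (signOf c (i + 1) = false → p ⟨i, by omega⟩ < p ⟨i + 1, hi⟩ ∧
        q ⟨i + 1, hi⟩ = q ⟨i, by omega⟩) := by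
    intro i hi u hu hut hout
    have hi' : i < n := by omega
    have hlt := hpq ⟨i, hi'⟩
    have hlt' := hpq ⟨i + 1, hi⟩
    have htw := hturn ⟨i, by omega⟩
    rw [signOf_succ c ⟨i, by omega⟩]
    constructor
    · intro he
      exact turnsRight_step hT (φ (Fin.castSucc ⟨i, hi'⟩)).2 (φ (Fin.succ ⟨i, hi'⟩)).2
        (hinj ⟨i, hi'⟩) A (by omega) (hq _) (by omega) (hq _) (hδ _) (hδ _) (hφ _).2.1
        (hφ _).2.2 (hφ ⟨i + 1, hi⟩).2.1 hu hut hout (htw.1 (of_decide_eq_true he))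
    · intro he
      exact turnsLeft_step hT (φ (Fin.castSucc ⟨i, hi'⟩)).2 (φ (Fin.succ ⟨i, hi'⟩)).2
        (hinj ⟨i, hi'⟩) A (by omega) (hq _) (by omega) (hq _) (hδ _) (hδ _) (hφ _).2.1
        (hφ _).2.2 (hφ ⟨i + 1, hi⟩).2.1 hu hut hout
        (htw.2 ((Int.units_eq_one_or _).resolve_left (of_decide_eq_false he)))
  have hp0 : 1 ≤ p i0 := by
    by_contra hp
    apply hA'
    rw [hδ i0, show p i0 = 0 by omega, hA0]
    exact Finset.mem_insert_self _ _
  -- Each triangle has a vertex outside the interval of the next diagonal: at first `A` itself,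
  -- later the end that the preceding step has left behind.
  have hinv : ∀ i (hi : i < n), ∃ u < n + 3, vertex A u ∈ (φ (Fin.castSucc ⟨i, hi⟩)).1 ∧
      (u < p ⟨i, hi⟩ ∨ q ⟨i, hi⟩ < u) := by
    intro i
    induction i with
    | zero => exact fun _ => ⟨0, by omega, hA0.symm ▸ hA, Or.inl hp0⟩
    | succ i ih =>
      intro hi
      have hi' : i < n := by omega
      obtain ⟨u, hu, hut, hout⟩ := ih hi'
      have hs := hstep i hi u hu hut hout
      have hlt := hpq ⟨i, hi'⟩
      have hmem := (endpoints_subset_iff (hδ ⟨i, hi'⟩)).1 (hφ ⟨i, hi'⟩).2.2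
      cases he : signOf c (i + 1)
      · exact ⟨p ⟨i, hi'⟩, by have := hq ⟨i, hi'⟩; omega, hmem.1, Or.inl (hs.2 he).1⟩
      · exact ⟨q ⟨i, hi'⟩, hq _, hmem.2, Or.inr (hs.1 he).2⟩
  -- The sequences are extended by `0` beyond the last diagonal. These values are never used.
  have key := eq_counts_of_steps (n := n) (ε := signOf c)
    (p := fun i => if h : i < n then p ⟨i, h⟩ else 0)
    (q := fun i => if h : i < n then q ⟨i, h⟩ else 0)
  have hpf : ∀ i (hi : i < n), (if h : i < n then p ⟨i, h⟩ else 0) = p ⟨i, hi⟩ :=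
    fun i hi => dif_pos hi
  have hqf : ∀ i (hi : i < n), (if h : i < n then q ⟨i, h⟩ else 0) = q ⟨i, hi⟩ :=
    fun i hi => dif_pos hi
  intro k
  have hk := key
    (by
      rw [hpf 0 hn, hqf 0 hn]
      exact ⟨hp0, Nat.lt_succ_iff.1 (hq _)⟩)
    (by
      rw [hpf (n - 1) (by omega), hqf (n - 1) (by omega)]
      exact hpq _)
    (fun i hi => by
      obtain ⟨u, hu, hut, hout⟩ := hinv i (by omega)
      simp only [hpf i (by omega), hqf i (by omega), hpf (i + 1) hi, hqf (i + 1) hi]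
      exact hstep i hi u hu hut hout) k k.2
  simp only [hpf k k.2, hqf k k.2] at hk
  rw [hδ k, hk.1, hk.2]

/-! ## Existence of path triangulations -/

/-- The vertices, in increasing order, of the `i`-th triangle of the path triangulation. -/
def triPos (n : ℕ) (ε : ℕ → Bool) (i : ℕ) : ℕ × ℕ × ℕ :=
  if ε i then (1 + minusCount ε i, n + 2 - plusCount ε i, n + 3 - plusCount ε i)
  else (minusCount ε i, minusCount ε i + 1, n + 2 - plusCount ε i)

/-- The `i`-th triangle of the path triangulation. -/
def pathTriangle (n : ℕ) (ε : ℕ → Bool) (i : ℕ) : Finset (Fin (n + 3)) :=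
  Finset.univ.filter fun v =>
    v.val = (triPos n ε i).1 ∨ v.val = (triPos n ε i).2.1 ∨ v.val = (triPos n ε i).2.2

theorem mem_pathTriangle {n : ℕ} {ε : ℕ → Bool} {i : ℕ} {v : Fin (n + 3)} :
    v ∈ pathTriangle n ε i ↔
      v.val = (triPos n ε i).1 ∨ v.val = (triPos n ε i).2.1 ∨ v.val = (triPos n ε i).2.2 := by
  simp [pathTriangle]

theorem triPos_lt {n : ℕ} {ε : ℕ → Bool} (hε : IsEndNeg n ε) {i : ℕ} (hi : i ≤ n) :
    (triPos n ε i).1 < (triPos n ε i).2.1 ∧ (triPos n ε i).2.1 < (triPos n ε i).2.2 ∧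
      (triPos n ε i).2.2 < n + 3 := by
  have h1 := minusCount_add_plusCount ε i
  have h2 : ε i = true → 1 ≤ plusCount ε i := by
    intro h
    have h0 : 0 < i := by
      rw [Nat.pos_iff_ne_zero]; rintro rfl; rw [hε.1] at h; exact absurd h (by decide)
    have := (count_lt ε h0).2
    rw [if_pos h] at this
    omega
  unfold triPos
  cases he : ε i
  · simp only [Bool.false_eq_true, if_false]
    omega
  · have := h2 he
    simp only [if_true]
    omega

theorem card_eq_three_of_lt {n a b c : ℕ} (hab : a < b) (hbc : b < c) (hc : c < n) :
    (Finset.univ.filter fun v : Fin n => v.val = a ∨ v.val = b ∨ v.val = c).card = 3 := by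
  rw [Finset.card_eq_three]
  refine ⟨⟨a, by omega⟩, ⟨b, by omega⟩, ⟨c, hc⟩, ?_, ?_, ?_, ?_⟩
  · simp only [ne_eq, Fin.mk.injEq]; omega
  · simp only [ne_eq, Fin.mk.injEq]; omega
  · simp only [ne_eq, Fin.mk.injEq]; omega
  · ext v
    simp [Fin.ext_iff]

theorem exists_eq_filter_of_card_eq_three {n : ℕ} {t : Finset (Fin n)} (ht : t.card = 3) :
    ∃ x y z : Fin n, x < y ∧ y < z ∧ ∀ v, v ∈ t ↔ v = x ∨ v = y ∨ v = z := by
  obtain ⟨a, b, c, hab, hac, hbc, rfl⟩ := Finset.card_eq_three.1 ht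
  simp only [Finset.mem_insert, Finset.mem_singleton]
  have key : ∀ x y z : Fin n, x < y → y < z →
      (∀ v, (v = a ∨ v = b ∨ v = c) ↔ (v = x ∨ v = y ∨ v = z)) → ∃ x y z : Fin n, x < y ∧ y < z ∧
        ∀ v, (v = a ∨ v = b ∨ v = c) ↔ (v = x ∨ v = y ∨ v = z) :=
    fun x y z h1 h2 h3 => ⟨x, y, z, h1, h2, h3⟩
  rcases lt_or_gt_of_ne hab with h1 | h1 <;> rcases lt_or_gt_of_ne hac with h2 | h2 <;>
    rcases lt_or_gt_of_ne hbc with h3 | h3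
  · exact key a b c h1 h3 (by tauto)
  · exact key a c b h2 h3 (by tauto)
  · exact absurd (h1.trans h3) h2.not_gt
  · exact key c a b h2 h1 (by tauto)
  · exact key b a c h1 h2 (by tauto)
  · exact absurd (h3.trans h1) h2.not_gt
  · exact key b c a h3 h2 (by tauto)
  · exact key c b a h3 h1 (by tauto)

section

variable {n : ℕ} {ε : ℕ → Bool} {δ : Fin n → Diagonal n}

theorem joined_range_iff (hδ : ∀ k, (δ k).1.1.val = 1 + minusCount ε k ∧
      (δ k).1.2.val = n + 2 - plusCount ε k) (x y : Fin (n + 3)) :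
    Joined (Set.range δ) x y ↔ x.val + 1 = y.val ∨ (x.val = 0 ∧ y.val = n + 2) ∨
      ∃ k < n, x.val = 1 + minusCount ε k ∧ y.val = n + 2 - plusCount ε k := by
  unfold Joined
  refine or_congr_right (or_congr_right ⟨?_, ?_⟩)
  · rintro ⟨_, ⟨k, rfl⟩, h⟩
    have := hδ k
    rw [h] at this
    exact ⟨k, k.2, this⟩
  · rintro ⟨k, hk, h1, h2⟩
    exact ⟨_, ⟨⟨k, hk⟩, rfl⟩, Prod.ext (Fin.ext ((hδ ⟨k, hk⟩).1.trans h1.symm))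
      (Fin.ext ((hδ ⟨k, hk⟩).2.trans h2.symm))⟩

theorem endpoints_subset_pathTriangle_iff (hδ : ∀ k, (δ k).1.1.val = 1 + minusCount ε k ∧
      (δ k).1.2.val = n + 2 - plusCount ε k) (k : Fin n) {i : ℕ} (hi : i ≤ n) :
    endpoints (δ k) ⊆ pathTriangle n ε i ↔ i = k.val ∨ i = k.val + 1 := by
  rw [endpoints_subset_iff rfl, mem_pathTriangle, mem_pathTriangle, (hδ k).1, (hδ k).2]
  have hk := k.2
  have h1 := minusCount_add_plusCount ε k
  have h2 := minusCount_add_plusCount ε i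
  constructor
  · intro h
    unfold triPos at h
    cases he : ε i <;> simp only [he, Bool.false_eq_true, if_false, if_true] at h <;> omega
  · rintro (rfl | rfl)
    · unfold triPos
      split_ifs <;> simp [add_comm 1]
    · unfold triPos
      simp only [minusCount, plusCount] at h2 ⊢
      cases he : ε (k.val + 1) <;>
        simp only [he, Bool.false_eq_true, if_false, if_true] at h2 ⊢ <;> omega

theorem isTriangle_pathTriangle (hn : 1 ≤ n) (hε : IsEndNeg n ε)
    (hδ : ∀ k, (δ k).1.1.val = 1 + minusCount ε k ∧ (δ k).1.2.val = n + 2 - plusCount ε k)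
    {i : ℕ} (hi : i ≤ n) : IsTriangle (Set.range δ) (pathTriangle n ε i) := by
  obtain ⟨h1, h2, h3⟩ := triPos_lt hε hi
  refine ⟨card_eq_three_of_lt h1 h2 h3, fun x hx y hy hxy => ?_⟩
  rw [mem_pathTriangle] at hx hy
  rw [joined_range_iff hδ]
  have hxy : x.val < y.val := hxy
  have hcount := minusCount_add_plusCount ε i
  -- Besides a polygon edge, triangle `i` has the sides `δ i` (`hcur`) and `δ (i - 1)` (`hprev`). At
  -- the two ends of the path one of these is replaced by a further polygon edge.
  have hcur : i < n → ∀ a b : ℕ, a = 1 + minusCount ε i → b = n + 2 - plusCount ε i →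
      ∃ k < n, a = 1 + minusCount ε k ∧ b = n + 2 - plusCount ε k :=
    fun h a b ha hb => ⟨i, h, ha, hb⟩
  have hprev : 0 < i → ∀ a b : ℕ, a = minusCount ε i + (if ε i then 1 else 0) →
      b = n + 2 - plusCount ε i + (if ε i then 1 else 0) →
      ∃ k < n, a = 1 + minusCount ε k ∧ b = n + 2 - plusCount ε k := by
    intro h a b ha hb
    obtain ⟨j, rfl⟩ : ∃ j, i = j + 1 := ⟨i - 1, by omega⟩
    refine ⟨j, hi, ?_⟩
    have := minusCount_add_plusCount ε j
    simp only [minusCount, plusCount] at ha hb hcount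
    cases he : ε (j + 1) <;>
      simp only [he, Bool.false_eq_true, if_false, if_true] at ha hb hcount <;> omega
  have hend : ε i = true → 0 < i ∧ i < n := by
    intro h
    constructor
    · rw [Nat.pos_iff_ne_zero]; rintro rfl; rw [hε.1] at h; exact absurd h (by decide)
    · refine lt_of_le_of_ne hi ?_; rintro rfl; rw [hε.2] at h; exact absurd h (by decide)
  have hzero : i = 0 → minusCount ε i = 0 ∧ plusCount ε i = 0 := by
    rintro rfl; exact ⟨rfl, rfl⟩
  unfold triPos at h1 h2 h3 hx hy
  cases he : ε i <;>
    simp only [he, Bool.false_eq_true, if_false, if_true, forall_const, false_imp_iff]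
      at h1 h2 h3 hx hy hprev hend
  · by_cases e1 : x.val + 1 = y.val
    · exact Or.inl e1
    refine Or.inr ?_
    by_cases e2 : x.val = minusCount ε i
    · have e3 : y.val = n + 2 - plusCount ε i := by omega
      rcases Nat.eq_zero_or_pos i with h0 | h0
      · have := hzero h0
        exact Or.inl (by omega)
      · exact Or.inr (hprev h0 _ _ (by omega) (by omega))
    · have e4 : i < n := by omega
      exact Or.inr (hcur e4 _ _ (by omega) (by omega))
  · by_cases e1 : x.val + 1 = y.val
    · exact Or.inl e1
    refine Or.inr (Or.inr ?_)
    by_cases e2 : y.val = n + 2 - plusCount ε i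
    · exact hcur hend.2 _ _ (by omega) (by omega)
    · exact hprev hend.1 _ _ (by omega) (by omega)

/-- The longest side `xz` is the edge from `0` to `n + 2`, which gives triangle `0`, or some `δ j`.
In the latter case `xy` and `yz` cannot both be diagonals, since a low end of a path diagonal is
never a high end of another. So one is a polygon edge, the other is `δ (j + 1)` or also a polygon
edge, and the triangle is number `j + 1`. -/
theorem eq_triPos_of_joined (hε : IsEndNeg n ε)
    (hδ : ∀ k, (δ k).1.1.val = 1 + minusCount ε k ∧ (δ k).1.2.val = n + 2 - plusCount ε k)
    {x y z : Fin (n + 3)} (hxy : x < y) (hyz : y < z) (h1 : Joined (Set.range δ) x y)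
    (h2 : Joined (Set.range δ) y z) (h3 : Joined (Set.range δ) x z) :
    ∃ i ≤ n, triPos n ε i = (x.val, y.val, z.val) := by
  rw [joined_range_iff hδ] at h1 h2 h3
  have hxy : x.val < y.val := hxy
  have hyz : y.val < z.val := hyz
  have hz := z.2
  have hsucc : ∀ j, (ε (j + 1) = false ∧ minusCount ε (j + 1) = minusCount ε j + 1 ∧
      plusCount ε (j + 1) = plusCount ε j) ∨ (ε (j + 1) = true ∧
      minusCount ε (j + 1) = minusCount ε j ∧ plusCount ε (j + 1) = plusCount ε j + 1) := by
    intro j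
    cases he : ε (j + 1) <;> simp [minusCount, plusCount, he]
  have hneg : ∀ i, ε i = false → x.val = minusCount ε i → y.val = minusCount ε i + 1 →
      z.val = n + 2 - plusCount ε i → triPos n ε i = (x.val, y.val, z.val) := by
    intro i he e1 e2 e3
    rw [triPos, he, if_neg (by decide), e1, e2, e3]
  have hpos : ∀ i, ε i = true → x.val = 1 + minusCount ε i → y.val = n + 2 - plusCount ε i →
      z.val = n + 3 - plusCount ε i → triPos n ε i = (x.val, y.val, z.val) := by
    intro i he e1 e2 e3
    rw [triPos, if_pos he, e1, e2, e3]
  rcases h3 with h3 | h3 | ⟨j, hj, h3⟩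
  · omega
  · refine ⟨0, Nat.zero_le _, hneg 0 hε.1 h3.1 ?_ h3.2⟩
    have : minusCount ε 0 = 0 := rfl
    rcases h1 with h1 | h1 | ⟨k, hk, h1⟩ <;> omega
  · have c1 := minusCount_add_plusCount ε j
    rcases h1 with h1 | h1 | ⟨k, hk, h1⟩
    · rcases h2 with h2 | h2 | ⟨l, hl, h2⟩
      · have hj' : j + 1 = n := by omega
        have := hsucc j
        rw [hj', hε.2] at this
        simp only [reduceCtorEq, false_and, or_false, true_and] at this
        exact ⟨n, le_rfl, hneg n hε.2 (by omega) (by omega) (by omega)⟩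
      · omega
      · have c2 := minusCount_add_plusCount ε l
        obtain rfl : l = j + 1 := by omega
        rcases hsucc j with h | h
        · exact ⟨j + 1, hj, hneg _ h.1 (by omega) (by omega) (by omega)⟩
        · omega
    · omega
    · have c2 := minusCount_add_plusCount ε k
      rcases h2 with h2 | h2 | ⟨l, hl, h2⟩
      · obtain rfl : k = j + 1 := by omega
        rcases hsucc j with h | h
        · omega
        · exact ⟨j + 1, hj, hpos _ h.1 (by omega) (by omega) (by omega)⟩
      · omega
      · have c3 := minusCount_add_plusCount ε l
        rcases le_total k l with h | h
        · have := count_le ε h; omega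
        · have := count_le ε h; omega

theorem exists_eq_pathTriangle (hε : IsEndNeg n ε)
    (hδ : ∀ k, (δ k).1.1.val = 1 + minusCount ε k ∧ (δ k).1.2.val = n + 2 - plusCount ε k)
    {t : Finset (Fin (n + 3))} (ht : IsTriangle (Set.range δ) t) :
    ∃ i ≤ n, pathTriangle n ε i = t := by
  obtain ⟨x, y, z, hxy, hyz, hmem⟩ := exists_eq_filter_of_card_eq_three ht.1
  have hx := (hmem x).2 (by simp)
  have hy := (hmem y).2 (by simp)
  have hz := (hmem z).2 (by simp)
  obtain ⟨i, hi, h⟩ := eq_triPos_of_joined hε hδ hxy hyz (ht.2 x hx y hy hxy)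
    (ht.2 y hy z hz hyz) (ht.2 x hx z hz (hxy.trans hyz))
  refine ⟨i, hi, ?_⟩
  ext v
  rw [mem_pathTriangle, hmem, h]
  simp only [Fin.ext_iff]

theorem pathTriangle_injOn (hε : IsEndNeg n ε) {i j : ℕ} (hi : i ≤ n) (hj : j ≤ n)
    (h : pathTriangle n ε i = pathTriangle n ε j) : i = j := by
  obtain ⟨h1, h2, h3⟩ := triPos_lt hε hi
  obtain ⟨k1, k2, k3⟩ := triPos_lt hε hj
  have hv : ∀ v, v < n + 3 → ((v = (triPos n ε i).1 ∨ v = (triPos n ε i).2.1 ∨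
      v = (triPos n ε i).2.2) ↔ (v = (triPos n ε j).1 ∨ v = (triPos n ε j).2.1 ∨
      v = (triPos n ε j).2.2)) := fun v hv => by
    have : (⟨v, hv⟩ : Fin (n + 3)) ∈ pathTriangle n ε i ↔ ⟨v, hv⟩ ∈ pathTriangle n ε j := by
      rw [h]
    rwa [mem_pathTriangle, mem_pathTriangle] at this
  have e1 := hv _ (h1.trans (h2.trans h3))
  have e2 := hv _ (h2.trans h3)
  have e3 := hv _ h3
  have f1 := hv _ (k1.trans (k2.trans k3))
  have f2 := hv _ (k2.trans k3)
  have f3 := hv _ k3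
  have heq : (triPos n ε i).1 = (triPos n ε j).1 ∧ (triPos n ε i).2.1 = (triPos n ε j).2.1 ∧
      (triPos n ε i).2.2 = (triPos n ε j).2.2 := by
    clear hv
    omega
  clear hv e1 e2 e3 f1 f2 f3
  have c1 := minusCount_add_plusCount ε i
  have c2 := minusCount_add_plusCount ε j
  have c3 := count_le ε hi
  have c4 := count_le ε hj
  unfold triPos at heq
  cases hei : ε i <;> cases hej : ε j <;>
    simp only [hei, hej, Bool.false_eq_true, if_false, if_true] at heq <;> omega

/-- Negative simple roots do not cross each other, and a positive root starting at `a` crosses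
`-α_a`. -/
theorem IsModel.isTriangulation_range {f : APRoot n ≃ Diagonal n} (hf : IsModel ε δ f) :
    IsTriangulation (Set.range δ) := by
  constructor
  · rintro _ ⟨i, rfl⟩ _ ⟨j, rfl⟩
    rw [← hf.map_inl, ← hf.map_inl, hf.crosses_iff]
    exact id
  · intro d hd
    obtain ⟨r, rfl⟩ := f.surjective d
    rcases r with k | ⟨⟨a, b⟩, hab⟩
    · exact absurd ⟨k, (hf.map_inl k).symm⟩ hd
    · have h1 : a.val < b.val := hab
      have h2 := b.2
      refine ⟨δ ⟨a.val, by omega⟩, ⟨_, rfl⟩, ?_⟩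
      rw [← hf.map_inl, hf.crosses_iff]
      exact ⟨le_rfl, h1⟩

end

theorem exists_isPathTriangulation {n : ℕ} (hn : 1 ≤ n) (c : Fin (n - 1) → ℤˣ) :
    ∃ T δ, IsPathTriangulation c T δ := by
  have hε := isEndNeg_signOf c
  obtain ⟨δ, f, hf, hend⟩ := exists_isModel hn hε (0 : Fin (n + 3))
  set ε := signOf c with hεdef
  -- Counting from the vertex `0` makes positions and vertex labels agree.
  have hv : ∀ p, p < n + 3 → (vertex (0 : Fin (n + 3)) p).val = p := fun p hp => by
    have := vertex_val (0 : Fin (n + 3)) hp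
    rw [Fin.val_zero] at this
    omega
  have hδ : ∀ k, (δ k).1.1.val = 1 + minusCount ε k ∧ (δ k).1.2.val = n + 2 - plusCount ε k := by
    intro k
    have h1 := minusCount_add_plusCount ε k
    have h2 := k.2
    have h3 := (δ k).2
    have e1 := hv (1 + minusCount ε k) (by omega)
    have e2 := hv (n + 2 - plusCount ε k) (by omega)
    rcases pair_cases (hend k) with ⟨h4, h5⟩ | ⟨h4, h5⟩ <;> rw [Fin.ext_iff] at h4 h5 <;> omega
  refine ⟨Set.range δ, δ, hf.isTriangulation_range, ?_, ?_⟩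
  · let φ : Fin (n + 1) → {t : Finset (Fin (n + 3)) // IsTriangle (Set.range δ) t} := fun i =>
      ⟨pathTriangle n ε i, isTriangle_pathTriangle hn hε hδ (Nat.lt_succ_iff.1 i.2)⟩
    have hφ : Function.Bijective φ := by
      constructor
      · intro i j h
        exact Fin.ext (pathTriangle_injOn hε (Nat.lt_succ_iff.1 i.2) (Nat.lt_succ_iff.1 j.2)
          (congrArg Subtype.val h))
      · rintro ⟨t, ht⟩
        obtain ⟨i, hi, h⟩ := exists_eq_pathTriangle hε hδ ht
        exact ⟨⟨i, Nat.lt_succ_iff.2 hi⟩, Subtype.ext h⟩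
    have hsub : ∀ (k : Fin n) (i : Fin (n + 1)), endpoints (δ k) ⊆ (φ i).1 ↔
        i.val = k.val ∨ i.val = k.val + 1 := fun k i =>
      endpoints_subset_pathTriangle_iff hδ k (Nat.lt_succ_iff.1 i.2)
    refine ⟨⟨Equiv.ofBijective φ hφ, ?_⟩, fun i => ⟨⟨i, rfl⟩, (hsub _ _).2 (Or.inl rfl),
      (hsub _ _).2 (Or.inr rfl)⟩⟩
    intro i j
    rw [SimpleGraph.pathGraph_adj]
    have hi := i.2
    have hj := j.2
    constructor
    · rintro ⟨hne, _, ⟨k, rfl⟩, h1, h2⟩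
      have h1 := (hsub k i).1 h1
      have h2 := (hsub k j).1 h2
      have : i.val ≠ j.val := fun h => hne (congrArg φ (Fin.ext h))
      omega
    · intro h
      refine ⟨fun he => ?_, ?_⟩
      · rw [hφ.1 he] at h
        omega
      · rcases h with h | h
        · exact ⟨_, ⟨⟨i.val, by omega⟩, rfl⟩, (hsub _ i).2 (Or.inl rfl),
            (hsub _ j).2 (Or.inr h.symm)⟩
        · exact ⟨_, ⟨⟨j.val, by omega⟩, rfl⟩, (hsub _ i).2 (Or.inr h.symm),
            (hsub _ j).2 (Or.inl rfl)⟩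
  · intro i
    have hi := i.2
    have d1 := hδ ⟨i, by omega⟩
    have d2 := hδ ⟨i + 1, by omega⟩
    have hs : ε (i.val + 1) = decide (c i = 1) := signOf_succ c i
    have c1 := minusCount_add_plusCount ε i
    simp only [minusCount, plusCount, hs] at d1 d2
    constructor
    · intro hc
      simp only [hc, decide_true, if_true] at d2
      have hx : (δ ⟨i, by omega⟩).1.1 = (δ ⟨i + 1, by omega⟩).1.1 := Fin.ext (by omega)
      refine ⟨(δ ⟨i, by omega⟩).1.1, (δ ⟨i, by omega⟩).1.2, (δ ⟨i + 1, by omega⟩).1.2, rfl,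
        by rw [hx]; rfl, Or.inl ?_⟩
      simp only [Fin.lt_def]
      omega
    · intro hc
      simp only [hc, show decide ((-1 : ℤˣ) = 1) = false by decide, Bool.false_eq_true,
        if_false] at d2
      have hx : (δ ⟨i, by omega⟩).1.2 = (δ ⟨i + 1, by omega⟩).1.2 := Fin.ext (by omega)
      refine ⟨(δ ⟨i, by omega⟩).1.2, (δ ⟨i, by omega⟩).1.1, (δ ⟨i + 1, by omega⟩).1.1,
        Finset.pair_comm _ _, by rw [hx]; exact Finset.pair_comm _ _, Or.inr (Or.inl ?_)⟩
      simp only [Fin.lt_def]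
      omega

end CClusterFan

/-! ### Proof of the proposition -/

theorem mainTheorem10 (n : ℕ) (hn : 1 ≤ n) :
    (CClusterFan.IsCompatibilityFamily (CClusterFan.CCompatible (n := n)) ∧
      ∀ R : Equiv.Perm (Fin (n + 1)) → CClusterFan.rootSpace n → CClusterFan.rootSpace n → Prop,
        CClusterFan.IsCompatibilityFamily R →
          ∀ w, CClusterFan.IsCoxeterElement w →
            ∀ α ∈ CClusterFan.almostPositiveRoots n, ∀ β ∈ CClusterFan.almostPositiveRoots n,
              (R w α β ↔ CClusterFan.CCompatible w α β)) ∧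
    (∀ c : Fin (n - 1) → ℤˣ,
      (∃ T δ, CClusterFan.IsPathTriangulation c T δ) ∧
      (∃ w, CClusterFan.IsCoxeterElementOfSigns c w) ∧
      ∀ (T : Set (CClusterFan.Diagonal n)) (δ : Fin n → CClusterFan.Diagonal n),
        CClusterFan.IsPathTriangulation c T δ →
          (∃ ω, CClusterFan.IsAdmissibleWeight δ ω) ∧
          ∀ ω, CClusterFan.IsAdmissibleWeight δ ω →
            CClusterFan.IsPolytope (CClusterFan.assII δ ω) ∧
            ∀ w, CClusterFan.IsCoxeterElementOfSigns c w →
              CClusterFan.normalFan (CClusterFan.assII δ ω) = CClusterFan.cClusterFan w) ∧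
    (∀ w : Equiv.Perm (Fin (n + 1)), CClusterFan.IsCoxeterElement w →
      ∃ P : Set (Module.Dual ℝ (CClusterFan.rootSpace n)),
        CClusterFan.IsPolytope P ∧ CClusterFan.normalFan P = CClusterFan.cClusterFan w) := by
  have part2 : ∀ c : Fin (n - 1) → ℤˣ,
      (∃ T δ, CClusterFan.IsPathTriangulation c T δ) ∧
      (∃ w, CClusterFan.IsCoxeterElementOfSigns c w) ∧
      ∀ (T : Set (CClusterFan.Diagonal n)) (δ : Fin n → CClusterFan.Diagonal n),
        CClusterFan.IsPathTriangulation c T δ →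
          (∃ ω, CClusterFan.IsAdmissibleWeight δ ω) ∧
          ∀ ω, CClusterFan.IsAdmissibleWeight δ ω →
            CClusterFan.IsPolytope (CClusterFan.assII δ ω) ∧
            ∀ w, CClusterFan.IsCoxeterElementOfSigns c w →
              CClusterFan.normalFan (CClusterFan.assII δ ω) = CClusterFan.cClusterFan w := by
    intro c
    refine ⟨CClusterFan.exists_isPathTriangulation hn c,
      CClusterFan.exists_isCoxeterElementOfSigns c, fun T δ hδ => ?_⟩
    obtain ⟨A, hA⟩ := hδ.exists_endpoints hn
    obtain ⟨f, hf⟩ :=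
      CClusterFan.exists_isModel_of_endpoints hn (CClusterFan.isEndNeg_signOf c) A hA
    refine ⟨hf.exists_isAdmissibleWeight, fun ω hω => ⟨hf.isPolytope_assII hω, fun w hw => ?_⟩⟩
    refine hf.normalFan_assII hω (hw.imp fun l h => ⟨h.1, h.2.2⟩) fun m h0 hm => ?_
    -- Only the interior signs are compared. At `0` and `n`, `signOf c` is negative by convention
    -- and need not agree with `permSign w`.
    obtain ⟨m, rfl⟩ : ∃ k, m = k + 1 := ⟨m - 1, by omega⟩
    exact (CClusterFan.signOf_succ c ⟨m, by omega⟩).trans (hw.permSign_eq ⟨m, by omega⟩).symm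
  refine ⟨⟨CClusterFan.isCompatibilityFamily_cCompatible n, fun R hR w hw α hα β hβ => ?_⟩,
    part2, fun w hw => ?_⟩
  · rw [CClusterFan.almostPositiveRoots_eq_range] at hα hβ
    obtain ⟨r, rfl⟩ := hα
    obtain ⟨s, rfl⟩ := hβ
    rw [hR.iff_compatible hw,
      (CClusterFan.isCompatibilityFamily_cCompatible n).iff_compatible hw]
  · obtain ⟨c, hc⟩ := hw.exists_signs
    obtain ⟨⟨T, δ, hδ⟩, -, h⟩ := part2 c
    obtain ⟨⟨ω, hω⟩, h⟩ := h T δ hδ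
    exact ⟨_, (h ω hω).1, (h ω hω).2 w hc⟩
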